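/- **Setting.** Let $\beta>0$, $L>0$, $c^*>0$, and integers $d\ge 1$, $n\ge 2$. Let $\ell=\lfloor\beta\rfloor$ be the largest integer *strictly* less than $\beta$, and put $\ell_+=\max(\ell,1)$. Let $\mathcal P_{\mathcal H}(\beta,L)$ be the set of probability densities $f:\mathbb R^d\to\mathbb R$ that are supported on $[0,1]^d$, are $\ell$ times differentiable, and satisfy $|D^sf(x)-D^sf(y)|\le L|x-y|_2^{\beta-\ell}$ for all $x,y\in\mathbb R^d$ and all multi-indices $s$ with $|s|=\ell$. Let $\mathbb P_f,\mathbb E_f$ refer to $n$ i.i.d. draws from $f$, and let $\varepsilon=c^*n^{-\beta/(2\beta+d)}$. Let $\hat f$ be a density estimator (measurable in the sample at each point of $[0,1]^d$) such that for all $y\in[0,1]^d$ and $\varepsilon\le t\le 1$ $$\sup_{f\in\mathcal P_{\mathcal H}(\beta,L)}\mathbb P_f\big[|\hat f(y)-f(y)|>t\big]\le 2\exp(-t^2/\varepsilon^2).$$ Set $K=\lfloor n^{1/(2\beta+d)}\rfloor$ and divide $[0,1]^d$ into the $K^d$ sub-cubes $I_{\vec j}=\frac1K(\vec j+[0,1]^d)$,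 $\vec j\in\{0,\dots,K-1\}^d$. The mesh consists of the points $\frac1K(\vec j+\frac{s}{\ell})$, $s\in\mathbb Z_{\ge0}^d$, $|s|\le\ell$ (with $s/\ell:=0$ if $\ell=0$), i.e. of the rescaled $\ell$-th principal lattices of the sub-cubes. **Model.** Algorithms are programs of a unit-cost real random access machine (arithmetic on, and comparison of, reals and natural numbers; no rounding of reals). They are given $n,d,\ell,K,\binom{\ell+d}{d}$, the number of binary digits of $n$, and the real number $L$. A preprocessing program has oracle access to $\hat f$, each call taking time $Q$, and outputs a string of bits; a query program receives only that string and a point $y\in[0,1]^d$, and returns a real number $\tilde f(y)$. **Theorem.** There are an absolute constant $C$, one preprocessing program and one query program, the same for all $\beta,L,c^*,d,n,\hat f$, such that the resulting estimator $\tilde f$ has the following properties. 1. For every sample, $\tilde f$ is constructed in time at most $C\,Q\binom{\ell+d}{d}n^{d/(2\beta+d)}$ for every $Q\ge d+\log n$. At most $\binom{\ell+d}{d}n^{d/(2\beta+d)}$ queries of $\hat f$ are made, all at points of the mesh. 2. For every sample, at most $C\,d^2\ell_+^2\binom{\ell+d}{d}n^{d/(2\beta+d)}\log n$ bits are stored.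 3. For every sample and every $y\in[0,1]^d$, $\tilde f(y)$ is computed from the stored bits in time at most $C\,d\,\ell_+\binom{\ell+d}{d}\log n$. 4. For every sample, $\tilde f$ is on each sub-cube $I_{\vec j}$ a polynomial of degree at most $\ell$ whose values at the mesh points of $I_{\vec j}$ agree up to $L/n$ with the values of $\hat f$ truncated to $[0,L]$ (on common faces of sub-cubes, $\tilde f$ is given by the polynomial of one of them). For every $y\in[0,1]^d$, $\tilde f(y)$ is measurable in the sample. 5. If $\varepsilon\sqrt{\log\big(2\binom{\ell+d}{d}n^{\frac{d}{2\beta+d}+2}\big)}\le 1$ (for fixed $\beta,d,c^*$ this holds for all large $n$), then for every $f\in\mathcal P_{\mathcal H}(\beta,L)$ the norm $\|\tilde f-f\|_\infty=\sup_{y\in[0,1]^d}|\tilde f(y)-f(y)|$ is measurable in the sample and $$\mathbb E_f\|\tilde f-f\|_\infty<\tilde c\,(\log n)^{1/2}n^{-\frac{\beta}{2\beta+d}},\qquad \tilde c=10\binom{\ell+d}{\ell}^3(2\ell)^{2\ell}\Big\{c^*+\frac{Ld^\beta}{\ell!}\Big\}+2Ld^{\frac12(3\ell+1)},$$ where $0^0=1$.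 -/

import Mathlib

open MeasureTheory

namespace DensityInterp

/-! ## Hölder densities and the sampling model -/

/-- `d`-dimensional Euclidean space. -/
abbrev E (d : ℕ) : Type := EuclideanSpace ℝ (Fin d)

/-- The unit cube `[0,1]^d`. -/
def cube (d : ℕ) : Set (E d) := {y | ∀ i, 0 ≤ y i ∧ y i ≤ 1}

/-- The largest integer strictly less than `β` (for `β > 0`). -/
noncomputable def strictFloor (β : ℝ) : ℕ := ⌈β⌉₊ - 1

/-- The partial derivative `∂^ℓ f / ∂x_{i 0} ⋯ ∂x_{i (ℓ-1)}` at `x`. As `i` ranges over all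
sequences of length `ℓ`, these are all the `D^s f` with `|s| = ℓ`. -/
noncomputable def partialDeriv {d ℓ : ℕ} (f : E d → ℝ) (i : Fin ℓ → Fin d) (x : E d) : ℝ :=
  iteratedFDeriv ℝ ℓ f x (fun r => EuclideanSpace.single (i r) (1 : ℝ))

/-- Probability densities on `ℝ^d` that are supported on the unit cube and `L`-Hölder smooth of
order `β`: all partial derivatives of order `ℓ = strictFloor β` exist and are `(β - ℓ)`-Hölder
with constant `L` (hence are continuous). -/
structure IsHolderDensity (d : ℕ) (β L : ℝ) (f : E d → ℝ) : Prop where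
  supported : ∀ x, x ∉ cube d → f x = 0
  smooth : ContDiff ℝ (strictFloor β : ℕ) f
  holder : ∀ (i : Fin (strictFloor β) → Fin d) (x y : E d),
    |partialDeriv f i x - partialDeriv f i y| ≤ L * ‖x - y‖ ^ (β - (strictFloor β : ℝ))
  nonneg : ∀ x, 0 ≤ f x
  integral_eq_one : ∫ x, f x = 1

/-- Samples of size `n`. -/
abbrev Sample (n d : ℕ) : Type := Fin n → E d

/-- The law of `n` independent draws from the density `f`. -/
noncomputable def sampleLaw (n : ℕ) {d : ℕ} (f : E d → ℝ) : Measure (Sample n d) :=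
  Measure.pi fun _ => (volume : Measure (E d)).withDensity fun x => ENNReal.ofReal (f x)

/-- The rate `n^{-β/(2β+d)}`. -/
noncomputable def rate (n d : ℕ) (β : ℝ) : ℝ := (n : ℝ) ^ (-(β / (2 * β + d)))

/-- The pointwise error of the estimator `fhat` is sub-Gaussian at scale
`ε = cstar * n^{-β/(2β+d)}`, uniformly over the Hölder densities: for all `y` in the cube and
all `ε ≤ t ≤ 1` the probability of an error larger than `t` is at most `2 exp(-t²/ε²)`. -/
def TailBound {n d : ℕ} (β L cstar : ℝ) (fhat : Sample n d → E d → ℝ) : Prop :=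
  ∀ y ∈ cube d, ∀ t : ℝ, cstar * rate n d β ≤ t → t ≤ 1 →
    ∀ f : E d → ℝ, IsHolderDensity d β L f →
      sampleLaw n f {X | t < |fhat X y - f y|} ≤
        ENNReal.ofReal (2 * Real.exp (-(t ^ 2 / (cstar * rate n d β) ^ 2)))

/-- The supremum norm over the cube of the difference of two functions. -/
noncomputable def supDist {d : ℕ} (g f : E d → ℝ) : ENNReal :=
  ⨆ y ∈ cube d, ‖g y - f y‖ₑ

/-! ## The mesh -/

/-- The number `⌊n^{1/(2β+d)}⌋` of sub-cubes along each axis. -/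
noncomputable def gridSize (n d : ℕ) (β : ℝ) : ℕ := ⌊(n : ℝ) ^ (1 / (2 * β + d))⌋₊

/-- The closed sub-cube `(j + [0,1]^d) / K`. -/
def subCube {d : ℕ} (K : ℕ) (j : Fin d → Fin K) : Set (E d) :=
  {y | ∀ i, ((j i : ℕ) : ℝ) / K ≤ y i ∧ y i ≤ (((j i : ℕ) : ℝ) + 1) / K}

/-- The point `(j + s/ℓ) / K`. For `s` in `ℕ^d` with `|s| ≤ ℓ` the points `s/ℓ` form the `ℓ`-th
principal lattice of the simplex with vertices `0, e_1, …, e_d` (its barycentric coordinates are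
`s_i/ℓ` and `1 - |s|/ℓ`); for `ℓ = 0` the lattice is the origin. -/
noncomputable def meshPoint {d : ℕ} (ℓ K : ℕ) (j : Fin d → Fin K) (s : Fin d → ℕ) : E d :=
  WithLp.toLp 2 fun i => (((j i : ℕ) : ℝ) + (s i : ℝ) / ℓ) / K

/-- Truncation of a real number to `[0, L]`. -/
noncomputable def clip (L v : ℝ) : ℝ := max 0 (min v L)

/-! ## A real random access machine

The machine has arrays of natural numbers and arrays of real numbers, a read-only store of bits,
an output tape of bits and an oracle for a function on `ℝ^d`. Arithmetic operations, memory
accesses and comparisons have unit cost. Real numbers cannot be rounded or converted to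
natural numbers: they influence the natural numbers and the output through comparisons only. -/

/-- Natural number expressions; `stored i` is the `i`-th bit of the read-only store. -/
inductive NExp : Type
  | lit (c : ℕ)
  | get (a : ℕ) (i : NExp)
  | stored (i : NExp)
  | add (e e' : NExp)
  | sub (e e' : NExp)
  | mul (e e' : NExp)

/-- Real expressions. -/
inductive RExp : Type
  | ofNat (e : NExp)
  | get (a : ℕ) (i : NExp)
  | add (x x' : RExp)
  | sub (x x' : RExp)
  | mul (x x' : RExp)
  | div (x x' : RExp)

/-- Tests. -/
inductive Test : Type
  | natLE (e e' : NExp)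
  | realLE (x x' : RExp)

/-- Programs. `ask src dst i` calls the oracle at the point whose coordinates are the first `d`
entries of the real array `src` and puts the answer in entry `i` of the real array `dst`.
`emit e` appends a bit to the output, namely whether `e` is nonzero. `loop e c` repeats
`c` as often as the value of `e` on entry says. -/
inductive Prog : Type
  | skip
  | setNat (a : ℕ) (i e : NExp)
  | setReal (a : ℕ) (i : NExp) (x : RExp)
  | ask (src dst : ℕ) (i : NExp)
  | emit (e : NExp)
  | seq (c c' : Prog)
  | ite (b : Test) (c c' : Prog)
  | loop (e : NExp) (c : Prog)

/-- Configurations. `asked` records the points at which the oracle was called, `steps` the number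
of elementary steps so far; programs cannot read either of them. -/
structure Config (d : ℕ) : Type where
  nat : ℕ → ℕ → ℕ
  real : ℕ → ℕ → ℝ
  out : List Bool
  asked : List (E d)
  steps : ℕ

/-- Number of operations in an expression. -/
def NExp.cost : NExp → ℕ
  | lit _ => 1
  | get _ i => i.cost + 1
  | stored i => i.cost + 1
  | add e e' => e.cost + e'.cost + 1
  | sub e e' => e.cost + e'.cost + 1
  | mul e e' => e.cost + e'.cost + 1

/-- Number of operations in an expression. -/
def RExp.cost : RExp → ℕ
  | ofNat e => e.cost + 1
  | get _ i => i.cost + 1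
  | add x x' => x.cost + x'.cost + 1
  | sub x x' => x.cost + x'.cost + 1
  | mul x x' => x.cost + x'.cost + 1
  | div x x' => x.cost + x'.cost + 1

/-- Number of operations in a test. -/
def Test.cost : Test → ℕ
  | natLE e e' => e.cost + e'.cost + 1
  | realLE x x' => x.cost + x'.cost + 1

/-- Value of a natural number expression (subtraction is truncated at `0`, and bits beyond the
end of the store are `0`). -/
def NExp.eval {d : ℕ} (store : List Bool) (σ : Config d) : NExp → ℕ
  | lit c => c
  | get a i => σ.nat a (i.eval store σ)
  | stored i => if store.getD (i.eval store σ) false then 1 else 0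
  | add e e' => e.eval store σ + e'.eval store σ
  | sub e e' => e.eval store σ - e'.eval store σ
  | mul e e' => e.eval store σ * e'.eval store σ

/-- Value of a real expression (division by `0` gives `0`). -/
noncomputable def RExp.eval {d : ℕ} (store : List Bool) (σ : Config d) : RExp → ℝ
  | ofNat e => (e.eval store σ : ℝ)
  | get a i => σ.real a (i.eval store σ)
  | add x x' => x.eval store σ + x'.eval store σ
  | sub x x' => x.eval store σ - x'.eval store σ
  | mul x x' => x.eval store σ * x'.eval store σ
  | div x x' => x.eval store σ / x'.eval store σ

/-- Whether a test succeeds. -/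
def Test.holds {d : ℕ} (store : List Bool) (σ : Config d) : Test → Prop
  | natLE e e' => e.eval store σ ≤ e'.eval store σ
  | realLE x x' => x.eval store σ ≤ x'.eval store σ

/-- Count `k` further steps. -/
def Config.tick {d : ℕ} (k : ℕ) (σ : Config d) : Config d := { σ with steps := σ.steps + k }

/-- Overwrite entry `i` of array `a`. -/
def write {α : Type} (m : ℕ → ℕ → α) (a i : ℕ) (v : α) : ℕ → ℕ → α :=
  Function.update m a (Function.update (m a) i v)

open Classical in
/-- The effect of a program, with the oracle `g` and the given read-only store. -/
noncomputable def Prog.run {d : ℕ} (g : E d → ℝ) (store : List Bool) :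
    Prog → Config d → Config d
  | skip, σ => σ
  | setNat a i e, σ =>
      { σ.tick (i.cost + e.cost + 1) with
        nat := write σ.nat a (i.eval store σ) (e.eval store σ) }
  | setReal a i x, σ =>
      { σ.tick (i.cost + x.cost + 1) with
        real := write σ.real a (i.eval store σ) (x.eval store σ) }
  | ask src dst i, σ =>
      let u : E d := WithLp.toLp 2 fun k => σ.real src k
      { σ.tick (i.cost + 1) with
        real := write σ.real dst (i.eval store σ) (g u)
        asked := σ.asked ++ [u] }
  | emit e, σ =>
      { σ.tick (e.cost + 1) with out := σ.out ++ [decide (e.eval store σ ≠ 0)] }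
  | seq c c', σ => c'.run g store (c.run g store σ)
  | ite b c c', σ =>
      if b.holds store σ then c.run g store (σ.tick (b.cost + 1))
      else c'.run g store (σ.tick (b.cost + 1))
  | loop e c, σ =>
      (fun τ => c.run g store (τ.tick 1))^[e.eval store σ] (σ.tick (e.cost + 1))

/-- Initial configuration. The natural array `0` starts with the sample size `n`, the dimension
`d`, the degree `ℓ`, the number `K` of sub-cubes per axis, the number `binom(ℓ+d, d)` of lattice
points and the number of binary digits of `n`. The real array `0` starts with `L`, and the real
array `1` with the coordinates of the input point `y`. Everything else is `0`. -/
noncomputable def start (n d ℓ K : ℕ) (L : ℝ) (y : E d) : Config d where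
  nat := fun a i => if a = 0 then [n, d, ℓ, K, (ℓ + d).choose d, n.size].getD i 0 else 0
  real := fun a i =>
    if a = 0 ∧ i = 0 then L else if h : a = 1 ∧ i < d then y ⟨i, h.2⟩ else 0
  out := []
  asked := []
  steps := 0

/-- The final configuration of the preprocessing program, run with oracle access to the function
`g`. -/
noncomputable def preprocess (pre : Prog) (n d : ℕ) (β L : ℝ) (g : E d → ℝ) : Config d :=
  pre.run g [] (start n d (strictFloor β) (gridSize n d β) L 0)

/-- The final configuration of the query program at the point `y`. It has access to the stored
bits only (its oracle is identically `0`). -/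
noncomputable def evaluate (qry : Prog) (n d : ℕ) (β L : ℝ) (bits : List Bool) (y : E d) :
    Config d :=
  qry.run (fun _ => 0) bits (start n d (strictFloor β) (gridSize n d β) L y)

/-- The function computed by preprocessing `g` and querying the stored bits: the query
program leaves its answer in entry `0` of the real array `2`. -/
noncomputable def compressed (pre qry : Prog) (n d : ℕ) (β L : ℝ) (g : E d → ℝ) (y : E d) : ℝ :=
  (evaluate qry n d β L (preprocess pre n d β L g).out y).real 2 0

/-- Total running time of a computation if each oracle call takes time `Q`. -/
def Config.time {d : ℕ} (Q : ℝ) (σ : Config d) : ℝ := σ.steps + Q * σ.asked.length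

/-- `ftilde` is a piecewise polynomial interpolant of `g`, truncated to `[0, L]`, on the mesh
with `K` sub-cubes per axis: on each sub-cube it is a polynomial of degree at most `ℓ` whose values
on the rescaled principal lattice agree with those of the truncation of `g` up to `δ`. (On a common
face of several sub-cubes the polynomial of any one of them may be used.) -/
def IsInterpolant {d : ℕ} (ℓ K : ℕ) (L δ : ℝ) (g ftilde : E d → ℝ) : Prop :=
  ∃ q : (Fin d → Fin K) → MvPolynomial (Fin d) ℝ,
    (∀ j, (q j).totalDegree ≤ ℓ) ∧
    (∀ j (s : Fin d → ℕ), ∑ i, s i ≤ ℓ →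
      |MvPolynomial.eval (fun i => meshPoint ℓ K j s i) (q j) - clip L (g (meshPoint ℓ K j s))|
        ≤ δ) ∧
    ∀ y ∈ cube d, ∃ j, y ∈ subCube K j ∧ ftilde y = MvPolynomial.eval (fun i => y i) (q j)

/-- The number `binom(ℓ+d, d) * n^{d/(2β+d)}` of mesh points, up to rounding. -/
noncomputable def meshCount (n d : ℕ) (β : ℝ) : ℝ :=
  ((strictFloor β + d).choose d : ℝ) * (n : ℝ) ^ ((d : ℝ) / (2 * β + d))

/-- The constant in the risk bound, with `ℓ = strictFloor β`:
`10 binom(ℓ+d, ℓ)^3 (2ℓ)^{2ℓ} (cstar + L d^β / ℓ!) + 2 L d^{(3ℓ+1)/2}`, where `0^0 = 1`. -/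
noncomputable def riskConst (d : ℕ) (β L cstar : ℝ) : ℝ :=
  10 * ((strictFloor β + d).choose (strictFloor β) : ℝ) ^ 3
      * (2 * (strictFloor β : ℝ)) ^ (2 * strictFloor β)
      * (cstar + L * (d : ℝ) ^ β / ((strictFloor β).factorial : ℝ))
    + 2 * L * (d : ℝ) ^ ((3 * (strictFloor β : ℝ) + 1) / 2)

end DensityInterp

namespace DensityInterp

/-! ## Frames and running times of programs -/

/-! On each sub-cube the new estimator is the Lagrange interpolant of degree `ℓ` at the principal
lattice, built from values of `fhat` that are truncated to `[0, L]` and cut off after `n.size`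
binary digits. A lattice point corresponds to a composition `s` of `ℓ` into `d + 1` parts. In
barycentric coordinates `z` scaled to sum `ℓ`, its Lagrange polynomial is the product of the
generalized binomials `binom(z_k, s_k)` (`basis`).

Programs. The preprocessing program enumerates sub-cubes with a base-`K` counter and lattice points
with a successor rule for compositions. It emits the binary digits of each value greedily, by
comparisons. All blocks of bits have the same length, so the query program finds its block by
arithmetic. Since reals cannot be rounded, it locates the sub-cube by binary search along each axis,
and then it runs through the compositions in the same order. One term costs `O(d + ℓ + log n)`
because the Lagrange polynomial has `ℓ` factors. The correctness of both programs is summed up in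
`compressed_eq`, after which only the formula `interpolate` matters.

Interpolation error. The absorption identity for binomials yields that the scheme reproduces
products of at most `ℓ` affine factors (`sum_basis_mul_listProd`). Applied to the Taylor polynomial
of `f` at the query point `y`, it returns `f y` (`sum_basis_mul_taylorSum`). Hence the error at `y`
is a combination of the differences between stored values and Taylor values at the mesh points. It
is at most the Lebesgue constant times the sum of the quantization error `L / n`, the largest error
`t` of `fhat` on the mesh, and the Hölder remainder `L (d / K)^β / ℓ!`
(`IsHolderDensity.abs_interpolate_sub_le`).

Risk. Take `t = ε √A`, where `A` is the logarithm of `2 binom(ℓ+d, d) n^(d/(2β+d) + 2)`. A union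
bound over the mesh shows that `fhat` is off by more than `t` somewhere on it with probability at
most `n^(-2)`. Truncation costs nothing because every `f` in the class is bounded by `L`
(`IsHolderDensity.le_bound`: expand at a point just outside the cube, where all derivatives vanish).
It also keeps the error bounded on the bad event. What remains is a comparison of constants
(`risk_bound_lt`).

Measurability is cheap: the stored bits take countably many values, and both the estimator and its
sup-norm error are functions of these bits. -/

theorem write_apply {α : Type} (m : ℕ → ℕ → α) (a i : ℕ) (v : α) (b k : ℕ) :
    write m a i v b k = if b = a ∧ k = i then v else m b k := by
  unfold write
  by_cases hb : b = a
  · subst hb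
    by_cases hk : k = i <;> simp [hk]
  · simp [hb]

/-- Whether a program may write to the array `a` of natural numbers. -/
def Prog.writesNat (a : ℕ) : Prog → Bool
  | skip | setReal .. | ask .. | emit .. => false
  | setNat b _ _ => a == b
  | seq c c' => c.writesNat a || c'.writesNat a
  | ite _ c c' => c.writesNat a || c'.writesNat a
  | loop _ c => c.writesNat a

/-- Whether a program may write to the array `a` of real numbers. -/
def Prog.writesReal (a : ℕ) : Prog → Bool
  | skip | setNat .. | emit .. => false
  | setReal b _ _ => a == b
  | ask _ b _ => a == b
  | seq c c' => c.writesReal a || c'.writesReal a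
  | ite _ c c' => c.writesReal a || c'.writesReal a
  | loop _ c => c.writesReal a

/-- Whether a program contains an output instruction. -/
def Prog.emits : Prog → Bool
  | skip | setNat .. | setReal .. | ask .. => false
  | emit _ => true
  | seq c c' => c.emits || c'.emits
  | ite _ c c' => c.emits || c'.emits
  | loop _ c => c.emits

/-- Whether a program contains an oracle call. -/
def Prog.asks : Prog → Bool
  | skip | setNat .. | setReal .. | emit .. => false
  | ask .. => true
  | seq c c' => c.asks || c'.asks
  | ite _ c c' => c.asks || c'.asks
  | loop _ c => c.asks

/-- The configurations `σ` and `τ` agree on everything that the program `c` cannot change. -/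
structure Frame {d : ℕ} (c : Prog) (σ τ : Config d) : Prop where
  nat : ∀ a, c.writesNat a = false → τ.nat a = σ.nat a
  real : ∀ a, c.writesReal a = false → τ.real a = σ.real a
  out : c.emits = false → τ.out = σ.out
  asked : c.asks = false → τ.asked = σ.asked

theorem Frame.refl {d : ℕ} (c : Prog) (σ : Config d) : Frame c σ σ :=
  ⟨fun _ _ => rfl, fun _ _ => rfl, fun _ => rfl, fun _ => rfl⟩

theorem Frame.trans {d : ℕ} {c : Prog} {σ τ υ : Config d} (h : Frame c σ τ) (h' : Frame c τ υ) :
    Frame c σ υ :=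
  ⟨fun a ha => (h'.nat a ha).trans (h.nat a ha), fun a ha => (h'.real a ha).trans (h.real a ha),
    fun ha => (h'.out ha).trans (h.out ha), fun ha => (h'.asked ha).trans (h.asked ha)⟩

theorem Frame.tick {d : ℕ} (c : Prog) (σ : Config d) (k : ℕ) : Frame c σ (σ.tick k) :=
  ⟨fun _ _ => rfl, fun _ _ => rfl, fun _ => rfl, fun _ => rfl⟩

/-- A property of configurations that is kept by the body of a loop is kept by the loop. -/
theorem iterate_invariant {α : Type*} (f : α → α) (I : ℕ → α → Prop) {N : ℕ} {x : α} (h0 : I 0 x)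
    (hs : ∀ i < N, ∀ y, I i y → I (i + 1) (f y)) : I N (f^[N] x) := by
  induction N with
  | zero => simpa
  | succ N ih =>
    rw [Function.iterate_succ_apply']
    exact hs N (Nat.lt_succ_self N) _ (ih fun i hi => hs i (hi.trans (Nat.lt_succ_self N)))

section
variable {d : ℕ} (g : E d → ℝ) (st : List Bool)

/-- The footprint of a program is read off its syntax. For a concrete fragment the side conditions
of `Frame` therefore close by `rfl`, and invariants need not mention arrays that the fragment leaves
alone. -/
theorem Prog.frame (c : Prog) (σ : Config d) : Frame c σ (c.run g st σ) := by
  induction c generalizing σ with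
  | skip => exact Frame.refl _ _
  | setNat a i e =>
    refine ⟨fun b hb => ?_, fun _ _ => rfl, fun _ => rfl, fun _ => rfl⟩
    have : b ≠ a := by simpa [writesNat] using hb
    funext k
    simp [run, write_apply, this]
  | setReal a i x =>
    refine ⟨fun _ _ => rfl, fun b hb => ?_, fun _ => rfl, fun _ => rfl⟩
    have : b ≠ a := by simpa [writesReal] using hb
    funext k
    simp [run, write_apply, this]
  | ask s a i =>
    refine ⟨fun _ _ => rfl, fun b hb => ?_, fun _ => rfl, fun h => by simp [asks] at h⟩
    have : b ≠ a := by simpa [writesReal] using hb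
    funext k
    simp [run, write_apply, this]
  | emit e => exact ⟨fun _ _ => rfl, fun _ _ => rfl, fun h => by simp [emits] at h, fun _ => rfl⟩
  | seq c c' ih ih' =>
    have h1 := ih σ
    have h2 := ih' (c.run g st σ)
    refine ⟨fun b hb => ?_, fun b hb => ?_, fun hb => ?_, fun hb => ?_⟩
    · simp only [writesNat, Bool.or_eq_false_iff] at hb
      exact (h2.nat b hb.2).trans (h1.nat b hb.1)
    · simp only [writesReal, Bool.or_eq_false_iff] at hb
      exact (h2.real b hb.2).trans (h1.real b hb.1)
    · simp only [emits, Bool.or_eq_false_iff] at hb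
      exact (h2.out hb.2).trans (h1.out hb.1)
    · simp only [asks, Bool.or_eq_false_iff] at hb
      exact (h2.asked hb.2).trans (h1.asked hb.1)
  | ite b c c' ih ih' =>
    have h1 := ih (σ.tick (b.cost + 1))
    have h2 := ih' (σ.tick (b.cost + 1))
    refine ⟨fun a ha => ?_, fun a ha => ?_, fun ha => ?_, fun ha => ?_⟩
    · simp only [writesNat, Bool.or_eq_false_iff] at ha
      simp only [run]
      split_ifs
      exacts [h1.nat a ha.1, h2.nat a ha.2]
    · simp only [writesReal, Bool.or_eq_false_iff] at ha
      simp only [run]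
      split_ifs
      exacts [h1.real a ha.1, h2.real a ha.2]
    · simp only [emits, Bool.or_eq_false_iff] at ha
      simp only [run]
      split_ifs
      exacts [h1.out ha.1, h2.out ha.2]
    · simp only [asks, Bool.or_eq_false_iff] at ha
      simp only [run]
      split_ifs
      exacts [h1.asked ha.1, h2.asked ha.2]
  | loop e c ih =>
    have key : Frame c σ ((Prog.loop e c).run g st σ) :=
      iterate_invariant _ (fun _ τ => Frame c σ τ) (Frame.tick c σ _) fun i _ τ hτ =>
        hτ.trans ((Frame.tick c τ 1).trans (ih _))
    exact ⟨key.nat, key.real, key.out, key.asked⟩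

theorem Prog.run_seq (c c' : Prog) (σ : Config d) :
    (Prog.seq c c').run g st σ = c'.run g st (c.run g st σ) := rfl

/-- The invariant rule for loops. -/
theorem Prog.loop_invariant (e : NExp) (c : Prog) (σ : Config d) (I : ℕ → Config d → Prop)
    (h0 : I 0 (σ.tick (e.cost + 1)))
    (hs : ∀ i < e.eval st σ, ∀ τ, Frame c σ τ → I i τ → I (i + 1) (c.run g st (τ.tick 1))) :
    I (e.eval st σ) ((Prog.loop e c).run g st σ) := by
  have := iterate_invariant (fun τ => c.run g st (τ.tick 1))
    (fun i τ => Frame c σ τ ∧ I i τ) (N := e.eval st σ) (x := σ.tick (e.cost + 1))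
    ⟨Frame.tick c σ _, h0⟩ fun i hi τ hτ =>
      ⟨hτ.1.trans ((Frame.tick c τ 1).trans (Prog.frame g st c _)), hs i hi τ hτ.1 hτ.2⟩
  exact this.2

/-- Whether an expression reads only the array `0` of natural numbers. -/
def NExp.static : NExp → Bool
  | lit _ => true
  | get a i => a == 0 && i.static
  | stored _ => false
  | add e e' => e.static && e'.static
  | sub e e' => e.static && e'.static
  | mul e e' => e.static && e'.static

theorem NExp.eval_static (e : NExp) (he : e.static) {σ τ : Config d} (h : τ.nat 0 = σ.nat 0) :
    e.eval st τ = e.eval st σ := by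
  induction e with
  | lit c => rfl
  | get a i ih =>
    simp only [static, Bool.and_eq_true, beq_iff_eq] at he
    obtain ⟨rfl, h2⟩ := he
    simp [eval, ih h2, h]
  | stored i => simp [static] at he
  | add e e' ih ih' | sub e e' ih ih' | mul e e' ih ih' =>
    simp only [static, Bool.and_eq_true] at he
    simp [eval, ih he.1, ih' he.2]

/-- Whether the number of iterations of every loop depends on the array `0` only. -/
def Prog.static : Prog → Bool
  | skip | setNat .. | setReal .. | ask .. | emit .. => true
  | seq c c' => c.static && c'.static
  | ite _ c c' => c.static && c'.static
  | loop e c => e.static && c.static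

/-- A bound for the number of steps of a static program. -/
def Prog.bound (σ : Config d) : Prog → ℕ
  | skip => 0
  | setNat _ i e => i.cost + e.cost + 1
  | setReal _ i x => i.cost + x.cost + 1
  | ask _ _ i => i.cost + 1
  | emit e => e.cost + 1
  | seq c c' => c.bound σ + c'.bound σ
  | ite b c c' => b.cost + 1 + max (c.bound σ) (c'.bound σ)
  | loop e c => e.cost + 1 + e.eval st σ * (1 + c.bound σ)

/-- Loop counts of a static program depend only on array `0`, which the program does not write, so
one bound computed at `σ₀` serves every iteration. Two loops are not static and get their steps
counted by hand: the loop over all sub-cubes and the inner loop of `timesBasis`. -/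
theorem Prog.steps_le (c : Prog) (hc : c.static) (hw : c.writesNat 0 = false) (σ₀ σ : Config d)
    (h : σ.nat 0 = σ₀.nat 0) : (c.run g st σ).steps ≤ σ.steps + c.bound st σ₀ := by
  induction c generalizing σ with
  | skip | setNat a i e | setReal a i e | ask s a i | emit e => simp [run, bound, Config.tick]
  | seq c c' ih ih' =>
    simp only [static, Bool.and_eq_true] at hc
    simp only [writesNat, Bool.or_eq_false_iff] at hw
    have h1 := ih hc.1 hw.1 σ h
    have h2 := ih' hc.2 hw.2 (c.run g st σ) (((Prog.frame g st c σ).nat 0 hw.1).trans h)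
    simp only [run, bound]
    omega
  | ite b c c' ih ih' =>
    simp only [static, Bool.and_eq_true] at hc
    simp only [writesNat, Bool.or_eq_false_iff] at hw
    have h1 := ih hc.1 hw.1 (σ.tick (b.cost + 1)) h
    have h2 := ih' hc.2 hw.2 (σ.tick (b.cost + 1)) h
    simp only [run, bound, Config.tick] at *
    split_ifs <;> omega
  | loop e c ih =>
    simp only [static, Bool.and_eq_true] at hc
    simp only [writesNat] at hw
    have key := Prog.loop_invariant g st e c σ
      (fun i τ => τ.steps ≤ σ.steps + (e.cost + 1) + i * (1 + c.bound st σ₀))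
      (by simp [Config.tick]) fun i hi τ hF hτ => by
        have := ih hc.2 hw (τ.tick 1) ((hF.nat 0 hw).trans h)
        simp only [Config.tick] at this ⊢
        rw [Nat.add_mul]
        omega
    rw [NExp.eval_static st e hc.1 h] at key
    simp only [bound]
    omega

end

/-! ## Program fragments -/

infixr:50 ";;" => Prog.seq

/-- The scalar variable `a`. -/
abbrev NExp.var (a : ℕ) : NExp := .get a (.lit 0)
/-- The `i`-th input. -/
abbrev NExp.inp (i : ℕ) : NExp := .get 0 (.lit i)
/-- The real scalar variable `a`. -/
abbrev RExp.var (a : ℕ) : RExp := .get a (.lit 0)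
/-- Assignment to a scalar variable. -/
abbrev Prog.set (a : ℕ) (e : NExp) : Prog := .setNat a (.lit 0) e
/-- Assignment to a real scalar variable. -/
abbrev Prog.rset (a : ℕ) (x : RExp) : Prog := .setReal a (.lit 0) x
/-- Increment of a scalar variable. -/
abbrev Prog.inc (a : ℕ) : Prog := .set a (.add (.var a) (.lit 1))

open NExp Prog

/-- Replaces the composition in the array `2` by the next one. -/
def nextComp : Prog :=
  set 3 (lit 0) ;;
  loop (inp 1) (ite (.natLE (.get 2 (var 3)) (lit 0)) (inc 3) skip) ;;
  set 4 (.get 2 (var 3)) ;;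
  setNat 2 (var 3) (lit 0) ;;
  setNat 2 (lit 0) (.sub (var 4) (lit 1)) ;;
  setNat 2 (.add (var 3) (lit 1)) (.add (.get 2 (.add (var 3) (lit 1))) (lit 1))

/-- Sets the array `2` to the composition `(ℓ, 0, …, 0)`. -/
def resetComp : Prog :=
  set 1 (lit 0) ;;
  loop (.add (inp 1) (lit 1)) (setNat 2 (var 1) (lit 0) ;; inc 1) ;;
  setNat 2 (lit 0) (inp 2)

/-- Replaces the digits in the array `5` by those of the next number. -/
def nextCell : Prog :=
  set 7 (lit 1) ;; set 1 (lit 0) ;;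
  loop (inp 1)
    (setNat 5 (var 1) (.add (.get 5 (var 1)) (var 7)) ;;
     ite (.natLE (inp 3) (.get 5 (var 1)))
      (setNat 5 (var 1) (lit 0) ;; set 7 (lit 1)) (set 7 (lit 0)) ;;
     inc 1)

/-- Puts the mesh point given by the arrays `5` and `2` into the real array `3`. -/
def makePoint : Prog :=
  set 1 (lit 0) ;;
  loop (inp 1)
    (setReal 3 (var 1)
      (.div (.add (.ofNat (.get 5 (var 1)))
        (.div (.ofNat (.get 2 (.add (var 1) (lit 1)))) (.ofNat (inp 2)))) (.ofNat (inp 3))) ;;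
     inc 1)

/-- Truncates the real variable `4` to `[0, L]`. -/
def clipValue : Prog :=
  ite (.realLE (.var 4) (.ofNat (lit 0))) (rset 4 (.ofNat (lit 0)))
    (ite (.realLE (.var 0) (.var 4)) (rset 4 (.var 0)) skip)

/-- Writes the binary digits of the real variable `4`, relative to `L`. -/
def emitDigits : Prog :=
  rset 5 (.div (.var 0) (.ofNat (lit 2))) ;;
  loop (inp 5)
    (ite (.realLE (.var 5) (.var 4)) (emit (lit 1) ;; rset 4 (.sub (.var 4) (.var 5)))
      (emit (lit 0)) ;;
     rset 5 (.div (.var 5) (.ofNat (lit 2))))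

/-- Treats one mesh point. -/
def treatPoint : Prog :=
  makePoint ;; ask 3 4 (lit 0) ;; clipValue ;; emitDigits ;; nextComp

/-- Treats one sub-cube. -/
def treatCell : Prog :=
  resetComp ;; loop (inp 4) treatPoint ;; nextCell

/-- Puts the number of sub-cubes into the variable `6`. -/
def countCells : Prog :=
  set 6 (lit 1) ;; loop (inp 1) (set 6 (.mul (var 6) (inp 3)))

/-- The preprocessing program. -/
def preProg : Prog := countCells ;; loop (var 6) treatCell

/-- The powers of two in the array `8`. -/
def makePowers : Prog :=
  setNat 8 (lit 0) (lit 1) ;; set 9 (lit 0) ;;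
  loop (inp 5)
    (setNat 8 (.add (var 9) (lit 1)) (.add (.get 8 (var 9)) (.get 8 (var 9))) ;; inc 9)

/-- One step of the binary search. -/
def searchStep : Prog :=
  set 9 (.sub (var 9) (lit 1)) ;;
  set 4 (.add (var 3) (.get 8 (var 9))) ;;
  ite (.natLE (var 4) (.sub (inp 3) (lit 1)))
    (ite (.realLE (.ofNat (var 4)) (.mul (.ofNat (inp 3)) (.get 1 (var 1)))) (set 3 (var 4)) skip)
    skip

/-- Binary search for the sub-cube along the axis in the variable `1`. The result is the variable
`3`. -/
def searchAxis : Prog :=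
  set 3 (lit 0) ;; set 9 (inp 5) ;; loop (inp 5) searchStep

/-- Locates the query point: the index of its sub-cube is put into the variable `10` and its local
barycentric coordinates into the real array `6`. -/
def locate : Prog :=
  makePowers ;; set 10 (lit 0) ;; set 6 (lit 1) ;; set 1 (lit 0) ;;
  setReal 6 (lit 0) (.ofNat (inp 2)) ;;
  loop (inp 1)
    (searchAxis ;;
     set 10 (.add (var 10) (.mul (var 3) (var 6))) ;;
     set 6 (.mul (var 6) (inp 3)) ;;
     setReal 6 (.add (var 1) (lit 1)) (.mul (.ofNat (inp 2))
      (.sub (.mul (.ofNat (inp 3)) (.get 1 (var 1))) (.ofNat (var 3)))) ;;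
     setReal 6 (lit 0) (.sub (.get 6 (lit 0)) (.get 6 (.add (var 1) (lit 1)))) ;;
     inc 1)

/-- Reads a value from the store into the real variable `4`. -/
def readValue : Prog :=
  rset 4 (.ofNat (lit 0)) ;; rset 5 (.div (.var 0) (.ofNat (lit 2))) ;;
  loop (inp 5)
    (ite (.natLE (lit 1) (stored (var 11))) (rset 4 (.add (.var 4) (.var 5))) skip ;;
     rset 5 (.div (.var 5) (.ofNat (lit 2))) ;;
     inc 11)

/-- The innermost loop of `timesBasis`. -/
def timesFactor : Prog :=
  rset 4 (.mul (.var 4) (.div (.sub (.get 6 (var 1)) (.ofNat (var 4)))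
    (.sub (.ofNat (.get 2 (var 1))) (.ofNat (var 4))))) ;; inc 4

/-- Multiplies the real variable `4` by the value of the current Lagrange polynomial. -/
def timesBasis : Prog :=
  set 1 (lit 0) ;;
  loop (.add (inp 1) (lit 1))
    (set 4 (lit 0) ;; loop (.get 2 (var 1)) timesFactor ;; inc 1)

/-- Adds one term of the interpolation formula to the result. -/
def addTerm : Prog :=
  readValue ;; timesBasis ;; rset 2 (.add (.var 2) (.var 4)) ;; nextComp

/-- The query program. -/
def qryProg : Prog :=
  locate ;; set 11 (.mul (var 10) (.mul (inp 4) (inp 5))) ;;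
  setNat 2 (lit 0) (inp 2) ;; loop (inp 4) addTerm

/-! ## Effects of the fragments -/

/-- `b` is the composition that follows `a`, and the first nonzero entry of `a` has an index below
`m`. -/
def Step (m : ℕ) (a b : ℕ → ℕ) : Prop :=
  ∃ h < m, (∀ i < h, a i = 0) ∧ 0 < a h ∧
    b = fun i => if i = h + 1 then a (h + 1) + 1 else if i = 0 then a h - 1 else
      if i = h then 0 else a i

section
variable {d : ℕ} (g : E d → ℝ) (st : List Bool) (σ : Config d)

theorem nextComp_effect {m : ℕ} (hm : σ.nat 0 1 = m) {a b : ℕ → ℕ}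
    (ha : ∀ i ≤ m, σ.nat 2 i = a i) (hab : Step m a b) :
    ∀ i ≤ m, (nextComp.run g st σ).nat 2 i = b i := by
  obtain ⟨h, hh, h0, hp, rfl⟩ := hab
  unfold nextComp
  rw [run_seq, run_seq]
  -- The pointer advances over zeros and then stays put, so after `i` rounds it is at `min i h`;
  -- since `h < m`, the `m` rounds suffice.
  have key := loop_invariant g st (inp 1) (ite (.natLE (.get 2 (var 3)) (lit 0)) (inc 3) skip)
    ((set 3 (lit 0)).run g st σ) (fun i τ => τ.nat 3 0 = min i h)
    (by simp [run, eval, write_apply, Config.tick]) (by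
      intro i hi τ hF hτ
      have h2 : τ.nat 2 = σ.nat 2 := by
        rw [hF.nat 2 rfl]; funext k; simp [run, write_apply, Config.tick]
      have h3 : σ.nat 2 (min i h) = a (min i h) := ha _ (by omega)
      simp only [run, Test.holds, eval, Config.tick, h2, hτ, h3]
      rcases lt_or_ge i h with hih | hih
      · rw [min_eq_left hih.le, h0 i hih]
        simp [write_apply]
        omega
      · rw [min_eq_right hih]
        simp [hp.ne', hτ]
        omega)
  have hF := frame g st (loop (inp 1) (ite (.natLE (.get 2 (var 3)) (lit 0)) (inc 3) skip))
    ((set 3 (lit 0)).run g st σ)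
  have h2 := hF.nat 2 rfl
  have e2 : ((set 3 (lit 0)).run g st σ).nat 2 = σ.nat 2 := (frame g st _ _).nat 2 rfl
  have e0 : (inp 1).eval st ((set 3 (lit 0)).run g st σ) = m := by
    simp [run, eval, write_apply, Config.tick, hm]
  rw [e0, min_eq_right hh.le] at key
  generalize (loop _ _).run g st _ = τ at *
  rw [e2] at h2
  intro i hi
  have h5 := ha h hh.le
  have h6 := ha (h + 1) hh
  have h7 := ha i hi
  simp only [run, eval, Config.tick, write_apply, h2, key]
  by_cases c1 : i = h + 1
  · subst c1; simp [h6]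
  · by_cases c2 : i = 0
    · subst c2
      simp [h5]
    · simp [c1, c2, h7]

theorem resetComp_effect {m : ℕ} (hm : σ.nat 0 1 = m) :
    ∀ i ≤ m, (resetComp.run g st σ).nat 2 i = if i = 0 then σ.nat 0 2 else 0 := by
  unfold resetComp
  rw [run_seq, run_seq]
  have key := loop_invariant g st (.add (inp 1) (lit 1)) (setNat 2 (var 1) (lit 0) ;; inc 1)
    ((set 1 (lit 0)).run g st σ) (fun i τ => τ.nat 1 0 = i ∧ ∀ k < i, τ.nat 2 k = 0)
    (by simp [run, eval, write_apply, Config.tick]) (by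
      intro i hi τ hF hτ
      simp only [run, eval, Config.tick, write_apply, hτ.1]
      refine ⟨by simp, fun k hk => ?_⟩
      by_cases h : k = i
      · simp [h]
      · simp [h, hτ.2 k (by omega)])
  have hF := frame g st (loop (.add (inp 1) (lit 1)) (setNat 2 (var 1) (lit 0) ;; inc 1))
    ((set 1 (lit 0)).run g st σ)
  have h2 := hF.nat 0 rfl
  have e2 : ((set 1 (lit 0)).run g st σ).nat 0 = σ.nat 0 := (frame g st _ _).nat 0 rfl
  have e0 : (NExp.add (inp 1) (lit 1)).eval st ((set 1 (lit 0)).run g st σ) = m + 1 := by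
    simp [run, eval, write_apply, Config.tick, hm]
  rw [e0] at key
  generalize (loop _ _).run g st _ = τ at *
  rw [e2] at h2
  intro i hi
  simp [run, eval, Config.tick, write_apply, h2, key.2 i (by omega)]

theorem countCells_effect : (countCells.run g st σ).nat 6 0 = σ.nat 0 3 ^ σ.nat 0 1 := by
  unfold countCells
  rw [run_seq]
  have key := loop_invariant g st (inp 1) (set 6 (.mul (var 6) (inp 3)))
    ((set 6 (lit 1)).run g st σ) (fun i τ => τ.nat 6 0 = σ.nat 0 3 ^ i)
    (by simp [run, eval, write_apply, Config.tick]) (by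
      intro i hi τ hF hτ
      have e2 : ((set 6 (lit 1)).run g st σ).nat 0 = σ.nat 0 := (frame g st _ _).nat 0 rfl
      have h2 := (hF.nat 0 rfl).trans e2
      simp [run, eval, Config.tick, write_apply, hτ, h2, pow_succ])
  simpa [run, eval, write_apply, Config.tick] using key

theorem nat_div_succ_pow (c K k : ℕ) : (c + 1) / K ^ k = c / K ^ k ∨
    (c + 1) / K ^ k = c / K ^ k + 1 := by
  rw [Nat.succ_div]
  split_ifs <;> simp

/-- One digit of the addition of `1` in base `K`: `a' - a` is the carry that comes in, and the
growth of the quotient by `K` is the carry that goes out. -/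
theorem digit_carry {a a' K : ℕ} (hK : 0 < K) (h : a' = a ∨ a' = a + 1) :
    (K ≤ a % K + (a' - a) → a' % K = 0 ∧ a' / K - a / K = 1) ∧
    (¬ K ≤ a % K + (a' - a) → a' % K = a % K + (a' - a) ∧ a' / K - a / K = 0) := by
  have hlt := Nat.mod_lt a hK
  rcases h with rfl | rfl
  · simp [hlt]
  · simp only [Nat.add_sub_cancel_left]
    have h1 := Nat.div_add_mod a K
    constructor
    · intro h2
      have h3 : a + 1 = K * (a / K + 1) := by rw [Nat.mul_add]; omega
      rw [h3]
      simp [Nat.mul_div_cancel_left _ hK]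
    · intro h2
      have h3 : a + 1 = (a % K + 1) + K * (a / K) := by omega
      constructor
      · rw [h3, Nat.add_mul_mod_self_left, Nat.mod_eq_of_lt (by omega)]
      · rw [h3, Nat.add_mul_div_left _ _ hK, Nat.div_eq_of_lt (by omega)]
        omega

theorem nextCell_effect {m K c : ℕ} (hm : σ.nat 0 1 = m) (hK : σ.nat 0 3 = K) (hK0 : 0 < K)
    (hc : ∀ k < m, σ.nat 5 k = c / K ^ k % K) :
    ∀ k < m, (nextCell.run g st σ).nat 5 k = (c + 1) / K ^ k % K := by
  unfold nextCell
  rw [run_seq, run_seq]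
  have f0 : (run g st (set 1 (lit 0)) (run g st (set 7 (lit 1)) σ)).nat 0 = σ.nat 0 :=
    ((frame g st _ _).nat 0 rfl).trans ((frame g st _ _).nat 0 rfl)
  -- Variable `7` is the carry into digit `i`, written as the difference of the quotients of `c + 1`
  -- and `c` by `K ^ i`. For `i = 0` it is the `1` to be added.
  have key := loop_invariant g st (inp 1) (setNat 5 (var 1) (.add (.get 5 (var 1)) (var 7)) ;;
     ite (.natLE (inp 3) (.get 5 (var 1)))
      (setNat 5 (var 1) (lit 0) ;; set 7 (lit 1)) (set 7 (lit 0)) ;;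
     inc 1) (run g st (set 1 (lit 0)) (run g st (set 7 (lit 1)) σ))
    (fun i τ => τ.nat 1 0 = i ∧ τ.nat 7 0 = (c + 1) / K ^ i - c / K ^ i ∧
      (∀ k < i, τ.nat 5 k = (c + 1) / K ^ k % K) ∧
      ∀ k, i ≤ k → τ.nat 5 k = σ.nat 5 k) (by simp [run, eval, write_apply, Config.tick]) (by
      rintro i hi τ hF ⟨h1, h7, hlt, hge⟩
      have h0 : τ.nat 0 = σ.nat 0 := (hF.nat 0 rfl).trans f0
      have him : i < m := by rw [← hm]; simpa [run, eval, write_apply, Config.tick] using hi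
      have h5 : τ.nat 5 i = c / K ^ i % K := (hge i le_rfl).trans (hc i him)
      have hd := digit_carry hK0 (nat_div_succ_pow c K i)
      simp only [Nat.div_div_eq_div_mul, ← pow_succ] at hd
      by_cases hcar : K ≤ c / K ^ i % K + ((c + 1) / K ^ i - c / K ^ i)
      · have := hd.1 hcar
        simp only [run, eval, Test.holds, Config.tick, write_apply, h1, h7, h5, h0, hK]
        simp only [OfNat.zero_ne_ofNat, false_and, if_false, and_self, true_and, if_true]
        simp [write_apply, hcar, h1, this.2]
        refine ⟨fun k hk => ?_, fun k hk => ?_⟩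
        · by_cases hki : k = i
          · simp [hki, this.1]
          · simp [hki, hlt k (by omega)]
        · have hki : k ≠ i := by omega
          simp [hki, hge k (by omega)]
      · have := hd.2 hcar
        simp only [run, eval, Test.holds, Config.tick, write_apply, h1, h7, h5, h0, hK]
        simp only [OfNat.zero_ne_ofNat, false_and, if_false, and_self, true_and, if_true]
        simp [write_apply, hcar, h1, this.2]
        refine ⟨fun k hk => ?_, fun k hk => ?_⟩
        · by_cases hki : k = i
          · simp [hki, this.1]
          · simp [hki, hlt k (by omega)]
        · have hki : k ≠ i := by omega
          simp [hki, hge k (by omega)])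
  have e0 : (inp 1).eval st (run g st (set 1 (lit 0)) (run g st (set 7 (lit 1)) σ)) = m := by
    simp [run, eval, write_apply, Config.tick, hm]
  rw [e0] at key
  exact key.2.2.1

theorem makePoint_effect {m : ℕ} (hm : σ.nat 0 1 = m) :
    ∀ k < m, (makePoint.run g st σ).real 3 k =
      ((σ.nat 5 k : ℝ) + (σ.nat 2 (k + 1) : ℝ) / σ.nat 0 2) / σ.nat 0 3 := by
  unfold makePoint
  rw [run_seq]
  have key := loop_invariant g st (inp 1) (setReal 3 (var 1)
      (.div (.add (.ofNat (.get 5 (var 1)))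
        (.div (.ofNat (.get 2 (.add (var 1) (lit 1)))) (.ofNat (inp 2)))) (.ofNat (inp 3))) ;;
     inc 1) ((set 1 (lit 0)).run g st σ)
    (fun i τ => τ.nat 1 0 = i ∧ ∀ k < i, τ.real 3 k =
      ((σ.nat 5 k : ℝ) + (σ.nat 2 (k + 1) : ℝ) / σ.nat 0 2) / σ.nat 0 3)
    (by simp [run, eval, write_apply, Config.tick]) (by
      rintro i hi τ hF ⟨h1, h3⟩
      have f0 : τ.nat 0 = σ.nat 0 := (hF.nat 0 rfl).trans ((frame g st _ _).nat 0 rfl)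
      have f2 : τ.nat 2 = σ.nat 2 := (hF.nat 2 rfl).trans ((frame g st _ _).nat 2 rfl)
      have f5 : τ.nat 5 = σ.nat 5 := (hF.nat 5 rfl).trans ((frame g st _ _).nat 5 rfl)
      simp only [run, eval, RExp.eval, Config.tick, write_apply, h1]
      refine ⟨by simp, fun k hk => ?_⟩
      by_cases h : k = i
      · simp [h, f0, f2, f5]
      · simp [h, h3 k (by omega)])
  have e0 : (inp 1).eval st ((set 1 (lit 0)).run g st σ) = m := by
    simp [run, eval, write_apply, Config.tick, hm]
  rw [e0] at key
  exact key.2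

theorem clipValue_effect (hL : 0 ≤ σ.real 0 0) :
    (clipValue.run g st σ).real 4 0 = clip (σ.real 0 0) (σ.real 4 0) := by
  unfold clipValue clip
  simp only [run, Test.holds, RExp.eval, eval, Config.tick]
  rcases le_total (σ.real 4 0) 0 with h | h
  · simp [h, write_apply, h.trans hL]
  · rcases le_total (σ.real 0 0) (σ.real 4 0) with h' | h'
    · rcases eq_or_lt_of_le h with h0 | h0
      · have : σ.real 0 0 = 0 := le_antisymm (by rw [h0]; exact h') hL
        simp [← h0, this, write_apply]
      · simp [not_le.2 h0, h', write_apply, hL]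
    · rcases eq_or_lt_of_le h with h0 | h0
      · simp [← h0, write_apply, hL]
      · simp only [Nat.cast_zero, not_le.2 h0, if_false, min_eq_left h', max_eq_right h]
        by_cases hh : σ.real 0 0 ≤ σ.real 4 0
        · simp [write_apply, le_antisymm h' hh]
        · simp [hh]

end

/-- What is left of `v` after the removal of `m` binary digits relative to `L`. -/
noncomputable def remainder (L v : ℝ) : ℕ → ℝ
  | 0 => v
  | m + 1 => if L / 2 ^ (m + 1) ≤ remainder L v m then remainder L v m - L / 2 ^ (m + 1)
      else remainder L v m

open Classical in
/-- The `m`-th binary digit of `v` relative to `L`. -/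
noncomputable def digit (L v : ℝ) (m : ℕ) : Bool := decide (L / 2 ^ (m + 1) ≤ remainder L v m)

/-- The first `b` binary digits of `v` relative to `L`. -/
noncomputable def digits (b : ℕ) (L v : ℝ) : List Bool := (List.range b).map (digit L v)

section
variable {d : ℕ} (g : E d → ℝ) (st : List Bool) (σ : Config d)

/-- Greedy binary expansion: real variable `5` holds the current weight `L / 2 ^ (i + 1)`, and it is
subtracted whenever it fits. Only comparisons of reals are needed. -/
theorem emitDigits_effect : (emitDigits.run g st σ).out =
    σ.out ++ digits (σ.nat 0 5) (σ.real 0 0) (σ.real 4 0) := by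
  unfold emitDigits
  rw [run_seq]
  have key := loop_invariant g st (inp 5)
    (ite (.realLE (.var 5) (.var 4)) (emit (lit 1) ;; rset 4 (.sub (.var 4) (.var 5)))
      (emit (lit 0)) ;;
     rset 5 (.div (.var 5) (.ofNat (lit 2))))
    (run g st (rset 5 (.div (.var 0) (.ofNat (lit 2)))) σ)
    (fun i τ => τ.real 4 0 = remainder (σ.real 0 0) (σ.real 4 0) i ∧
      τ.real 5 0 = σ.real 0 0 / 2 ^ (i + 1) ∧
      τ.out = σ.out ++ digits i (σ.real 0 0) (σ.real 4 0))
    (by simp [run, eval, RExp.eval, write_apply, Config.tick, remainder, digits]) (by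
      rintro i hi τ hF ⟨h4, h5, ho⟩
      simp only [run, eval, RExp.eval, Test.holds, Config.tick, h4, h5]
      by_cases hc : σ.real 0 0 / 2 ^ (i + 1) ≤ remainder (σ.real 0 0) (σ.real 4 0) i
      · simp [hc, remainder, write_apply, h5, ho, digits, List.range_succ, digit]
        rw [pow_succ _ (i + 1)]; field_simp
      · simp [hc, remainder, write_apply, h4, h5, ho, digits, List.range_succ, digit]
        rw [pow_succ _ (i + 1)]; field_simp)
  have e0 : (inp 5).eval st (run g st (rset 5 (.div (.var 0) (.ofNat (lit 2)))) σ) = σ.nat 0 5 := by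
    simp [run, eval, Config.tick]
  rw [e0] at key
  exact key.2.2

end

/-! ## The preprocessing program -/

/-- The mesh point that belongs to the sub-cube with index `c` and the composition `s`. -/
noncomputable def gridPoint (d ℓ K c : ℕ) (s : ℕ → ℕ) : E d :=
  WithLp.toLp 2 fun k => (((c / K ^ (k : ℕ) % K : ℕ) : ℝ) + (s (k + 1) : ℝ) / ℓ) / K

section
variable {d : ℕ} (g : E d → ℝ) (st : List Bool) (σ : Config d)

theorem treatPoint_effect {K c : ℕ} {s : ℕ → ℕ} (hd : σ.nat 0 1 = d) (hK : σ.nat 0 3 = K)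
    (hL : 0 ≤ σ.real 0 0) (hc : ∀ k < d, σ.nat 5 k = c / K ^ k % K)
    (hs : ∀ k ≤ d, σ.nat 2 k = s k) :
    (treatPoint.run g st σ).out = σ.out ++
      digits (σ.nat 0 5) (σ.real 0 0) (clip (σ.real 0 0) (g (gridPoint d (σ.nat 0 2) K c s))) ∧
    (treatPoint.run g st σ).asked = σ.asked ++ [gridPoint d (σ.nat 0 2) K c s] ∧
    ∀ s', Step d s s' → ∀ k ≤ d, (treatPoint.run g st σ).nat 2 k = s' k := by
  unfold treatPoint
  rw [run_seq, run_seq, run_seq, run_seq]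
  have h1 := makePoint_effect g st σ hd
  have f1 := frame g st makePoint σ
  generalize makePoint.run g st σ = σ₁ at *
  have hu : (WithLp.toLp 2 fun k => σ₁.real 3 k : E d) = gridPoint d (σ.nat 0 2) K c s := by
    unfold gridPoint
    congr 1
    funext k
    rw [h1 k k.2, hc k k.2, hs _ (by omega), hK]
  have f2 := frame g st (ask 3 4 (lit 0)) σ₁
  have h2 : ((ask 3 4 (lit 0)).run g st σ₁).real 4 0 = g (gridPoint d (σ.nat 0 2) K c s) := by
    simp [run, eval, write_apply, hu]
  have h2' : ((ask 3 4 (lit 0)).run g st σ₁).asked = σ₁.asked ++ [gridPoint d (σ.nat 0 2) K c s] := by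
    simp [run, hu]
  generalize (ask 3 4 (lit 0)).run g st σ₁ = σ₂ at *
  have r2 : σ₂.real 0 = σ.real 0 := (f2.real 0 rfl).trans (f1.real 0 rfl)
  have h3 := clipValue_effect g st σ₂ (by rwa [r2])
  have f3 := frame g st clipValue σ₂
  generalize clipValue.run g st σ₂ = σ₃ at *
  have h4 := emitDigits_effect g st σ₃
  have f4 := frame g st emitDigits σ₃
  generalize emitDigits.run g st σ₃ = σ₄ at *
  have f5 := frame g st nextComp σ₄
  have n4 : ∀ a, a ≠ 1 → σ₄.nat a = σ.nat a := fun a ha =>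
    (f4.nat a rfl).trans ((f3.nat a rfl).trans ((f2.nat a rfl).trans
      (f1.nat a (by simp [makePoint, writesNat, ha]))))
  have n3 : σ₃.nat 0 = σ.nat 0 := (f3.nat 0 rfl).trans ((f2.nat 0 rfl).trans (f1.nat 0 rfl))
  have r3 : σ₃.real 0 = σ.real 0 := (f3.real 0 rfl).trans r2
  refine ⟨?_, ?_, fun s' hs' => ?_⟩
  · rw [f5.out rfl, h4, n3, r3, h3, r2, h2, f3.out rfl, f2.out rfl, f1.out rfl]
  · rw [f5.asked rfl, f4.asked rfl, f3.asked rfl, h2', f1.asked rfl]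
  · exact nextComp_effect g st σ₄ (by rw [n4 0 (by simp), hd])
      (fun i hi => by rw [n4 2 (by simp), hs i hi]) hs'

theorem treatCell_effect {K c : ℕ} {s : ℕ → ℕ → ℕ} (hd : σ.nat 0 1 = d) (hK : σ.nat 0 3 = K)
    (hK0 : 0 < K) (hL : 0 ≤ σ.real 0 0) (hc : ∀ k < d, σ.nat 5 k = c / K ^ k % K)
    (hs0 : ∀ k ≤ d, s 0 k = if k = 0 then σ.nat 0 2 else 0)
    (hs : ∀ i, i + 1 < σ.nat 0 4 → Step d (s i) (s (i + 1))) :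
    (treatCell.run g st σ).out = σ.out ++ (List.range (σ.nat 0 4)).flatMap (fun i =>
      digits (σ.nat 0 5) (σ.real 0 0)
        (clip (σ.real 0 0) (g (gridPoint d (σ.nat 0 2) K c (s i))))) ∧
    (treatCell.run g st σ).asked = σ.asked ++
      (List.range (σ.nat 0 4)).map (fun i => gridPoint d (σ.nat 0 2) K c (s i)) ∧
    ∀ k < d, (treatCell.run g st σ).nat 5 k = (c + 1) / K ^ k % K := by
  unfold treatCell
  rw [run_seq, run_seq]
  have h1 := resetComp_effect g st σ hd
  have f1 := frame g st resetComp σ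
  generalize resetComp.run g st σ = σ₁ at *
  have key := loop_invariant g st (inp 4) treatPoint σ₁ (fun i τ =>
    τ.out = σ.out ++ (List.range i).flatMap (fun i => digits (σ.nat 0 5) (σ.real 0 0)
        (clip (σ.real 0 0) (g (gridPoint d (σ.nat 0 2) K c (s i))))) ∧
    τ.asked = σ.asked ++ (List.range i).map (fun i => gridPoint d (σ.nat 0 2) K c (s i)) ∧
    (i < σ.nat 0 4 → ∀ k ≤ d, τ.nat 2 k = s i k))
    (by
      refine ⟨?_, ?_, fun _ k hk => ?_⟩
      · simpa [Config.tick] using f1.out rfl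
      · simpa [Config.tick] using f1.asked rfl
      · rw [hs0 k hk]; exact h1 k hk) (by
      rintro i hi τ hF ⟨ho, ha, hc2⟩
      have n0 : τ.nat 0 = σ.nat 0 := (hF.nat 0 rfl).trans (f1.nat 0 rfl)
      have n5 : τ.nat 5 = σ.nat 5 := (hF.nat 5 rfl).trans (f1.nat 5 rfl)
      have r0 : τ.real 0 = σ.real 0 := (hF.real 0 rfl).trans (f1.real 0 rfl)
      have hi' : i < σ.nat 0 4 := by rw [← f1.nat 0 rfl]; exact hi
      obtain ⟨p1, p2, p3⟩ := treatPoint_effect g st (τ.tick 1) (K := K) (c := c) (s := s i)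
        (by simp [Config.tick, n0, hd]) (by simp [Config.tick, n0, hK])
        (by simpa [Config.tick, r0] using hL)
        (by simpa [Config.tick, n5] using hc) (by simpa [Config.tick] using hc2 hi')
      simp only [Config.tick, n0, r0] at p1 p2
      refine ⟨?_, ?_, fun hlt => p3 _ (hs i hlt)⟩
      · simp only [Config.tick]
        rw [p1, ho]
        simp [List.range_succ]
      · simp only [Config.tick]
        rw [p2, ha]
        simp [List.range_succ])
  have f2 := frame g st (loop (inp 4) treatPoint) σ₁
  have e0 : (inp 4).eval st σ₁ = σ.nat 0 4 := by simp [eval, f1.nat 0 rfl]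
  rw [e0] at key
  generalize (loop (inp 4) treatPoint).run g st σ₁ = σ₂ at *
  have n0 : σ₂.nat 0 = σ.nat 0 := (f2.nat 0 rfl).trans (f1.nat 0 rfl)
  have n5 : σ₂.nat 5 = σ.nat 5 := (f2.nat 5 rfl).trans (f1.nat 5 rfl)
  have f3 := frame g st nextCell σ₂
  exact ⟨(f3.out rfl).trans key.1, (f3.asked rfl).trans key.2.1,
    nextCell_effect g st σ₂ (by rw [n0, hd]) (by rw [n0, hK]) hK0 (by rwa [n5])⟩

/-- The invariant identifies array `5` with the base-`K` digits of the number of sub-cubes done so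
far. Zeros on entry are the digits of sub-cube `0`. -/
theorem preProg_effect {s : ℕ → ℕ → ℕ} (hd : σ.nat 0 1 = d) (hK0 : 0 < σ.nat 0 3)
    (hL : 0 ≤ σ.real 0 0) (h5 : σ.nat 5 = 0)
    (hs0 : ∀ k ≤ d, s 0 k = if k = 0 then σ.nat 0 2 else 0)
    (hs : ∀ i, i + 1 < σ.nat 0 4 → Step d (s i) (s (i + 1))) :
    (preProg.run g st σ).out = σ.out ++ (List.range (σ.nat 0 3 ^ d)).flatMap (fun c =>
      (List.range (σ.nat 0 4)).flatMap (fun i => digits (σ.nat 0 5) (σ.real 0 0)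
        (clip (σ.real 0 0) (g (gridPoint d (σ.nat 0 2) (σ.nat 0 3) c (s i)))))) ∧
    (preProg.run g st σ).asked = σ.asked ++ (List.range (σ.nat 0 3 ^ d)).flatMap (fun c =>
      (List.range (σ.nat 0 4)).map (fun i => gridPoint d (σ.nat 0 2) (σ.nat 0 3) c (s i))) := by
  unfold preProg
  rw [run_seq]
  have h1 := countCells_effect g st σ
  have f1 := frame g st countCells σ
  generalize countCells.run g st σ = σ₁ at *
  have key := loop_invariant g st (var 6) treatCell σ₁ (fun c τ =>
    τ.out = σ.out ++ (List.range c).flatMap (fun c =>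
      (List.range (σ.nat 0 4)).flatMap (fun i => digits (σ.nat 0 5) (σ.real 0 0)
        (clip (σ.real 0 0) (g (gridPoint d (σ.nat 0 2) (σ.nat 0 3) c (s i)))))) ∧
    τ.asked = σ.asked ++ (List.range c).flatMap (fun c =>
      (List.range (σ.nat 0 4)).map (fun i => gridPoint d (σ.nat 0 2) (σ.nat 0 3) c (s i))) ∧
    ∀ k < d, τ.nat 5 k = c / σ.nat 0 3 ^ k % σ.nat 0 3)
    (by
      refine ⟨?_, ?_, fun k hk => ?_⟩
      · simpa [Config.tick] using f1.out rfl
      · simpa [Config.tick] using f1.asked rfl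
      · simp [Config.tick, f1.nat 5 rfl, h5]) (by
      rintro i hi τ hF ⟨ho, ha, hc2⟩
      have n0 : τ.nat 0 = σ.nat 0 := (hF.nat 0 rfl).trans (f1.nat 0 rfl)
      have r0 : τ.real 0 = σ.real 0 := (hF.real 0 rfl).trans (f1.real 0 rfl)
      have n0' : (τ.tick 1).nat 0 = σ.nat 0 := n0
      have r0' : (τ.tick 1).real 0 = σ.real 0 := r0
      obtain ⟨p1, p2, p3⟩ := treatCell_effect g st (τ.tick 1) (K := σ.nat 0 3) (c := i) (s := s)
        (by rw [n0', hd]) (by rw [n0']) hK0 (by rwa [r0'])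
        hc2 (by rwa [n0']) (by rwa [n0'])
      rw [n0', r0'] at p1
      rw [n0'] at p2
      refine ⟨?_, ?_, p3⟩
      · rw [p1]
        simp [Config.tick, ho, List.range_succ]
      · rw [p2]
        simp [Config.tick, ha, List.range_succ])
  have e0 : (var 6).eval st σ₁ = σ.nat 0 3 ^ d := by simp [eval, h1, hd]
  rw [e0] at key
  exact ⟨key.1, key.2.1⟩

theorem treatPoint_bound :
    treatPoint.bound st σ ≤ 200 * (1 + σ.nat 0 1 + σ.nat 0 5) := by
  simp [treatPoint, makePoint, clipValue, emitDigits, nextComp, bound, NExp.cost, RExp.cost,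
    Test.cost, eval]
  omega

theorem treatCell_bound :
    treatCell.bound st σ ≤ 300 * (1 + σ.nat 0 1) +
      σ.nat 0 4 * (201 * (1 + σ.nat 0 1 + σ.nat 0 5)) := by
  have h : σ.nat 0 4 * (1 + treatPoint.bound st σ) ≤
      σ.nat 0 4 * (201 * (1 + σ.nat 0 1 + σ.nat 0 5)) := by
    gcongr
    have := treatPoint_bound st σ
    omega
  simp [treatCell, resetComp, nextCell, bound, NExp.cost, Test.cost, eval] at h ⊢
  omega

theorem preProg_steps (h4 : 0 < σ.nat 0 4) (hd : σ.nat 0 1 = d) (hK0 : 0 < σ.nat 0 3) :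
    (preProg.run g st σ).steps ≤ σ.steps +
      1000 * (σ.nat 0 3 ^ d * (σ.nat 0 4 * (1 + d + σ.nat 0 5))) := by
  unfold preProg
  rw [run_seq]
  have h1 := countCells_effect g st σ
  have f1 := frame g st countCells σ
  have s1 := steps_le g st countCells rfl rfl σ σ rfl
  have b1 : countCells.bound st σ ≤ 20 * (1 + d) := by
    simp [countCells, bound, NExp.cost, eval, hd]
    omega
  generalize countCells.run g st σ = σ₁ at *
  have key := loop_invariant g st (var 6) treatCell σ₁ (fun c τ => τ.steps ≤ σ₁.steps + 3 +
      c * (1 + treatCell.bound st σ)) (by simp [Config.tick, NExp.cost]) (by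
      intro i hi τ hF hτ
      have n0 : τ.nat 0 = σ.nat 0 := (hF.nat 0 rfl).trans (f1.nat 0 rfl)
      have := steps_le g st treatCell rfl rfl σ (τ.tick 1) n0
      simp only [Config.tick] at this ⊢
      rw [Nat.add_mul]
      omega)
  have e0 : (var 6).eval st σ₁ = σ.nat 0 3 ^ d := by simp [eval, h1, hd]
  rw [e0] at key
  have hb := treatCell_bound st σ
  rw [hd] at hb
  set B := σ.nat 0 4
  set N := σ.nat 0 3 ^ d
  set w := 1 + d + σ.nat 0 5
  have hN : 1 ≤ N := Nat.one_le_pow _ _ hK0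
  -- There is at least one sub-cube and at least one lattice point, so the overhead per sub-cube and
  -- the initial count are absorbed into `N * (B * w)`.
  have hBw : w ≤ B * w := Nat.le_mul_of_pos_left _ h4
  have hNBw : B * w ≤ N * (B * w) := Nat.le_mul_of_pos_left _ hN
  have hdw : 1 + d ≤ w := by omega
  have h2 : N * (1 + treatCell.bound st σ) ≤ N * (502 * (B * w)) := by
    gcongr
    have : B * (201 * w) = 201 * (B * w) := by ring
    omega
  have h3 : N * (502 * (B * w)) = 502 * (N * (B * w)) := by ring
  omega

end

/-! ## Enumeration of compositions -/

/-- The compositions of `r` into parts with indices `0, …, k`. -/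
def comps : ℕ → ℕ → List (ℕ → ℕ)
  | 0, r => [Pi.single 0 r]
  | _ + 1, 0 => [0]
  | k + 1, r + 1 => comps k (r + 1) ++ (comps (k + 1) r).map (· + Pi.single (k + 1) 1)

/-- The recursion of `comps` splits by whether the last part vanishes; this is Pascal's rule. -/
theorem length_comps (k r : ℕ) : (comps k r).length = (r + k).choose k := by
  induction k generalizing r with
  | zero => simp [comps]
  | succ k ih =>
    induction r with
    | zero => simp [comps]
    | succ r ihr =>
      simp only [comps, List.length_append, List.length_map, ih, ihr]
      rw [show r + 1 + (k + 1) = (r + (k + 1)) + 1 by ring, Nat.choose_succ_succ]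
      congr 2
      ring

theorem head?_comps (k r : ℕ) : (comps k r).head? = some (Pi.single 0 r) := by
  induction k generalizing r with
  | zero => simp [comps]
  | succ k ih => cases r <;> simp [comps, ih]

theorem getLast?_comps (k r : ℕ) : (comps k r).getLast? = some (Pi.single k r) := by
  induction k generalizing r with
  | zero => simp [comps]
  | succ k ih =>
    induction r with
    | zero => simp [comps]
    | succ r ihr => simp [comps, ihr, ← Pi.single_add]

theorem mem_comps (k r : ℕ) (s : ℕ → ℕ) :
    s ∈ comps k r ↔ s ∈ Finset.piAntidiag (Finset.range (k + 1)) r := by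
  rw [Finset.mem_piAntidiag]
  induction k generalizing r s with
  | zero =>
    simp only [comps, List.mem_singleton, zero_add, Finset.range_one, Finset.sum_singleton,
      Finset.mem_singleton]
    constructor
    · rintro rfl
      refine ⟨by simp, fun i hi => ?_⟩
      by_contra h
      simp [h] at hi
    · rintro ⟨h1, h2⟩
      funext i
      by_cases hi : i = 0
      · subst hi; simp [h1]
      · simpa [hi] using mt (h2 i) hi
  | succ k ih =>
    induction r generalizing s with
    | zero =>
      simp only [comps, List.mem_singleton, Finset.sum_eq_zero_iff]
      constructor
      · rintro rfl; simp
      · rintro ⟨h1, h2⟩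
        funext i
        by_contra hi
        exact hi (h1 i (h2 i hi))
    | succ r ihr =>
      simp only [comps, List.mem_append, List.mem_map, ih, ihr]
      constructor
      · rintro (⟨h1, h2⟩ | ⟨a, ⟨h1, h2⟩, rfl⟩)
        · have h3 : s (k + 1) = 0 := by
            by_contra h
            simpa using h2 _ h
          refine ⟨by rw [Finset.sum_range_succ, h1, h3], fun i hi => ?_⟩
          have := h2 i hi
          simp at this ⊢
          omega
        · refine ⟨?_, fun i hi => ?_⟩
          · simp [Finset.sum_add_distrib, h1, Finset.sum_pi_single']
          · by_cases hik : i = k + 1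
            · simp [hik]
            · exact h2 i (by simpa [hik] using hi)
      · rintro ⟨h1, h2⟩
        by_cases hk : s (k + 1) = 0
        · left
          refine ⟨by rw [Finset.sum_range_succ, hk] at h1; simpa using h1, fun i hi => ?_⟩
          have := h2 i hi
          have : i ≠ k + 1 := by rintro rfl; exact hi hk
          simp at *
          omega
        · right
          have hs : s - Pi.single (k + 1) 1 + Pi.single (k + 1) 1 = s := by
            funext i
            by_cases hik : i = k + 1
            · subst hik; simp; omega
            · simp [hik]
          refine ⟨s - Pi.single (k + 1) 1, ⟨?_, fun i hi => h2 i ?_⟩, hs⟩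
          · rw [← hs] at h1
            simp only [Pi.add_apply, Finset.sum_add_distrib, Finset.sum_pi_single'] at h1
            simpa using h1
          · rintro h; simp [h] at hi

theorem nodup_comps (k r : ℕ) : (comps k r).Nodup := by
  induction k generalizing r with
  | zero => simp [comps]
  | succ k ih =>
    induction r with
    | zero => simp [comps]
    | succ r ihr =>
      simp only [comps]
      refine List.Nodup.append (ih _) (ihr.map fun a b h => by simpa using h) ?_
      intro s hs hs'
      rw [mem_comps, Finset.mem_piAntidiag] at hs
      obtain ⟨a, -, rfl⟩ := List.mem_map.1 hs'
      simpa using hs.2 (k + 1) (by simp)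

theorem toFinset_comps [DecidableEq (ℕ → ℕ)] (k r : ℕ) :
    (comps k r).toFinset = Finset.piAntidiag (Finset.range (k + 1)) r := by
  ext s
  rw [List.mem_toFinset, mem_comps]

theorem Step.mono {m m' : ℕ} (h : m ≤ m') {a b : ℕ → ℕ} : Step m a b → Step m' a b := by
  rintro ⟨i, hi, h'⟩
  exact ⟨i, hi.trans_le h, h'⟩

/-- The rule inspects only entries up to its first nonzero one, which lies below `m`. Entry `m` is
at most incremented, and that commutes with adding `1` to it. -/
theorem Step.add_single {m : ℕ} {a b : ℕ → ℕ} :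
    Step m a b → Step m (a + Pi.single m 1) (b + Pi.single m 1) := by
  rintro ⟨h, hm, h0, hp, rfl⟩
  refine ⟨h, hm, fun i hi => ?_, ?_, ?_⟩
  · simp [h0 i hi, (hi.trans hm).ne]
  · simp [hp]
  · funext i
    have hm' : h ≠ m := hm.ne
    simp only [Pi.add_apply, Pi.single_apply, hm', if_false, add_zero]
    by_cases h1 : i = h + 1
    · subst h1; simp; ring
    · by_cases h2 : i = 0
      · subst h2
        have : (0 : ℕ) ≠ m := by omega
        simp [this]
      · by_cases h3 : i = h
        · subst h3; simp [h2, hm']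
        · simp [h1, h2, h3]

/-- Within the two halves of the recursion the rule applies by induction. At the seam the first half
ends with everything in part `k`, and the second begins with one unit in part `k + 1` and the rest
in part `0`: this is the rule with `h = k`. -/
theorem isChain_comps (k r : ℕ) : (comps k r).IsChain (Step k) := by
  induction k generalizing r with
  | zero => simp [comps]
  | succ k ih =>
    induction r with
    | zero => simp [comps]
    | succ r ihr =>
      simp only [comps]
      rw [List.isChain_append]
      refine ⟨(ih _).imp fun a b => Step.mono (Nat.le_succ k), ?_, ?_⟩
      · rw [List.isChain_map]
        exact ihr.imp fun a b => Step.add_single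
      · intro x hx y hy
        rw [getLast?_comps] at hx
        rw [List.head?_map, head?_comps] at hy
        simp only [Option.map_some, Option.mem_def, Option.some.injEq] at hx hy
        subst hx hy
        refine ⟨k, Nat.lt_succ_self k, fun i hi => by simp [hi.ne], by simp, ?_⟩
        funext i
        simp only [Pi.add_apply, Pi.single_apply]
        by_cases h1 : i = k + 1
        · simp [h1]
        · by_cases h2 : i = 0
          · simp [h2]
          · simp [h1, h2]

/-- The `i`-th composition of `ℓ` into parts with indices `0, …, d`. -/
def compSeq (d ℓ i : ℕ) : ℕ → ℕ := (comps d ℓ).getD i 0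

theorem compSeq_zero (d ℓ : ℕ) : compSeq d ℓ 0 = Pi.single 0 ℓ := by
  have := head?_comps d ℓ
  unfold compSeq
  cases h : comps d ℓ with
  | nil => simp [h] at this
  | cons a l => simpa [h] using this

theorem step_compSeq {d ℓ i : ℕ} (hi : i + 1 < (ℓ + d).choose d) :
    Step d (compSeq d ℓ i) (compSeq d ℓ (i + 1)) := by
  rw [← length_comps] at hi
  have := List.isChain_iff_getElem.1 (isChain_comps d ℓ) i hi
  unfold compSeq
  rwa [List.getD_eq_getElem _ _ hi, List.getD_eq_getElem _ _ (Nat.lt_of_succ_lt hi)]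

theorem compSeq_mem {d ℓ i : ℕ} (hi : i < (ℓ + d).choose d) :
    compSeq d ℓ i ∈ Finset.piAntidiag (Finset.range (d + 1)) ℓ := by
  rw [← length_comps] at hi
  rw [← mem_comps]
  unfold compSeq
  rw [List.getD_eq_getElem _ _ hi]
  exact List.getElem_mem hi

/-- `comps` lists every composition exactly once, so the order in which the machine adds its terms
can be forgotten. -/
theorem sum_compSeq (d ℓ : ℕ) (F : (ℕ → ℕ) → ℝ) :
    ∑ i ∈ Finset.range ((ℓ + d).choose d), F (compSeq d ℓ i) =
      ∑ s ∈ Finset.piAntidiag (Finset.range (d + 1)) ℓ, F s := by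
  classical
  rw [← toFinset_comps, List.sum_toFinset _ (nodup_comps d ℓ), ← length_comps,
    Finset.sum_range, ← Fin.sum_univ_getElem]
  simp only [List.getElem_map]
  rw [← (finCongr (List.length_map F (as := comps d ℓ))).sum_comp]
  refine Finset.sum_congr rfl fun i _ => ?_
  unfold compSeq
  rw [List.getD_eq_getElem _ _ (by simpa using i.2)]
  simp

theorem card_piAntidiag (d ℓ : ℕ) :
    (Finset.piAntidiag (Finset.range (d + 1)) ℓ).card = (ℓ + d).choose d := by
  classical
  rw [← toFinset_comps, List.toFinset_card_of_nodup (nodup_comps d ℓ), length_comps]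

/-! ## The query program -/

/-- The coordinate of the sub-cube that contains a point with coordinate `x`. -/
noncomputable def cellOf (K : ℕ) (x : ℝ) : ℕ := min (K - 1) ⌊(K : ℝ) * x⌋₊

/-- The product over all parts of the generalized binomial coefficients `binom(z_k, s_k)`. -/
noncomputable def basis (d : ℕ) (s : ℕ → ℕ) (z : ℕ → ℝ) : ℝ :=
  ∏ k ∈ Finset.range (d + 1), ∏ t ∈ Finset.range (s k), (z k - t) / (s k - t)

/-- The value that is represented by the `b` bits beginning at the position `p`. -/
noncomputable def decode (L : ℝ) (st : List Bool) (b p : ℕ) : ℝ :=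
  ∑ m ∈ Finset.range b, if st.getD (p + m) false then L / 2 ^ (m + 1) else 0

/-- The local barycentric coordinates of `y` in its sub-cube. -/
noncomputable def localCoord (d ℓ K : ℕ) (y : ℕ → ℝ) : ℕ → ℝ
  | 0 => ℓ - ∑ k ∈ Finset.range d, (ℓ : ℝ) * (K * y k - cellOf K (y k))
  | k + 1 => ℓ * (K * y k - cellOf K (y k))

/-- The index of the sub-cube that contains `y`. -/
noncomputable def cellIndex (d K : ℕ) (y : ℕ → ℝ) : ℕ :=
  ∑ k ∈ Finset.range d, cellOf K (y k) * K ^ k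

section
variable {d : ℕ} (g : E d → ℝ) (st : List Bool) (σ : Config d)

theorem makePowers_effect : ∀ i ≤ σ.nat 0 5, (makePowers.run g st σ).nat 8 i = 2 ^ i := by
  unfold makePowers
  rw [run_seq, run_seq]
  have f0 : (run g st (set 9 (lit 0)) (run g st (setNat 8 (lit 0) (lit 1)) σ)).nat 0 = σ.nat 0 :=
    ((frame g st _ _).nat 0 rfl).trans ((frame g st _ _).nat 0 rfl)
  have key := loop_invariant g st (inp 5)
    (setNat 8 (.add (var 9) (lit 1)) (.add (.get 8 (var 9)) (.get 8 (var 9))) ;; inc 9)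
    (run g st (set 9 (lit 0)) (run g st (setNat 8 (lit 0) (lit 1)) σ))
    (fun i τ => τ.nat 9 0 = i ∧ ∀ k ≤ i, τ.nat 8 k = 2 ^ k)
    (by simp [run, eval, write_apply, Config.tick]) (by
      rintro i hi τ hF ⟨h9, h8⟩
      simp only [run, eval, Config.tick, write_apply, h9]
      refine ⟨by simp, fun k hk => ?_⟩
      by_cases h : k = i + 1
      · simp [h, h8 i le_rfl, pow_succ]; ring
      · simp [h, h8 k (by omega)])
  have e0 : (inp 5).eval st (run g st (set 9 (lit 0)) (run g st (setNat 8 (lit 0) (lit 1)) σ)) =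
      σ.nat 0 5 := by simp [eval, f0]
  rw [e0] at key
  exact key.2

theorem searchStep_effect {M k b : ℕ} {x : ℝ} (hM : M = cellOf (σ.nat 0 3) x) (hx : 0 ≤ x)
    (hk : σ.nat 1 0 = k) (hy : σ.real 1 k = x)
    (hb : σ.nat 9 0 = b + 1) (h8 : σ.nat 8 b = 2 ^ b)
    (h3 : σ.nat 3 0 ≤ M) (h3' : M < σ.nat 3 0 + 2 ^ (b + 1)) :
    (searchStep.run g st σ).nat 9 0 = b ∧ (searchStep.run g st σ).nat 3 0 ≤ M ∧
      M < (searchStep.run g st σ).nat 3 0 + 2 ^ b := by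
  have hx' : (0 : ℝ) ≤ σ.nat 0 3 * x := by positivity
  -- The two nested tests together decide `m ≤ M`. In this way the floor in `cellOf` is found by
  -- comparisons alone.
  have hle : ∀ m : ℕ, (m ≤ σ.nat 0 3 - 1 ∧ (m : ℝ) ≤ σ.nat 0 3 * x) ↔ m ≤ M := by
    intro m
    rw [hM, cellOf, le_min_iff, Nat.le_floor_iff hx']
  have hle' := hle (σ.nat 3 0 + 2 ^ b)
  rw [pow_succ] at h3'
  simp only [searchStep, run, eval, RExp.eval, Test.holds, Config.tick, hb]
  by_cases c1 : σ.nat 3 0 + 2 ^ b ≤ σ.nat 0 3 - 1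
  · by_cases c2 : ((σ.nat 3 0 + 2 ^ b : ℕ) : ℝ) ≤ σ.nat 0 3 * x
    · have := hle'.1 ⟨c1, c2⟩
      push_cast at c2
      simp [write_apply, hk, hy, h8, c1, c2]
      omega
    · have : ¬ σ.nat 3 0 + 2 ^ b ≤ M := fun h => c2 (hle'.2 h).2
      push_cast at c2
      simp [write_apply, hk, hy, h8, c1, c2]
      omega
  · have : ¬ σ.nat 3 0 + 2 ^ b ≤ M := fun h => c1 (hle'.2 h).1
    simp [write_apply, h8, c1]
    omega

theorem searchAxis_effect {k : ℕ} {x : ℝ} (hx : 0 ≤ x)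
    (hk : σ.nat 1 0 = k) (hy : σ.real 1 k = x) (h8 : ∀ i ≤ σ.nat 0 5, σ.nat 8 i = 2 ^ i)
    (hb : σ.nat 0 3 ≤ 2 ^ σ.nat 0 5) :
    (searchAxis.run g st σ).nat 3 0 = cellOf (σ.nat 0 3) x := by
  unfold searchAxis
  rw [run_seq, run_seq]
  have f0 : (run g st (set 9 (inp 5)) (run g st (set 3 (lit 0)) σ)).nat 0 = σ.nat 0 :=
    ((frame g st _ _).nat 0 rfl).trans ((frame g st _ _).nat 0 rfl)
  have f1 : (run g st (set 9 (inp 5)) (run g st (set 3 (lit 0)) σ)).nat 1 = σ.nat 1 :=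
    ((frame g st _ _).nat 1 rfl).trans ((frame g st _ _).nat 1 rfl)
  have f8 : (run g st (set 9 (inp 5)) (run g st (set 3 (lit 0)) σ)).nat 8 = σ.nat 8 :=
    ((frame g st _ _).nat 8 rfl).trans ((frame g st _ _).nat 8 rfl)
  have r1 : (run g st (set 9 (inp 5)) (run g st (set 3 (lit 0)) σ)).real 1 = σ.real 1 := rfl
  set M := cellOf (σ.nat 0 3) x with hM
  -- The search interval `[0, 2 ^ b)` contains `M` at the start, because `M < K ≤ 2 ^ b` if `K` is
  -- positive and `M = 0` otherwise.
  have hMb : M < 2 ^ σ.nat 0 5 := by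
    rcases Nat.eq_zero_or_pos (σ.nat 0 3) with h | h
    · have : M ≤ σ.nat 0 3 - 1 := min_le_left _ _
      have : 0 < 2 ^ σ.nat 0 5 := by positivity
      omega
    · have : M ≤ σ.nat 0 3 - 1 := min_le_left _ _
      omega
  have key := loop_invariant g st (inp 5) searchStep
    (run g st (set 9 (inp 5)) (run g st (set 3 (lit 0)) σ))
    (fun i τ => τ.nat 9 0 = σ.nat 0 5 - i ∧ τ.nat 3 0 ≤ M ∧ M < τ.nat 3 0 + 2 ^ (σ.nat 0 5 - i))
    (by simp [run, eval, write_apply, Config.tick, hMb]) (by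
      rintro i hi τ hF ⟨h9, h3, h3'⟩
      have hi' : i < σ.nat 0 5 := by simpa [eval, f0] using hi
      have n0 : (τ.tick 1).nat 0 = σ.nat 0 := (hF.nat 0 rfl).trans f0
      have e : σ.nat 0 5 - i = σ.nat 0 5 - (i + 1) + 1 := by omega
      rw [e] at h9 h3'
      refine searchStep_effect g st (τ.tick 1) (by rw [n0]) hx
        ((congrFun ((hF.nat 1 rfl).trans f1) 0).trans hk) ?_ h9 ?_ h3 h3'
      · exact (congrFun ((hF.real 1 rfl).trans r1) k).trans hy
      · exact (congrFun ((hF.nat 8 rfl).trans f8) _).trans (h8 _ (by omega)))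
  have e0 : (inp 5).eval st (run g st (set 9 (inp 5)) (run g st (set 3 (lit 0)) σ)) =
      σ.nat 0 5 := by simp [eval, f0]
  rw [e0] at key
  obtain ⟨-, h1, h2⟩ := key
  simp at h2
  omega

/-- Along the axes, variable `6` runs through the place values `K ^ i`, variable `10` collects the
index of the sub-cube, and entry `0` of real array `6` is reduced by each new coordinate, which
leaves the last barycentric coordinate there. -/
theorem locate_effect (hd : σ.nat 0 1 = d) (hx : ∀ k < d, 0 ≤ σ.real 1 k)
    (hb : σ.nat 0 3 ≤ 2 ^ σ.nat 0 5) :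
    (locate.run g st σ).nat 10 0 = cellIndex d (σ.nat 0 3) (σ.real 1) ∧
    ∀ k ≤ d, (locate.run g st σ).real 6 k = localCoord d (σ.nat 0 2) (σ.nat 0 3) (σ.real 1) k := by
  unfold locate
  rw [run_seq]
  have h1 := makePowers_effect g st σ
  have f1 := frame g st makePowers σ
  generalize makePowers.run g st σ = σ₁ at *
  rw [run_seq, run_seq, run_seq, run_seq]
  obtain ⟨σ₂, hσ₂⟩ : ∃ σ₂, σ₂ = run g st (setReal 6 (lit 0) (.ofNat (inp 2)))
      (run g st (set 1 (lit 0)) (run g st (set 6 (lit 1)) (run g st (set 10 (lit 0)) σ₁))) :=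
    ⟨_, rfl⟩
  rw [← hσ₂]
  have n0 : σ₂.nat 0 = σ.nat 0 := by
    rw [← f1.nat 0 rfl, hσ₂]; funext k; simp [run, write_apply, Config.tick]
  have n8 : σ₂.nat 8 = σ₁.nat 8 := by
    rw [hσ₂]; funext k; simp [run, write_apply, Config.tick]
  have r1 : σ₂.real 1 = σ.real 1 := by
    rw [← f1.real 1 rfl, hσ₂]; funext k; simp [run, write_apply, Config.tick]
  set K := σ.nat 0 3
  set l := σ.nat 0 2 with hl
  set y := σ.real 1
  have e0 : (inp 1).eval st σ₂ = d := by simp [eval, n0, hd]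
  have e2 : σ₁.nat 0 2 = l := by rw [f1.nat 0 rfl]
  have key := loop_invariant g st (inp 1) (searchAxis ;;
     set 10 (.add (var 10) (.mul (var 3) (var 6))) ;;
     set 6 (.mul (var 6) (inp 3)) ;;
     setReal 6 (.add (var 1) (lit 1)) (.mul (.ofNat (inp 2))
      (.sub (.mul (.ofNat (inp 3)) (.get 1 (var 1))) (.ofNat (var 3)))) ;;
     setReal 6 (lit 0) (.sub (.get 6 (lit 0)) (.get 6 (.add (var 1) (lit 1)))) ;;
     inc 1) σ₂ (fun i τ => τ.nat 1 0 = i ∧ τ.nat 6 0 = K ^ i ∧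
      τ.nat 10 0 = ∑ k ∈ Finset.range i, cellOf K (y k) * K ^ k ∧
      τ.real 6 0 = l - ∑ k ∈ Finset.range i, (l : ℝ) * (K * y k - cellOf K (y k)) ∧
      ∀ k < i, τ.real 6 (k + 1) = l * (K * y k - cellOf K (y k)))
    (by simp [hσ₂, run, eval, RExp.eval, write_apply, Config.tick, e2]) (by
      rintro i hi τ hF ⟨t1, t6, t10, z0, z⟩
      rw [e0] at hi
      have m0 : (τ.tick 1).nat 0 = σ.nat 0 := (hF.nat 0 rfl).trans n0
      have m8 : (τ.tick 1).nat 8 = σ₁.nat 8 := (hF.nat 8 rfl).trans n8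
      have s1 : (τ.tick 1).real 1 = y := (hF.real 1 rfl).trans r1
      have hs := searchAxis_effect g st (τ.tick 1) (hx i hi) t1 (by rw [s1])
        (by rw [m0, m8]; exact h1) (by rw [m0]; exact hb)
      have fs := frame g st searchAxis (τ.tick 1)
      rw [run_seq]
      generalize searchAxis.run g st (τ.tick 1) = υ at *
      rw [m0] at hs
      have u0 : υ.nat 0 = σ.nat 0 := (fs.nat 0 rfl).trans m0
      have u1 : υ.nat 1 0 = i := (congrFun (fs.nat 1 rfl) 0).trans t1
      have u6 : υ.nat 6 0 = K ^ i := (congrFun (fs.nat 6 rfl) 0).trans t6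
      have u10 : υ.nat 10 0 = _ := (congrFun (fs.nat 10 rfl) 0).trans t10
      have v1 : υ.real 1 = y := (fs.real 1 rfl).trans s1
      have v6 : υ.real 6 = τ.real 6 := fs.real 6 rfl
      simp only [run, eval, RExp.eval, Config.tick, write_apply]
      simp [u0, u1, u6, u10, v1, v6, hs, z0, pow_succ, Finset.sum_range_succ]
      refine ⟨Or.inl rfl, Or.inl rfl, ?_, fun k hk => ?_⟩
      · ring
      · by_cases hki : k = i
        · simp [hki, K, hl]
        · simp [hki, z k (by omega)])
  rw [e0] at key
  obtain ⟨-, -, h10, h0, hz⟩ := key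
  refine ⟨h10, fun k hk => ?_⟩
  cases k with
  | zero => exact h0
  | succ k => exact hz k hk

theorem readValue_effect : (readValue.run g st σ).real 4 0 =
      decode (σ.real 0 0) st (σ.nat 0 5) (σ.nat 11 0) ∧
    (readValue.run g st σ).nat 11 0 = σ.nat 11 0 + σ.nat 0 5 := by
  unfold readValue
  rw [run_seq, run_seq]
  have key := loop_invariant g st (inp 5)
    (ite (.natLE (lit 1) (stored (var 11))) (rset 4 (.add (.var 4) (.var 5))) skip ;;
     rset 5 (.div (.var 5) (.ofNat (lit 2))) ;;
     inc 11)
    (run g st (rset 5 (.div (.var 0) (.ofNat (lit 2)))) (run g st (rset 4 (.ofNat (lit 0))) σ))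
    (fun i τ => τ.real 4 0 = decode (σ.real 0 0) st i (σ.nat 11 0) ∧
      τ.real 5 0 = σ.real 0 0 / 2 ^ (i + 1) ∧ τ.nat 11 0 = σ.nat 11 0 + i)
    (by simp [run, eval, RExp.eval, write_apply, Config.tick, decode]) (by
      rintro i hi τ hF ⟨h4, h5, h11⟩
      simp only [run, eval, RExp.eval, Test.holds, Config.tick, h4, h5, h11]
      by_cases hc : st.getD (σ.nat 11 0 + i) false = true
      · simp only [hc]
        simp [write_apply, h5, h11, decode, Finset.sum_range_succ] at hc ⊢
        simp [hc]
        refine ⟨?_, by ring⟩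
        rw [pow_succ _ (i + 1)]; field_simp
      · simp only [hc]
        simp [write_apply, h4, h5, h11, decode, Finset.sum_range_succ] at hc ⊢
        simp [hc]
        refine ⟨?_, by ring⟩
        rw [pow_succ _ (i + 1)]; field_simp)
  have e0 : (inp 5).eval st (run g st (rset 5 (.div (.var 0) (.ofNat (lit 2))))
    (run g st (rset 4 (.ofNat (lit 0))) σ)) = σ.nat 0 5 := by
    simp [run, eval, Config.tick]
  rw [e0] at key
  exact ⟨key.1, key.2.2⟩

/-- Value and running time are tracked together because the inner loop runs `s k` times, a number
that the static bound cannot see. The sum of these lengths enters the bound, and for a composition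
of `ℓ` it is only `ℓ`. -/
theorem timesBasis_effect (hd : σ.nat 0 1 = d) : (timesBasis.run g st σ).real 4 0 =
      σ.real 4 0 * basis d (σ.nat 2) (σ.real 6) ∧
    (timesBasis.run g st σ).steps ≤ σ.steps + 100 * (d + 1 + ∑ k ∈ Finset.range (d + 1),
      σ.nat 2 k) := by
  unfold timesBasis
  rw [run_seq]
  have f1 := frame g st (set 1 (lit 0)) σ
  have h1 : ((set 1 (lit 0)).run g st σ).nat 1 0 = 0 := by simp [run, eval, write_apply]
  have s1 : ((set 1 (lit 0)).run g st σ).steps = σ.steps + 3 := by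
    simp [run, NExp.cost, Config.tick]
  generalize (set 1 (lit 0)).run g st σ = σ₁ at *
  have key := loop_invariant g st (.add (inp 1) (lit 1))
    (set 4 (lit 0) ;; loop (.get 2 (var 1)) timesFactor ;; inc 1) σ₁
    (fun i τ => τ.nat 1 0 = i ∧ τ.real 4 0 = σ.real 4 0 * ∏ k ∈ Finset.range i,
      ∏ t ∈ Finset.range (σ.nat 2 k), (σ.real 6 k - t) / (σ.nat 2 k - t) ∧
      τ.steps ≤ σ.steps + 10 + ∑ k ∈ Finset.range i, (20 + 30 * σ.nat 2 k))
    (by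
      refine ⟨h1, ?_, ?_⟩
      · simp [Config.tick, f1.real 4 rfl]
      · simp [Config.tick, s1, NExp.cost]) (by
      rintro i hi τ hF ⟨t1, t4, ts⟩
      rw [run_seq, run_seq]
      have g2 : ((set 4 (lit 0)).run g st (τ.tick 1)).nat 2 = σ.nat 2 :=
        ((frame g st _ _).nat 2 rfl).trans ((hF.nat 2 rfl).trans (f1.nat 2 rfl))
      have g6 : ((set 4 (lit 0)).run g st (τ.tick 1)).real 6 = σ.real 6 :=
        ((frame g st _ _).real 6 rfl).trans ((hF.real 6 rfl).trans (f1.real 6 rfl))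
      have g4 : ((set 4 (lit 0)).run g st (τ.tick 1)).nat 4 0 = 0 := by
        simp [run, eval, write_apply]
      have g1 : ((set 4 (lit 0)).run g st (τ.tick 1)).nat 1 0 = i :=
        (congrFun ((frame g st (set 4 (lit 0)) (τ.tick 1)).nat 1 rfl) 0).trans t1
      have gr4 : ((set 4 (lit 0)).run g st (τ.tick 1)).real 4 0 = τ.real 4 0 := rfl
      have gs : ((set 4 (lit 0)).run g st (τ.tick 1)).steps = τ.steps + 4 := by
        simp [run, NExp.cost, Config.tick]
      generalize (set 4 (lit 0)).run g st (τ.tick 1) = υ at *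
      have key := loop_invariant g st (.get 2 (var 1)) timesFactor υ
        (fun j ω => ω.nat 4 0 = j ∧ ω.real 4 0 = τ.real 4 0 * ∏ t ∈ Finset.range j,
          (σ.real 6 i - t) / (σ.nat 2 i - t) ∧ ω.steps ≤ υ.steps + 4 + 30 * j)
        (by simp [Config.tick, g4, gr4, NExp.cost]) (by
          rintro j hj ω hω ⟨w4, wr, ws⟩
          have w2 : ω.nat 2 = σ.nat 2 := (hω.nat 2 rfl).trans g2
          have w1 : ω.nat 1 0 = i := (congrFun (hω.nat 1 rfl) 0).trans g1
          have w6 : ω.real 6 = σ.real 6 := (hω.real 6 rfl).trans g6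
          simp only [timesFactor, run, eval, RExp.eval, Config.tick, write_apply, NExp.cost,
            RExp.cost]
          refine ⟨by simp [w4], ?_, by omega⟩
          rw [Finset.prod_range_succ, ← mul_assoc, ← wr]
          simp [w4, w2, w1, w6])
      have e0 : (NExp.get 2 (var 1)).eval st υ = σ.nat 2 i := by simp [eval, g1, g2]
      have fl := frame g st (loop (.get 2 (var 1)) timesFactor) υ
      rw [e0] at key
      generalize (loop (.get 2 (var 1)) timesFactor).run g st υ = ω at *
      have w1 : ω.nat 1 0 = i := (congrFun (fl.nat 1 rfl) 0).trans g1
      obtain ⟨k1, k2, k3⟩ := key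
      simp only [run, eval, Config.tick, write_apply, NExp.cost, w1]
      refine ⟨by simp, ?_, ?_⟩
      · rw [Finset.prod_range_succ, ← mul_assoc, k2, t4]
      · rw [Finset.sum_range_succ]
        omega)
  have e0 : (NExp.add (inp 1) (lit 1)).eval st σ₁ = d + 1 := by simp [eval, f1.nat 0 rfl, hd]
  rw [e0] at key
  refine ⟨key.2.1, key.2.2.trans ?_⟩
  rw [Finset.sum_add_distrib, ← Finset.mul_sum]
  simp
  omega

theorem basis_congr {m : ℕ} {s s' : ℕ → ℕ} {z z' : ℕ → ℝ} (hs : ∀ k ≤ m, s k = s' k)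
    (hz : ∀ k ≤ m, z k = z' k) : basis m s z = basis m s' z' := by
  unfold basis
  refine Finset.prod_congr rfl fun k hk => ?_
  have hk' : k ≤ m := Nat.lt_succ_iff.1 (Finset.mem_range.1 hk)
  rw [hs k hk', hz k hk']

theorem addTerm_effect (hd : σ.nat 0 1 = d) :
    (addTerm.run g st σ).real 2 0 = σ.real 2 0 +
      decode (σ.real 0 0) st (σ.nat 0 5) (σ.nat 11 0) * basis d (σ.nat 2) (σ.real 6) ∧
    (addTerm.run g st σ).nat 11 0 = σ.nat 11 0 + σ.nat 0 5 ∧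
    (∀ a b, (∀ k ≤ d, σ.nat 2 k = a k) → Step d a b →
      ∀ k ≤ d, (addTerm.run g st σ).nat 2 k = b k) ∧
    (addTerm.run g st σ).steps ≤ σ.steps + 200 * (1 + d + σ.nat 0 5 +
      ∑ k ∈ Finset.range (d + 1), σ.nat 2 k) := by
  unfold addTerm
  rw [run_seq, run_seq, run_seq]
  obtain ⟨h1, h1'⟩ := readValue_effect g st σ
  have f1 := frame g st readValue σ
  have s1 := steps_le g st readValue rfl rfl σ σ rfl
  have b1 : readValue.bound st σ ≤ 30 * (1 + σ.nat 0 5) := by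
    simp [readValue, bound, NExp.cost, RExp.cost, Test.cost, eval]
    omega
  generalize readValue.run g st σ = σ₁ at *
  have n0 : σ₁.nat 0 = σ.nat 0 := f1.nat 0 rfl
  have n2 : σ₁.nat 2 = σ.nat 2 := f1.nat 2 rfl
  have r6 : σ₁.real 6 = σ.real 6 := f1.real 6 rfl
  obtain ⟨h2, s2⟩ := timesBasis_effect g st σ₁ (by rw [n0, hd])
  have f2 := frame g st timesBasis σ₁
  generalize timesBasis.run g st σ₁ = σ₂ at *
  have f3 := frame g st (rset 2 (.add (.var 2) (.var 4))) σ₂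
  have h3 : ((rset 2 (.add (.var 2) (.var 4))).run g st σ₂).real 2 0 =
      σ₂.real 2 0 + σ₂.real 4 0 := by simp [run, RExp.eval, eval, write_apply]
  have s3 : ((rset 2 (.add (.var 2) (.var 4))).run g st σ₂).steps = σ₂.steps + 7 := by
    simp [run, NExp.cost, RExp.cost, Config.tick]
  generalize (rset 2 (.add (.var 2) (.var 4))).run g st σ₂ = σ₃ at *
  have f4 := frame g st nextComp σ₃
  have m0 : σ₃.nat 0 = σ.nat 0 := (f3.nat 0 rfl).trans ((f2.nat 0 rfl).trans n0)
  have m2 : σ₃.nat 2 = σ.nat 2 := (f3.nat 2 rfl).trans ((f2.nat 2 rfl).trans n2)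
  have s4 := steps_le g st nextComp rfl rfl σ σ₃ m0
  have b4 : nextComp.bound st σ ≤ 50 * (1 + d) := by
    simp [nextComp, bound, NExp.cost, Test.cost, eval, hd]
    omega
  refine ⟨?_, ?_, fun a b ha hab => ?_, ?_⟩
  · rw [f4.real 2 rfl, h3, h2, h1, n2, r6, f2.real 2 rfl, f1.real 2 rfl]
  · rw [f4.nat 11 rfl, f3.nat 11 rfl, f2.nat 11 rfl, h1']
  · exact nextComp_effect g st σ₃ (by rw [m0, hd]) (by rwa [m2]) hab
  · rw [n2] at s2
    omega

theorem locate_bound : locate.bound st σ ≤ 300 * ((1 + σ.nat 0 1) * (1 + σ.nat 0 5)) := by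
  simp [locate, makePowers, searchAxis, searchStep, bound, NExp.cost, RExp.cost, Test.cost, eval]
  nlinarith [Nat.zero_le (σ.nat 0 1 * σ.nat 0 5)]

/-- Variable `11` is the reading position. It jumps once to the block of the sub-cube and then
advances by one value per term, in step with the enumeration of compositions. `hsum` gives all terms
the same time bound. -/
theorem qryProg_effect {s : ℕ → ℕ → ℕ} (hd : σ.nat 0 1 = d) (hx : ∀ k < d, 0 ≤ σ.real 1 k)
    (hb : σ.nat 0 3 ≤ 2 ^ σ.nat 0 5) (h2 : σ.nat 2 = 0) (hr : σ.real 2 0 = 0)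
    (hs0 : ∀ k ≤ d, s 0 k = if k = 0 then σ.nat 0 2 else 0)
    (hs : ∀ i, i + 1 < σ.nat 0 4 → Step d (s i) (s (i + 1)))
    (hsum : ∀ i < σ.nat 0 4, ∑ k ∈ Finset.range (d + 1), s i k = σ.nat 0 2) :
    (qryProg.run g st σ).real 2 0 = ∑ i ∈ Finset.range (σ.nat 0 4),
      decode (σ.real 0 0) st (σ.nat 0 5)
        (cellIndex d (σ.nat 0 3) (σ.real 1) * (σ.nat 0 4 * σ.nat 0 5) + i * σ.nat 0 5) *
      basis d (s i) (localCoord d (σ.nat 0 2) (σ.nat 0 3) (σ.real 1)) ∧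
    (qryProg.run g st σ).steps ≤ σ.steps + 20 + 300 * ((1 + d) * (1 + σ.nat 0 5)) +
      σ.nat 0 4 * (201 * (1 + d + σ.nat 0 5 + σ.nat 0 2)) := by
  unfold qryProg
  rw [run_seq, run_seq, run_seq]
  obtain ⟨h10, h6⟩ := locate_effect g st σ hd hx hb
  have f1 := frame g st locate σ
  have s1 := steps_le g st locate rfl rfl σ σ rfl
  have b1 := locate_bound st σ
  rw [hd] at b1
  generalize locate.run g st σ = σ₁ at *
  have n0 : σ₁.nat 0 = σ.nat 0 := f1.nat 0 rfl
  have n2 : σ₁.nat 2 = 0 := (f1.nat 2 rfl).trans h2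
  obtain ⟨σ₂, hσ₂⟩ : ∃ σ₂, σ₂ = run g st (setNat 2 (lit 0) (inp 2))
    (run g st (set 11 (.mul (var 10) (.mul (inp 4) (inp 5)))) σ₁) := ⟨_, rfl⟩
  rw [← hσ₂]
  have m0 : σ₂.nat 0 = σ.nat 0 := by
    rw [← n0, hσ₂]; funext k; simp [run, write_apply, Config.tick]
  have m2 : ∀ k ≤ d, σ₂.nat 2 k = s 0 k := by
    intro k hk
    rw [hs0 k hk, hσ₂]
    simp [run, write_apply, Config.tick, eval, n0, n2]
  have m11 : σ₂.nat 11 0 =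
      cellIndex d (σ.nat 0 3) (σ.real 1) * (σ.nat 0 4 * σ.nat 0 5) := by
    rw [hσ₂]; simp [run, write_apply, Config.tick, eval, n0, h10]
  have r0 : σ₂.real 0 = σ.real 0 := by rw [← f1.real 0 rfl, hσ₂]; rfl
  have r6 : σ₂.real 6 = σ₁.real 6 := by rw [hσ₂]; rfl
  have r2 : σ₂.real 2 0 = 0 := by rw [← hr, ← f1.real 2 rfl, hσ₂]; rfl
  have s2 : σ₂.steps = σ₁.steps + 14 := by
    rw [hσ₂]; simp [run, Config.tick, NExp.cost]
  have e0 : (inp 4).eval st σ₂ = σ.nat 0 4 := by simp [eval, m0]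
  have key := loop_invariant g st (inp 4) addTerm σ₂ (fun i τ =>
    τ.real 2 0 = ∑ i ∈ Finset.range i, decode (σ.real 0 0) st (σ.nat 0 5)
        (cellIndex d (σ.nat 0 3) (σ.real 1) * (σ.nat 0 4 * σ.nat 0 5) + i * σ.nat 0 5) *
      basis d (s i) (localCoord d (σ.nat 0 2) (σ.nat 0 3) (σ.real 1)) ∧
    τ.nat 11 0 = cellIndex d (σ.nat 0 3) (σ.real 1) * (σ.nat 0 4 * σ.nat 0 5) + i * σ.nat 0 5 ∧
    (i < σ.nat 0 4 → ∀ k ≤ d, τ.nat 2 k = s i k) ∧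
    τ.steps ≤ σ₂.steps + 3 + i * (201 * (1 + d + σ.nat 0 5 + σ.nat 0 2)))
    (by simpa [Config.tick, r2, m11, NExp.cost] using fun _ => m2) (by
      rintro i hi τ hF ⟨t2, t11, tc, ts⟩
      rw [e0] at hi
      have p0 : (τ.tick 1).nat 0 = σ.nat 0 := (hF.nat 0 rfl).trans m0
      have q0 : (τ.tick 1).real 0 = σ.real 0 := (hF.real 0 rfl).trans r0
      have q6 : (τ.tick 1).real 6 = σ₁.real 6 := (hF.real 6 rfl).trans r6
      have t2' : (τ.tick 1).real 2 0 = _ := t2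
      have t11' : (τ.tick 1).nat 11 0 = _ := t11
      have tc' : ∀ k ≤ d, (τ.tick 1).nat 2 k = s i k := tc hi
      have ts' : (τ.tick 1).steps = τ.steps + 1 := rfl
      obtain ⟨a1, a2, a3, a4⟩ := addTerm_effect g st (τ.tick 1) (by rw [p0, hd])
      have hbs : basis d ((τ.tick 1).nat 2) ((τ.tick 1).real 6) =
          basis d (s i) (localCoord d (σ.nat 0 2) (σ.nat 0 3) (σ.real 1)) :=
        basis_congr tc' (by rw [q6]; exact h6)
      have hsm : ∑ k ∈ Finset.range (d + 1), (τ.tick 1).nat 2 k = σ.nat 0 2 := by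
        rw [← hsum i hi]
        exact Finset.sum_congr rfl fun k hk => tc' k (Nat.lt_succ_iff.1 (Finset.mem_range.1 hk))
      refine ⟨?_, ?_, fun hlt => a3 _ _ tc' (hs i hlt), ?_⟩
      · rw [a1, hbs, p0, q0, t11', t2', Finset.sum_range_succ]
      · rw [a2, t11', p0]; ring
      · rw [hsm, p0, ts'] at a4
        rw [Nat.add_mul]
        omega)
  rw [e0] at key
  refine ⟨key.1, key.2.2.2.trans ?_⟩
  omega

end

/-! ## Quantization -/

/-- Each step halves the interval. Its upper end is included, which admits `v = L`: then all digits
are `1` and the remainder is `L / 2 ^ b`. -/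
theorem remainder_mem {L v : ℝ} (h0 : 0 ≤ v) (h1 : v ≤ L) (b : ℕ) :
    0 ≤ remainder L v b ∧ remainder L v b ≤ L / 2 ^ b := by
  induction b with
  | zero => simpa [remainder] using ⟨h0, h1⟩
  | succ b ih =>
    have h2 : L / 2 ^ b = L / 2 ^ (b + 1) + L / 2 ^ (b + 1) := by rw [pow_succ]; field_simp; ring
    simp only [remainder]
    split_ifs with h
    · exact ⟨by linarith, by linarith [ih.2]⟩
    · exact ⟨ih.1, by linarith⟩

theorem sum_digit (L v : ℝ) (b : ℕ) :
    (∑ m ∈ Finset.range b, if digit L v m then L / 2 ^ (m + 1) else 0) = v - remainder L v b := by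
  induction b with
  | zero => simp [remainder]
  | succ b ih =>
    rw [Finset.sum_range_succ, ih]
    by_cases h : L / 2 ^ (b + 1) ≤ remainder L v b
    · simp [remainder, digit, h]
      ring
    · simp [remainder, digit, h]

theorem measurable_remainder (L : ℝ) (b : ℕ) : Measurable fun v => remainder L v b := by
  induction b with
  | zero => exact measurable_id
  | succ b ih =>
    simp only [remainder]
    exact Measurable.ite (measurableSet_le measurable_const ih) (ih.sub_const _) ih

theorem measurable_digit (L : ℝ) (m : ℕ) : Measurable fun v => digit L v m := by
  refine measurable_to_bool ?_
  simpa [digit, Set.preimage] using measurableSet_le measurable_const (measurable_remainder L m)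

theorem length_flatMap_range {α : Type*} {w : ℕ} (N : ℕ) (F : ℕ → List α)
    (hF : ∀ i, (F i).length = w) : ((List.range N).flatMap F).length = N * w := by
  simp [List.length_flatMap, hF]

theorem getD_flatMap_range {α : Type*} {w : ℕ} (N : ℕ) (F : ℕ → List α) (x : α)
    (hF : ∀ i, (F i).length = w) {i b : ℕ} (hi : i < N) (hb : b < w) :
    ((List.range N).flatMap F).getD (i * w + b) x = (F i).getD b x := by
  induction N with
  | zero => omega
  | succ N ih =>
    rw [List.range_succ, List.flatMap_append]
    have hl := length_flatMap_range N F hF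
    rcases Nat.lt_succ_iff_lt_or_eq.1 hi with h | rfl
    · rw [List.getD_append, ih h]
      rw [hl]
      calc i * w + b < (i + 1) * w := by rw [Nat.add_mul]; omega
        _ ≤ N * w := Nat.mul_le_mul_right _ h
    · rw [List.getD_append_right _ _ _ _ (by rw [hl]; omega), hl]
      simp

/-- The bits stored for a function `g`. -/
noncomputable def storedBits (d ℓ K B b : ℕ) (L : ℝ) (g : E d → ℝ) : List Bool :=
  (List.range (K ^ d)).flatMap fun c => (List.range B).flatMap fun i =>
    digits b L (clip L (g (gridPoint d ℓ K c (compSeq d ℓ i))))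

theorem length_digits (b : ℕ) (L v : ℝ) : (digits b L v).length = b := by simp [digits]

theorem length_storedBits (d ℓ K B b : ℕ) (L : ℝ) (g : E d → ℝ) :
    (storedBits d ℓ K B b L g).length = K ^ d * (B * b) :=
  length_flatMap_range _ _ fun _ => length_flatMap_range _ _ fun _ => length_digits _ _ _

/-- Every value occupies `b` bits and every sub-cube `B * b`, so positions in the store are a matter
of arithmetic; the weighted sum of the digits telescopes by `sum_digit`. -/
theorem decode_storedBits {d ℓ K B b : ℕ} {L : ℝ} {g : E d → ℝ} {c i : ℕ} (hc : c < K ^ d)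
    (hi : i < B) : decode L (storedBits d ℓ K B b L g) b (c * (B * b) + i * b) =
      clip L (g (gridPoint d ℓ K c (compSeq d ℓ i))) -
        remainder L (clip L (g (gridPoint d ℓ K c (compSeq d ℓ i)))) b := by
  rw [← sum_digit]
  unfold decode
  refine Finset.sum_congr rfl fun m hm => ?_
  have hm' : m < b := Finset.mem_range.1 hm
  have hlt : i * b + m < B * b := by
    calc i * b + m < (i + 1) * b := by rw [Nat.add_mul]; omega
      _ ≤ B * b := Nat.mul_le_mul_right _ hi
  unfold storedBits
  rw [add_assoc, getD_flatMap_range (w := B * b) _ _ _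
    (fun _ => length_flatMap_range _ _ fun _ => length_digits _ _ _) hc hlt,
    getD_flatMap_range (w := b) _ _ _ (fun _ => length_digits _ _ _) hi hm']
  simp [digits, hm']

theorem measurable_clip (L : ℝ) : Measurable (clip L) := by
  unfold clip
  fun_prop

theorem clip_mem {L : ℝ} (hL : 0 ≤ L) (v : ℝ) : 0 ≤ clip L v ∧ clip L v ≤ L :=
  ⟨le_max_left _ _, max_le hL (min_le_right _ _)⟩

/-! ## Cells and coordinates -/

/-- The coordinates of a point, extended by zero. -/
noncomputable def coords {d : ℕ} (y : E d) (k : ℕ) : ℝ := if h : k < d then y ⟨k, h⟩ else 0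

theorem coords_val {d : ℕ} (y : E d) (k : Fin d) : coords y k = y k := by simp [coords]

/-- The barycentric coordinates of `y` in the sub-cube `j`. -/
noncomputable def bary (d ℓ K : ℕ) (j : ℕ → ℕ) (y : ℕ → ℝ) : ℕ → ℝ
  | 0 => ℓ - ∑ k ∈ Finset.range d, (ℓ : ℝ) * (K * y k - j k)
  | k + 1 => ℓ * (K * y k - j k)

theorem localCoord_eq (d ℓ K : ℕ) (y : ℕ → ℝ) :
    localCoord d ℓ K y = bary d ℓ K (fun k => cellOf K (y k)) y := by
  funext k
  cases k <;> rfl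

theorem sum_bary (d ℓ K : ℕ) (j : ℕ → ℕ) (y : ℕ → ℝ) :
    ∑ k ∈ Finset.range (d + 1), bary d ℓ K j y k = ℓ := by
  rw [Finset.sum_range_succ']
  simp [bary]

theorem cellOf_lt {K : ℕ} (hK : 0 < K) (x : ℝ) : cellOf K x < K := by
  have : cellOf K x ≤ K - 1 := min_le_left _ _
  omega

theorem cellOf_le {K : ℕ} {x : ℝ} (hx : 0 ≤ x) : (cellOf K x : ℝ) ≤ K * x := by
  have h : cellOf K x ≤ ⌊(K : ℝ) * x⌋₊ := min_le_right _ _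
  exact (Nat.le_floor_iff (by positivity)).1 h

/-- The minimum in `cellOf` matters at `x = 1`, where the floor alone would point beyond the last
sub-cube. -/
theorem le_cellOf {K : ℕ} (hK : 0 < K) {x : ℝ} (hx1 : x ≤ 1) : K * x ≤ (cellOf K x : ℝ) + 1 := by
  unfold cellOf
  rcases le_total (K - 1) ⌊(K : ℝ) * x⌋₊ with h | h
  · rw [min_eq_left h]
    have : ((K - 1 : ℕ) : ℝ) + 1 = K := by exact_mod_cast Nat.sub_add_cancel hK
    rw [this]
    have : (0 : ℝ) < K := by exact_mod_cast hK
    nlinarith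
  · rw [min_eq_right h]
    exact (Nat.lt_floor_add_one _).le

/-- The sub-cube that contains `y`. -/
noncomputable def cellFun {K : ℕ} (hK : 0 < K) {d : ℕ} (y : E d) : Fin d → Fin K :=
  fun k => ⟨cellOf K (y k), cellOf_lt hK _⟩

theorem mem_subCube_cellFun {K : ℕ} (hK : 0 < K) {d : ℕ} {y : E d} (hy : y ∈ cube d) :
    y ∈ subCube K (cellFun hK y) := by
  have hK' : (0 : ℝ) < K := by exact_mod_cast hK
  intro i
  rw [div_le_iff₀ hK', le_div_iff₀ hK', mul_comm]
  exact ⟨cellOf_le (hy i).1, le_cellOf hK (hy i).2⟩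

/-- The index of a sub-cube. -/
def indexOf {d K : ℕ} (j : Fin d → Fin K) : ℕ := ∑ k, (j k : ℕ) * K ^ (k : ℕ)

theorem indexOf_lt {d K : ℕ} (j : Fin d → Fin K) : indexOf j < K ^ d := by
  have := (finFunctionFinEquiv j).2
  rwa [finFunctionFinEquiv_apply] at this

theorem indexOf_digit {d K : ℕ} (j : Fin d → Fin K) (k : Fin d) :
    indexOf j / K ^ (k : ℕ) % K = j k := by
  have := congrArg Fin.val (congrFun (finFunctionFinEquiv.symm_apply_apply j) k)
  rw [← this]
  unfold indexOf
  rw [← finFunctionFinEquiv_apply]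
  rfl

theorem cellIndex_coords {K : ℕ} (hK : 0 < K) {d : ℕ} (y : E d) :
    cellIndex d K (coords y) = indexOf (cellFun hK y) := by
  unfold cellIndex indexOf
  rw [Finset.sum_range]
  simp [coords_val, cellFun]

theorem gridPoint_indexOf {d ℓ K : ℕ} (j : Fin d → Fin K) (s : ℕ → ℕ) :
    gridPoint d ℓ K (indexOf j) s = meshPoint ℓ K j fun k => s (k + 1) := by
  unfold gridPoint meshPoint
  congr 1
  funext k
  rw [indexOf_digit]

theorem gridPoint_eq_meshPoint {d ℓ K : ℕ} {c : ℕ} (hc : c < K ^ d) (s : ℕ → ℕ) :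
    ∃ j : Fin d → Fin K, gridPoint d ℓ K c s = meshPoint ℓ K j fun k => s (k + 1) := by
  refine ⟨finFunctionFinEquiv.symm ⟨c, hc⟩, ?_⟩
  rw [← gridPoint_indexOf]
  congr 1
  unfold indexOf
  rw [← finFunctionFinEquiv_apply, Equiv.apply_symm_apply]

theorem sum_tail_le {d ℓ : ℕ} {s : ℕ → ℕ} (hs : s ∈ Finset.piAntidiag (Finset.range (d + 1)) ℓ) :
    ∑ k : Fin d, s (k + 1) ≤ ℓ := by
  have h := (Finset.mem_piAntidiag.1 hs).1
  rw [Finset.sum_range_succ', Finset.sum_range] at h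
  omega

theorem meshPoint_mem_cube {d ℓ K : ℕ} (j : Fin d → Fin K) {s : Fin d → ℕ} (hs : ∑ i, s i ≤ ℓ) :
    meshPoint ℓ K j s ∈ cube d := by
  intro i
  have hK : (0 : ℝ) < K := by exact_mod_cast (Nat.zero_le _).trans_lt (j i).2
  have h1 : s i ≤ ℓ := (Finset.single_le_sum (fun _ _ => Nat.zero_le _) (Finset.mem_univ i)).trans hs
  have h2 : ((s i : ℝ) / ℓ) ≤ 1 := div_le_one_of_le₀ (by exact_mod_cast h1) (by positivity)
  have h3 : ((j i : ℕ) : ℝ) + 1 ≤ K := by exact_mod_cast (j i).2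
  simp only [meshPoint]
  refine ⟨by positivity, ?_⟩
  rw [div_le_one hK]
  linarith

/-! ## The estimator -/

section
variable {n d : ℕ} {β L : ℝ}

theorem gridSize_pos (hn : 2 ≤ n) (hβ : 0 < β) : 0 < gridSize n d β := by
  unfold gridSize
  rw [Nat.floor_pos]
  refine Real.one_le_rpow (by exact_mod_cast (by omega : 1 ≤ n)) (by positivity)

/-- The exponent `1 / (2β + d)` is at most `1`. The bound lets the binary search get by with
`n.size` rounds. -/
theorem gridSize_le (hd : 1 ≤ d) (hn : 2 ≤ n) (hβ : 0 < β) : gridSize n d β ≤ n := by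
  have hd' : (1 : ℝ) ≤ d := by exact_mod_cast hd
  have h : ((gridSize n d β : ℕ) : ℝ) ≤ n := by
    refine (Nat.floor_le (by positivity)).trans ?_
    conv_rhs => rw [← Real.rpow_one (n : ℝ)]
    refine Real.rpow_le_rpow_of_exponent_le (by exact_mod_cast (by omega : 1 ≤ n)) ?_
    rw [div_le_one (by linarith)]
    linarith
  exact_mod_cast h

theorem gridSize_pow_le : ((gridSize n d β ^ d : ℕ) : ℝ) ≤ (n : ℝ) ^ ((d : ℝ) / (2 * β + d)) := by
  push_cast
  calc (gridSize n d β : ℝ) ^ d ≤ ((n : ℝ) ^ (1 / (2 * β + d))) ^ d := by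
        gcongr
        exact Nat.floor_le (by positivity)
    _ = (n : ℝ) ^ ((d : ℝ) / (2 * β + d)) := by
        rw [← Real.rpow_natCast, ← Real.rpow_mul (by positivity)]
        congr 1
        ring

theorem compSeq_start {ℓ : ℕ} : ∀ k ≤ d, compSeq d ℓ 0 k = if k = 0 then ℓ else 0 := by
  intro k _
  rw [compSeq_zero, Pi.single_apply]

theorem preprocess_effect (hn : 2 ≤ n) (hβ : 0 < β) (hL : 0 < L) (g : E d → ℝ) :
    (preprocess preProg n d β L g).out = storedBits d (strictFloor β) (gridSize n d β)
      ((strictFloor β + d).choose d) n.size L g ∧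
    (preprocess preProg n d β L g).asked = (List.range (gridSize n d β ^ d)).flatMap fun c =>
      (List.range ((strictFloor β + d).choose d)).map fun i =>
        gridPoint d (strictFloor β) (gridSize n d β) c (compSeq d (strictFloor β) i) := by
  have h := preProg_effect g [] (start n d (strictFloor β) (gridSize n d β) L 0)
    (s := compSeq d (strictFloor β)) (by simp [start])
    (by simpa [start] using gridSize_pos hn hβ) (by simpa [start] using hL.le)
    (by funext k; simp [start]) (by simpa [start] using compSeq_start)
    (by simpa [start] using fun i hi => step_compSeq hi)
  simpa [start, storedBits, preprocess] using h

theorem evaluate_effect (hd : 1 ≤ d) (hn : 2 ≤ n) (hβ : 0 < β) (bits : List Bool) {y : E d}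
    (hy : y ∈ cube d) :
    (evaluate qryProg n d β L bits y).real 2 0 =
      ∑ i ∈ Finset.range ((strictFloor β + d).choose d), decode L bits n.size
        (cellIndex d (gridSize n d β) (coords y) * ((strictFloor β + d).choose d * n.size) +
          i * n.size) * basis d (compSeq d (strictFloor β) i)
            (localCoord d (strictFloor β) (gridSize n d β) (coords y)) ∧
    (evaluate qryProg n d β L bits y).steps ≤ 20 + 300 * ((1 + d) * (1 + n.size)) +
      (strictFloor β + d).choose d * (201 * (1 + d + n.size + strictFloor β)) := by
  have hc : (start n d (strictFloor β) (gridSize n d β) L y).real 1 = coords y := by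
    funext k
    simp [start, coords]
  have h := qryProg_effect (fun _ => 0) bits (start n d (strictFloor β) (gridSize n d β) L y)
    (s := compSeq d (strictFloor β)) (by simp [start])
    (by
      rw [hc]
      intro k hk
      simpa [coords, hk] using (hy ⟨k, hk⟩).1)
    (by simpa [start] using (gridSize_le hd hn hβ).trans n.lt_size_self.le)
    (by funext k; simp [start]) (by simp [start])
    (by simpa [start] using compSeq_start)
    (by simpa [start] using fun i hi => step_compSeq hi)
    (by simpa [start] using fun i hi => (Finset.mem_piAntidiag.1 (compSeq_mem hi)).1)
  rw [hc] at h
  simpa [start, evaluate] using h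

/-- The stored approximation of the value `v`. -/
noncomputable def quantize (n : ℕ) (L v : ℝ) : ℝ := clip L v - remainder L (clip L v) n.size

theorem quantize_nonneg (hL : 0 ≤ L) (v : ℝ) : 0 ≤ quantize n L v := by
  unfold quantize
  rw [← sum_digit]
  exact Finset.sum_nonneg fun m _ => by split_ifs <;> positivity

theorem quantize_le (hL : 0 ≤ L) (v : ℝ) : quantize n L v ≤ L := by
  have h := clip_mem hL v
  have := (remainder_mem h.1 h.2 n.size).1
  unfold quantize
  linarith

theorem abs_quantize_sub_clip_le (hL : 0 ≤ L) (hn : 0 < n) (v : ℝ) :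
    |quantize n L v - clip L v| ≤ L / n := by
  have h := clip_mem hL v
  obtain ⟨h1, h2⟩ := remainder_mem h.1 h.2 n.size
  -- `n.size` digits give precision `L / n` because `n < 2 ^ n.size`.
  have h3 : L / 2 ^ n.size ≤ L / n := by
    have : (n : ℝ) ≤ 2 ^ n.size := by exact_mod_cast n.lt_size_self.le
    have : (0 : ℝ) < n := by exact_mod_cast hn
    gcongr
  unfold quantize
  rw [abs_le]
  constructor <;> linarith [div_nonneg hL (Nat.cast_nonneg (α := ℝ) n)]

/-- The interpolation formula on the sub-cube `j`. -/
noncomputable def interpolate (n ℓ K : ℕ) (L : ℝ) (g : E d → ℝ) (j : Fin d → Fin K)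
    (y : E d) : ℝ :=
  ∑ s ∈ Finset.piAntidiag (Finset.range (d + 1)) ℓ,
    quantize n L (g (meshPoint ℓ K j fun k => s (k + 1))) *
      basis d s (bary d ℓ K (fun k => if h : k < d then j ⟨k, h⟩ else 0) (coords y))

theorem bary_congr {d ℓ K : ℕ} {j j' : ℕ → ℕ} {y : ℕ → ℝ} (h : ∀ k < d, j k = j' k) :
    ∀ k ≤ d, bary d ℓ K j y k = bary d ℓ K j' y k := by
  intro k hk
  cases k with
  | zero =>
    simp only [bary]
    congr 1
    exact Finset.sum_congr rfl fun k hk => by rw [h k (Finset.mem_range.1 hk)]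
  | succ k => simp only [bary]; rw [h k hk]

/-- The link between the machine and the analysis: what the two programs compute together is the
explicit interpolation formula on the sub-cube found by the search. -/
theorem compressed_eq (hd : 1 ≤ d) (hn : 2 ≤ n) (hβ : 0 < β) (hL : 0 < L) (g : E d → ℝ) {y : E d}
    (hy : y ∈ cube d) : compressed preProg qryProg n d β L g y =
      interpolate n (strictFloor β) (gridSize n d β) L g (cellFun (gridSize_pos hn hβ) y) y := by
  unfold compressed
  rw [(evaluate_effect hd hn hβ _ hy).1, (preprocess_effect hn hβ hL g).1,
    cellIndex_coords (gridSize_pos hn hβ)]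
  unfold interpolate
  rw [← sum_compSeq]
  refine Finset.sum_congr rfl fun i hi => ?_
  rw [decode_storedBits (indexOf_lt _) (Finset.mem_range.1 hi), gridPoint_indexOf]
  unfold quantize
  congr 1
  refine basis_congr (fun _ _ => rfl) ?_
  rw [localCoord_eq]
  refine bary_congr fun k hk => ?_
  simp [hk, cellFun, coords]

end

/-! ## Lagrange interpolation on the principal lattice -/

/-- The compositions of `ℓ` into parts with indices `0, …, d`. -/
abbrev Comp (d ℓ : ℕ) : Finset (ℕ → ℕ) := Finset.piAntidiag (Finset.range (d + 1)) ℓ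

/-- The absorption identity `(s + 1) binom(z, s + 1) = z binom(z - 1, s)`. The facts about
reproduction of polynomials rest on it. -/
theorem basisFactor_succ (z : ℝ) (s : ℕ) :
    ((s : ℝ) + 1) * ∏ t ∈ Finset.range (s + 1), (z - t) / (((s + 1 : ℕ) : ℝ) - t) =
      z * ∏ t ∈ Finset.range s, (z - 1 - t) / ((s : ℝ) - t) := by
  rw [Finset.prod_range_succ']
  have h : ∀ t ∈ Finset.range s, (z - ((t + 1 : ℕ) : ℝ)) / (((s + 1 : ℕ) : ℝ) - ((t + 1 : ℕ) : ℝ)) =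
      (z - 1 - t) / ((s : ℝ) - t) := by
    intro t _
    push_cast
    congr 1 <;> ring
  rw [Finset.prod_congr rfl h]
  have : (s : ℝ) + 1 ≠ 0 := by positivity
  push_cast
  field_simp
  ring

theorem succ_mul_basis {d k : ℕ} (hk : k ≤ d) (s : ℕ → ℕ) (z : ℕ → ℝ) :
    ((s k : ℝ) + 1) * basis d (s + Pi.single k 1) z = z k * basis d s (z - Pi.single k 1) := by
  have hmem : k ∈ Finset.range (d + 1) := Finset.mem_range.2 (by omega)
  unfold basis
  rw [← Finset.mul_prod_erase _ _ hmem, ← Finset.mul_prod_erase _ _ hmem, ← mul_assoc, ← mul_assoc]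
  congr 1
  · have := basisFactor_succ (z k) (s k)
    simpa using this
  · refine Finset.prod_congr rfl fun i hi => ?_
    have hik : i ≠ k := (Finset.mem_erase.1 hi).1
    simp [hik]

theorem add_single_mem_comp {d ℓ k : ℕ} (hk : k ≤ d) {s : ℕ → ℕ} (hs : s ∈ Comp d ℓ) :
    s + Pi.single k 1 ∈ Comp d (ℓ + 1) := by
  rw [Finset.mem_piAntidiag] at hs ⊢
  refine ⟨?_, fun i hi => ?_⟩
  · simp only [Pi.add_apply, Finset.sum_add_distrib, hs.1, Finset.sum_pi_single']
    rw [if_pos (Finset.mem_range.2 (by omega))]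
  · by_cases h : i = k
    · subst h; exact Finset.mem_range.2 (by omega)
    · exact hs.2 i (by simpa [h] using hi)

theorem sub_single_add_single {k : ℕ} {s : ℕ → ℕ} (h : s k ≠ 0) :
    s - Pi.single k 1 + Pi.single k 1 = s := by
  funext i
  by_cases hi : i = k
  · subst hi; simp; omega
  · simp [hi]

theorem sub_single_mem_comp {d ℓ k : ℕ} {s : ℕ → ℕ} (hs : s ∈ Comp d (ℓ + 1)) (h : s k ≠ 0) :
    s - Pi.single k 1 ∈ Comp d ℓ := by
  rw [Finset.mem_piAntidiag] at hs ⊢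
  have hk := hs.2 k h
  have h1 := hs.1
  constructor
  · rw [← sub_single_add_single h] at h1
    simp only [Pi.add_apply, Finset.sum_add_distrib, Finset.sum_pi_single', if_pos hk] at h1
    exact Nat.succ_injective h1
  · intro i hi
    refine hs.2 i fun h0 => hi ?_
    simp [h0]

/-- Absorption in coordinate `k`, summed over compositions: terms with `s k = 0` drop out and the
others are reindexed by removing one unit from part `k`. A weight `s k` thus trades degree `ℓ + 1`
at `z` for degree `ℓ` at `z - e_k`. -/
theorem sum_coord_mul_basis {d ℓ k : ℕ} (hk : k ≤ d) (z : ℕ → ℝ) (G : (ℕ → ℕ) → ℝ) :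
    ∑ s ∈ Comp d (ℓ + 1), (s k : ℝ) * (basis d s z * G s) =
      z k * ∑ s ∈ Comp d ℓ, basis d s (z - Pi.single k 1) * G (s + Pi.single k 1) := by
  rw [← Finset.sum_filter_of_ne (p := fun s : ℕ → ℕ => s k ≠ 0)
    (fun s _ hs h0 => hs (by simp [h0])), Finset.mul_sum]
  symm
  refine Finset.sum_nbij' (fun s => s + Pi.single k 1) (fun s => s - Pi.single k 1) ?_ ?_ ?_ ?_ ?_
  · intro s hs
    exact Finset.mem_filter.2 ⟨add_single_mem_comp hk hs, by simp⟩
  · intro s hs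
    have := Finset.mem_filter.1 hs
    exact sub_single_mem_comp this.1 this.2
  · intro s _
    simp
  · intro s hs
    exact sub_single_add_single (Finset.mem_filter.1 hs).2
  · intro s _
    rw [← mul_assoc, ← succ_mul_basis hk, mul_assoc]
    simp

theorem sum_sub_single {d k : ℕ} (hk : k ≤ d) {z : ℕ → ℝ} {x : ℝ}
    (hz : ∑ i ∈ Finset.range (d + 1), z i = x + 1) :
    ∑ i ∈ Finset.range (d + 1), (z - Pi.single k 1 : ℕ → ℝ) i = x := by
  have hmem : k ∈ Finset.range (d + 1) := Finset.mem_range.2 (by omega)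
  simp only [Pi.sub_apply, Finset.sum_sub_distrib, hz, Finset.sum_pi_single', if_pos hmem]
  ring

/-- Vandermonde's identity. Multiplication by `ℓ + 1 = ∑ s k` and absorption in each part reduce it
to degree `ℓ`, since lowering one `z k` by `1` lowers the coordinate sum by `1`. -/
theorem sum_basis {d ℓ : ℕ} {z : ℕ → ℝ} (hz : ∑ i ∈ Finset.range (d + 1), z i = ℓ) :
    ∑ s ∈ Comp d ℓ, basis d s z = 1 := by
  induction ℓ generalizing z with
  | zero => simp [Comp, basis]
  | succ ℓ ih =>
    have h1 : ((ℓ : ℝ) + 1) * ∑ s ∈ Comp d (ℓ + 1), basis d s z = ℓ + 1 := by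
      calc ((ℓ : ℝ) + 1) * ∑ s ∈ Comp d (ℓ + 1), basis d s z
          = ∑ s ∈ Comp d (ℓ + 1), ∑ k ∈ Finset.range (d + 1), (s k : ℝ) * (basis d s z * 1) := by
            rw [Finset.mul_sum]
            refine Finset.sum_congr rfl fun s hs => ?_
            rw [← Finset.sum_mul]
            congr 1
            · exact_mod_cast (Finset.mem_piAntidiag.1 hs).1.symm
            · ring
        _ = ∑ k ∈ Finset.range (d + 1), z k := by
            rw [Finset.sum_comm]
            refine Finset.sum_congr rfl fun k hk => ?_
            have hk' : k ≤ d := Nat.lt_succ_iff.1 (Finset.mem_range.1 hk)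
            rw [sum_coord_mul_basis hk' z fun _ => 1]
            simp only [mul_one]
            rw [ih (sum_sub_single hk' (by rw [hz]; push_cast; ring)), mul_one]
        _ = ℓ + 1 := by rw [hz]; push_cast; ring
    have : (ℓ : ℝ) + 1 ≠ 0 := by positivity
    exact mul_left_cancel₀ this (by rw [h1, mul_one])

/-- The product of the factors `x_k + c` over the entries `(k, c)` of a list. -/
noncomputable def listProd (T : List (ℕ × ℝ)) (x : ℕ → ℝ) : ℝ := (T.map fun p => x p.1 + p.2).prod

/-- Interpolation on the principal lattice reproduces products of at most `ℓ` affine factors. -/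
theorem sum_basis_mul_listProd {d : ℕ} (T : List (ℕ × ℝ)) {ℓ : ℕ} {z : ℕ → ℝ}
    (hT : ∀ p ∈ T, p.1 ≤ d) (hℓ : T.length ≤ ℓ) (hz : ∑ i ∈ Finset.range (d + 1), z i = ℓ) :
    ∑ s ∈ Comp d ℓ, basis d s z * listProd T (fun k => s k) = listProd T z := by
  induction hm : T.length generalizing T ℓ z with
  | zero =>
    rw [List.length_eq_zero_iff.1 hm]
    simpa [listProd] using sum_basis hz
  | succ m ih =>
    match T, hm, hT, hℓ with
    | [], hm, _, _ => simp at hm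
    | (k, c) :: T, hm, hT, hℓ =>
    obtain ⟨ℓ, rfl⟩ : ∃ ℓ', ℓ = ℓ' + 1 := ⟨ℓ - 1, by simp at hℓ; omega⟩
    have hm' : T.length = m := by simpa using hm
    have hk : k ≤ d := hT (k, c) (by simp)
    have hT' : ∀ p ∈ T, p.1 ≤ d := fun p hp => hT p (by simp [hp])
    -- Peel off the factor `x_k + c`. Its part `x_k` is absorbed and shifts the argument by `e_k`;
    -- the remaining factors are again affine, with constants raised by `1` at the entries with
    -- index `k`. Both inductive hypotheses concern shorter products.
    set T' := T.map fun p => (p.1, p.2 + Pi.single (M := fun _ => ℝ) k 1 p.1) with hT'def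
    have hshift : ∀ x : ℕ → ℝ, listProd T (x + Pi.single k 1) = listProd T' x := by
      intro x
      simp only [listProd, hT'def, List.map_map]
      congr 1
      refine List.map_congr_left fun p _ => ?_
      simp only [Pi.add_apply, Function.comp_apply]
      ring
    have h1 := ih T' (ℓ := ℓ) (z := z - Pi.single k 1)
      (by
        intro p hp
        obtain ⟨q, hq, rfl⟩ := List.mem_map.1 hp
        exact hT' q hq)
      (by simp [hT'def] at hℓ ⊢; omega) (sum_sub_single hk (by rw [hz]; push_cast; ring))
      (by simp [hT'def, hm'])
    have h2 := ih T hT' (ℓ := ℓ + 1) (by simp at hℓ; omega) hz hm'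
    have h3 := sum_coord_mul_basis hk z (ℓ := ℓ) (fun s => listProd T (fun k => s k))
    have h4 : ∀ s : ℕ → ℕ, listProd T (fun i => ((s + Pi.single k 1 : ℕ → ℕ) i : ℝ)) =
        listProd T' (fun i => s i) := by
      intro s
      rw [← hshift]
      congr 1
      funext i
      by_cases hi : i = k
      · subst hi; simp
      · simp [hi]
    simp only [h4] at h3
    rw [h1, ← hshift, sub_add_cancel] at h3
    calc ∑ s ∈ Comp d (ℓ + 1), basis d s z * listProd ((k, c) :: T) (fun k => s k)
        = ∑ s ∈ Comp d (ℓ + 1), ((s k : ℝ) * (basis d s z * listProd T (fun k => s k)) +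
            c * (basis d s z * listProd T (fun k => s k))) := by
          refine Finset.sum_congr rfl fun s _ => ?_
          simp only [listProd, List.map_cons, List.prod_cons]
          ring
      _ = z k * listProd T z + c * listProd T z := by
          rw [Finset.sum_add_distrib, h3, ← Finset.mul_sum, h2]
      _ = listProd ((k, c) :: T) z := by
          simp only [listProd, List.map_cons, List.prod_cons]
          ring

theorem le_of_mem_comp {d ℓ : ℕ} {s : ℕ → ℕ} (hs : s ∈ Comp d ℓ) (k : ℕ) : s k ≤ ℓ := by
  obtain ⟨h1, h2⟩ := Finset.mem_piAntidiag.1 hs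
  by_cases h : s k = 0
  · omega
  · rw [← h1]
    exact Finset.single_le_sum (f := s) (fun _ _ => Nat.zero_le _) (h2 k h)

/-- At the lattice points, the Lagrange polynomials are `0` or `1`. -/
theorem basis_lattice {d ℓ : ℕ} {s s' : ℕ → ℕ} (hs : s ∈ Comp d ℓ) (hs' : s' ∈ Comp d ℓ)
    {z : ℕ → ℝ} (hz : ∀ k ≤ d, z k = s' k) [Decidable (s = s')] :
    basis d s z = if s = s' then 1 else 0 := by
  split_ifs with h
  · subst h
    unfold basis
    refine Finset.prod_eq_one fun k hk => Finset.prod_eq_one fun t ht => ?_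
    rw [hz k (Nat.lt_succ_iff.1 (Finset.mem_range.1 hk))]
    have : (t : ℝ) < s k := by exact_mod_cast Finset.mem_range.1 ht
    exact div_self (by linarith)
  · obtain ⟨h1, h2⟩ := Finset.mem_piAntidiag.1 hs
    obtain ⟨h1', h2'⟩ := Finset.mem_piAntidiag.1 hs'
    -- Two different compositions of the same number cannot be ordered in every part. Where `s' k <
    -- s k`, the numerator with `t = s' k` vanishes.
    have hex : ∃ k ∈ Finset.range (d + 1), s' k < s k := by
      by_contra hcon
      push Not at hcon
      refine h (funext fun k => ?_)
      by_cases hk : k ∈ Finset.range (d + 1)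
      · exact (Finset.sum_eq_sum_iff_of_le hcon).1 (h1.trans h1'.symm) k hk
      · rw [not_imp_comm.1 (h2 k) hk, not_imp_comm.1 (h2' k) hk]
    obtain ⟨k, hk, hlt⟩ := hex
    unfold basis
    refine Finset.prod_eq_zero hk (Finset.prod_eq_zero (Finset.mem_range.2 hlt) ?_)
    rw [hz k (Nat.lt_succ_iff.1 (Finset.mem_range.1 hk)), sub_self, zero_div]

/-- There are `∑ s k = ℓ` factors, each with an integer denominator of at least `1` and a numerator
of size at most `d * ℓ`. -/
theorem abs_basis_le {d ℓ : ℕ} (hd : 1 ≤ d) {s : ℕ → ℕ} (hs : s ∈ Comp d ℓ) {z : ℕ → ℝ}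
    (hz : ∑ i ∈ Finset.range (d + 1), z i = ℓ) (h0 : ∀ k < d, 0 ≤ z (k + 1))
    (h1 : ∀ k < d, z (k + 1) ≤ ℓ) : |basis d s z| ≤ ((d : ℝ) * ℓ) ^ ℓ := by
  have hd' : (1 : ℝ) ≤ d := by exact_mod_cast hd
  have hl : (0 : ℝ) ≤ ℓ := by positivity
  have hdl : (ℓ : ℝ) ≤ d * ℓ := by nlinarith
  have hfac : ∀ k ∈ Finset.range (d + 1), ∀ t ∈ Finset.range (s k),
      |(z k - t) / ((s k : ℝ) - t)| ≤ d * ℓ := by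
    intro k hk t ht
    have ht1 : (t : ℝ) + 1 ≤ s k := by exact_mod_cast Finset.mem_range.1 ht
    have ht0 : (0 : ℝ) ≤ t := by positivity
    have htl : (s k : ℝ) ≤ ℓ := by exact_mod_cast le_of_mem_comp hs k
    rw [abs_div, div_le_iff₀ (abs_pos.2 (by linarith)), abs_of_pos (by linarith : 0 < (s k : ℝ) - t)]
    -- The factor `d` is due to coordinate `0`: the point ranges over a cube and not just the
    -- simplex, so this coordinate can be as low as `ℓ - d * ℓ`.
    have hz' : |z k - t| ≤ d * ℓ := by
      cases k with
      | zero =>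
        rw [Finset.sum_range_succ'] at hz
        have e1 : 0 ≤ ∑ i ∈ Finset.range d, z (i + 1) :=
          Finset.sum_nonneg fun i hi => h0 i (Finset.mem_range.1 hi)
        have e2 : ∑ i ∈ Finset.range d, z (i + 1) ≤ d * ℓ := by
          have := Finset.sum_le_card_nsmul (Finset.range d) (fun i => z (i + 1)) ℓ
            fun i hi => h1 i (Finset.mem_range.1 hi)
          simpa using this
        rw [abs_le]
        constructor <;> linarith
      | succ k =>
        have hk' : k < d := by have := Finset.mem_range.1 hk; omega
        have := h0 k hk'
        have := h1 k hk'
        rw [abs_le]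
        constructor <;> linarith
    nlinarith [abs_nonneg (z k - t)]
  unfold basis
  rw [Finset.abs_prod]
  calc ∏ k ∈ Finset.range (d + 1), |∏ t ∈ Finset.range (s k), (z k - t) / ((s k : ℝ) - t)|
      ≤ ∏ k ∈ Finset.range (d + 1), ((d : ℝ) * ℓ) ^ s k := by
        refine Finset.prod_le_prod (fun _ _ => abs_nonneg _) fun k hk => ?_
        rw [Finset.abs_prod]
        refine (Finset.prod_le_prod (fun _ _ => abs_nonneg _) (hfac k hk)).trans ?_
        simp
    _ = ((d : ℝ) * ℓ) ^ ℓ := by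
        rw [Finset.prod_pow_eq_pow_sum, (Finset.mem_piAntidiag.1 hs).1]

/-- The right side is `(d + 1) ⋯ (d + ℓ)`. This exchanges the power of `d` in the Lebesgue constant
for a binomial coefficient. -/
theorem pow_le_factorial_mul_choose (d ℓ : ℕ) : d ^ ℓ ≤ ℓ.factorial * (ℓ + d).choose d := by
  induction ℓ with
  | zero => simp
  | succ ℓ ih =>
    have h := Nat.add_one_mul_choose_eq (ℓ + d) ℓ
    have e : (ℓ + d).choose ℓ = (ℓ + d).choose d := Nat.choose_symm_add
    have e' : (ℓ + 1 + d).choose (ℓ + 1) = (ℓ + 1 + d).choose d := Nat.choose_symm_add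
    rw [e, show ℓ + d + 1 = ℓ + 1 + d by ring, e'] at h
    calc d ^ (ℓ + 1) = d ^ ℓ * d := pow_succ _ _
      _ ≤ (ℓ.factorial * (ℓ + d).choose d) * (ℓ + 1 + d) := by
        gcongr
        omega
      _ = (ℓ + 1).factorial * (ℓ + 1 + d).choose d := by
        rw [Nat.factorial_succ]
        calc _ = ℓ.factorial * ((ℓ + 1 + d) * (ℓ + d).choose d) := by ring
          _ = _ := by rw [h]; ring

/-! ## The interpolant is piecewise polynomial -/

section
variable {n d : ℕ}

/-- The `k`-th coordinate as a polynomial. -/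
noncomputable def coordPoly (d k : ℕ) : MvPolynomial (Fin d) ℝ :=
  if h : k < d then MvPolynomial.X ⟨k, h⟩ else 0

/-- The barycentric coordinates as polynomials. -/
noncomputable def baryPoly (d ℓ K : ℕ) (j : ℕ → ℕ) : ℕ → MvPolynomial (Fin d) ℝ
  | 0 => MvPolynomial.C (ℓ : ℝ) - ∑ k ∈ Finset.range d, MvPolynomial.C (ℓ : ℝ) *
      (MvPolynomial.C (K : ℝ) * coordPoly d k - MvPolynomial.C (j k : ℝ))
  | k + 1 => MvPolynomial.C (ℓ : ℝ) *
      (MvPolynomial.C (K : ℝ) * coordPoly d k - MvPolynomial.C (j k : ℝ))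

theorem eval_baryPoly (ℓ K : ℕ) (j : ℕ → ℕ) (y : E d) (k : ℕ) :
    MvPolynomial.eval (fun i => y i) (baryPoly d ℓ K j k) = bary d ℓ K j (coords y) k := by
  have h : ∀ k, MvPolynomial.eval (fun i => y i) (coordPoly d k) = coords y k := by
    intro k
    unfold coordPoly coords
    split_ifs <;> simp
  cases k with
  | zero => simp [baryPoly, bary, h, map_sum]
  | succ k => simp [baryPoly, bary, h]

theorem totalDegree_baryPoly (ℓ K : ℕ) (j : ℕ → ℕ) (k : ℕ) :
    (baryPoly d ℓ K j k).totalDegree ≤ 1 := by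
  have hc : ∀ k, (coordPoly d k).totalDegree ≤ 1 := by
    intro k
    unfold coordPoly
    split_ifs <;> simp
  have hl : ∀ k, (MvPolynomial.C (ℓ : ℝ) *
      (MvPolynomial.C (K : ℝ) * coordPoly d k - MvPolynomial.C (j k : ℝ))).totalDegree ≤ 1 := by
    intro k
    refine (MvPolynomial.totalDegree_mul _ _).trans ?_
    rw [MvPolynomial.totalDegree_C, zero_add]
    refine (MvPolynomial.totalDegree_sub _ _).trans (max_le ?_
      ((MvPolynomial.totalDegree_C _).le.trans zero_le_one))
    refine (MvPolynomial.totalDegree_mul _ _).trans ?_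
    rw [MvPolynomial.totalDegree_C, zero_add]
    exact hc k
  cases k with
  | zero =>
    refine (MvPolynomial.totalDegree_sub _ _).trans (max_le
      ((MvPolynomial.totalDegree_C _).le.trans zero_le_one) ?_)
    exact MvPolynomial.totalDegree_finsetSum_le fun k _ => hl k
  | succ k => exact hl k

/-- The polynomial that interpolates on the sub-cube `j`. -/
noncomputable def interpPoly (n ℓ K : ℕ) (L : ℝ) (g : E d → ℝ) (j : Fin d → Fin K) :
    MvPolynomial (Fin d) ℝ :=
  ∑ s ∈ Comp d ℓ, MvPolynomial.C (quantize n L (g (meshPoint ℓ K j fun k => s (k + 1)))) *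
    ∏ k ∈ Finset.range (d + 1), ∏ t ∈ Finset.range (s k),
      (baryPoly d ℓ K (fun k => if h : k < d then j ⟨k, h⟩ else 0) k - MvPolynomial.C (t : ℝ)) *
        MvPolynomial.C ((s k : ℝ) - t)⁻¹

theorem eval_interpPoly (ℓ K : ℕ) (L : ℝ) (g : E d → ℝ) (j : Fin d → Fin K) (y : E d) :
    MvPolynomial.eval (fun i => y i) (interpPoly n ℓ K L g j) = interpolate n ℓ K L g j y := by
  simp only [interpPoly, interpolate, map_sum, map_mul, map_prod, map_sub, MvPolynomial.eval_C,
    eval_baryPoly, basis, div_eq_mul_inv]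

/-- Each term is a constant times `∑ s k = ℓ` factors that are affine in `y`. -/
theorem totalDegree_interpPoly (ℓ K : ℕ) (L : ℝ) (g : E d → ℝ) (j : Fin d → Fin K) :
    (interpPoly n ℓ K L g j).totalDegree ≤ ℓ := by
  refine MvPolynomial.totalDegree_finsetSum_le fun s hs => ?_
  refine (MvPolynomial.totalDegree_mul _ _).trans ?_
  rw [MvPolynomial.totalDegree_C, zero_add]
  refine (MvPolynomial.totalDegree_finsetProd _ _).trans ?_
  rw [← (Finset.mem_piAntidiag.1 hs).1]
  refine Finset.sum_le_sum fun k _ => ?_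
  refine (MvPolynomial.totalDegree_finsetProd _ _).trans ?_
  calc _ ≤ ∑ t ∈ Finset.range (s k), 1 := by
        refine Finset.sum_le_sum fun t _ => ?_
        refine (MvPolynomial.totalDegree_mul _ _).trans ?_
        rw [MvPolynomial.totalDegree_C, add_zero]
        exact (MvPolynomial.totalDegree_sub _ _).trans
          (max_le (totalDegree_baryPoly _ _ _ _)
            ((MvPolynomial.totalDegree_C _).le.trans zero_le_one))
    _ = s k := by simp

/-- The composition that extends a multi-index. -/
def extend (ℓ : ℕ) (s : Fin d → ℕ) : ℕ → ℕ
  | 0 => ℓ - ∑ i, s i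
  | k + 1 => if h : k < d then s ⟨k, h⟩ else 0

theorem extend_mem_comp {ℓ : ℕ} {s : Fin d → ℕ} (hs : ∑ i, s i ≤ ℓ) :
    extend ℓ s ∈ Comp d ℓ := by
  rw [Finset.mem_piAntidiag]
  constructor
  · rw [Finset.sum_range_succ', Finset.sum_range]
    simp only [extend, Fin.is_lt, dite_true, Fin.eta]
    omega
  · intro k hk
    cases k with
    | zero => simp
    | succ k =>
      by_cases h : k < d
      · simpa using h
      · simp [extend, h] at hk

theorem bary_meshPoint {ℓ K : ℕ} (hK : 0 < K) (j : Fin d → Fin K) {s : Fin d → ℕ}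
    (hs : ∑ i, s i ≤ ℓ) : ∀ k ≤ d,
      bary d ℓ K (fun k => if h : k < d then j ⟨k, h⟩ else 0) (coords (meshPoint ℓ K j s)) k =
        extend ℓ s k := by
  have hK' : (K : ℝ) ≠ 0 := by exact_mod_cast hK.ne'
  have h : ∀ k : Fin d, (ℓ : ℝ) * (K * coords (meshPoint ℓ K j s) k -
      ((if h : (k : ℕ) < d then (j ⟨k, h⟩ : ℕ) else 0 : ℕ) : ℝ)) = s k := by
    intro k
    rw [coords_val]
    simp only [Fin.is_lt, dite_true, Fin.eta, meshPoint]
    rw [mul_div_cancel₀ _ hK', add_sub_cancel_left]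
    -- For `ℓ = 0` the quotient `s k / ℓ` is a division by zero, but then `s k = 0` as well.
    rcases Nat.eq_zero_or_pos ℓ with hl | hl
    · have : s k ≤ ∑ i, s i := Finset.single_le_sum (fun _ _ => Nat.zero_le _) (Finset.mem_univ k)
      have : s k = 0 := by omega
      simp [this]
    · have : (ℓ : ℝ) ≠ 0 := by exact_mod_cast hl.ne'
      field_simp
  intro k hk
  cases k with
  | zero =>
    simp only [bary, extend]
    rw [Finset.sum_range, Finset.sum_congr rfl fun k _ => h k, Nat.cast_sub hs]
    push_cast
    rfl
  | succ k =>
    have := h ⟨k, hk⟩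
    simp only [bary, extend]
    rw [dif_pos (show k < d from hk)] at this ⊢
    rw [dif_pos (show k < d from hk)]
    exact this

theorem interpolate_meshPoint {ℓ K : ℕ} (hK : 0 < K) (L : ℝ) (g : E d → ℝ) (j : Fin d → Fin K)
    {s : Fin d → ℕ} (hs : ∑ i, s i ≤ ℓ) :
    interpolate n ℓ K L g j (meshPoint ℓ K j s) = quantize n L (g (meshPoint ℓ K j s)) := by
  classical
  unfold interpolate
  have hmem := extend_mem_comp hs
  rw [Finset.sum_eq_single_of_mem _ hmem]
  · rw [basis_lattice hmem hmem (bary_meshPoint hK j hs), if_pos rfl, mul_one]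
    congr 3
    funext k
    simp [extend]
  · intro t ht hne
    rw [basis_lattice ht hmem (bary_meshPoint hK j hs), if_neg hne, mul_zero]

theorem isInterpolant_compressed {β L : ℝ} (hd : 1 ≤ d) (hn : 2 ≤ n) (hβ : 0 < β) (hL : 0 < L)
    (g : E d → ℝ) : IsInterpolant (strictFloor β) (gridSize n d β) L (L / n) g
      (compressed preProg qryProg n d β L g) := by
  have hK := gridSize_pos (d := d) hn hβ
  refine ⟨fun j => interpPoly n (strictFloor β) (gridSize n d β) L g j,
    fun j => totalDegree_interpPoly _ _ _ _ _, fun j s hs => ?_, fun y hy => ?_⟩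
  · rw [eval_interpPoly, interpolate_meshPoint hK _ _ _ hs]
    exact abs_quantize_sub_clip_le hL.le (by omega) _
  · refine ⟨cellFun hK y, mem_subCube_cellFun hK hy, ?_⟩
    rw [eval_interpPoly, compressed_eq hd hn hβ hL g hy]

end

/-! ## Taylor expansion of Hölder functions -/

section
variable {d : ℕ}

theorem iteratedFDeriv_diag_eq_sum (m : ℕ) (f : E d → ℝ) (x v : E d) :
    iteratedFDeriv ℝ m f x (fun _ => v) =
      ∑ i : Fin m → Fin d, (∏ r, v (i r)) * partialDeriv f i x := by
  have hv : v = ∑ k : Fin d, v k • EuclideanSpace.single k (1 : ℝ) := by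
    ext k
    simp [Pi.single_apply]
  conv_lhs => rw [hv]
  have h1 := (iteratedFDeriv ℝ m f x).toMultilinearMap.map_sum
    (fun (_ : Fin m) (k : Fin d) => v k • EuclideanSpace.single k (1 : ℝ))
  refine h1.trans (Finset.sum_congr rfl fun i _ => ?_)
  exact (iteratedFDeriv ℝ m f x).toMultilinearMap.map_smul_univ (fun r => v (i r))
    (fun r => EuclideanSpace.single (i r) (1 : ℝ))

theorem norm_le_sum_abs (v : E d) : ‖v‖ ≤ ∑ k, |v k| := by
  have hv : v = ∑ k : Fin d, v k • EuclideanSpace.single k (1 : ℝ) := by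
    ext k
    simp [Pi.single_apply]
  conv_lhs => rw [hv]
  refine (norm_sum_le _ _).trans (Finset.sum_le_sum fun k _ => ?_)
  simp [norm_smul]

theorem iteratedDeriv_line {ℓ : ℕ} {f : E d → ℝ} (hf : ContDiff ℝ ℓ f) (y v : E d) {m : ℕ}
    (hm : m ≤ ℓ) : iteratedDeriv m (fun τ : ℝ => f (y + τ • v)) =
      fun τ => iteratedFDeriv ℝ m f (y + τ • v) fun _ => v := by
  induction m with
  | zero => funext τ; simp
  | succ m ih =>
    rw [iteratedDeriv_succ, ih (by omega)]
    funext τ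
    have hdiff : DifferentiableAt ℝ (iteratedFDeriv ℝ m f) (y + τ • v) :=
      (hf.differentiable_iteratedFDeriv (by exact_mod_cast hm)).differentiableAt
    have hline : HasDerivAt (fun τ : ℝ => y + τ • v) v τ := by
      simpa using ((hasDerivAt_id τ).smul_const v).const_add y
    have h1 := (hdiff.hasFDerivAt.comp_hasDerivAt τ hline)
    have h2 := (ContinuousMultilinearMap.apply ℝ (fun _ : Fin m => E d) ℝ
      (fun _ => v)).hasFDerivAt.comp_hasDerivAt τ h1
    have h3 := h2.deriv
    rw [iteratedFDeriv_succ_apply_left]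
    exact h3

/-- The Taylor polynomial of order `ℓ` of `f` at `y`. -/
noncomputable def taylorSum (ℓ : ℕ) (f : E d → ℝ) (y v : E d) : ℝ :=
  ∑ m ∈ Finset.range (ℓ + 1), ((m.factorial : ℝ))⁻¹ * iteratedFDeriv ℝ m f y fun _ => v

/-- Taylor's formula on the segment, with Lagrange remainder one order lower: its remainder is the
term of order `ℓ` at an intermediate point, and the term of order `ℓ` at `y` is subtracted from it.
For `ℓ = 0` take `τ = 1`. -/
theorem abs_sub_taylorSum_le {ℓ : ℕ} {f : E d → ℝ} (hf : ContDiff ℝ ℓ f) (y v : E d) {M : ℝ}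
    (hM : ∀ τ ∈ Set.Icc (0 : ℝ) 1, |iteratedFDeriv ℝ ℓ f (y + τ • v) (fun _ => v) -
      iteratedFDeriv ℝ ℓ f y fun _ => v| ≤ M) :
    |f (y + v) - taylorSum ℓ f y v| ≤ M / ℓ.factorial := by
  cases ℓ with
  | zero => simpa [taylorSum] using hM 1 (by simp)
  | succ ℓ =>
    set φ : ℝ → ℝ := fun τ => f (y + τ • v) with hφ
    have hφc : ContDiff ℝ (ℓ + 1 : ℕ) φ := hf.comp (by fun_prop)
    obtain ⟨ξ, hξ, h⟩ := taylor_mean_remainder_lagrange_iteratedDeriv (f := φ) (n := ℓ)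
      (x₀ := 0) (x := 1) zero_ne_one (by exact_mod_cast hφc.contDiffOn)
    have hξ' : ξ ∈ Set.Icc (0 : ℝ) 1 := by
      rw [Set.uIoo_of_le zero_le_one] at hξ
      exact Set.Ioo_subset_Icc_self hξ
    have hT : taylorWithinEval φ ℓ (Set.uIcc 0 1) 0 1 = taylorSum ℓ f y v := by
      rw [taylor_within_apply]
      unfold taylorSum
      refine Finset.sum_congr rfl fun m hm => ?_
      have hm' : m ≤ ℓ + 1 := (Finset.mem_range.1 hm).le
      rw [iteratedDerivWithin_eq_iteratedDeriv (uniqueDiffOn_uIcc zero_ne_one)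
        ((hφc.of_le (by exact_mod_cast hm')).contDiffAt) (by simp), hφ,
        iteratedDeriv_line hf y v hm']
      simp
    rw [hT, iteratedDeriv_line hf y v le_rfl] at h
    have h1 : φ 1 = f (y + v) := by simp [hφ]
    have h2 : f (y + v) - taylorSum (ℓ + 1) f y v =
        (iteratedFDeriv ℝ (ℓ + 1) f (y + ξ • v) (fun _ => v) -
          iteratedFDeriv ℝ (ℓ + 1) f y fun _ => v) / (ℓ + 1).factorial := by
      have h3 : taylorSum (ℓ + 1) f y v = taylorSum ℓ f y v +
        (((ℓ + 1).factorial : ℝ))⁻¹ * iteratedFDeriv ℝ (ℓ + 1) f y fun _ => v := by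
        unfold taylorSum
        rw [Finset.sum_range_succ _ (ℓ + 1)]
      rw [h3, ← h1]
      rw [h1] at h ⊢
      rw [← sub_sub, h, sub_div]
      simp
      ring
    rw [h2, abs_div, Nat.abs_cast]
    gcongr
    exact hM ξ hξ'

variable {β L : ℝ} {f : E d → ℝ}

theorem strictFloor_lt (hβ : 0 < β) : (strictFloor β : ℝ) < β := by
  unfold strictFloor
  have h := Nat.ceil_lt_add_one hβ.le
  have h1 : 1 ≤ ⌈β⌉₊ := Nat.one_le_ceil_iff.2 hβ
  rw [Nat.cast_sub h1]
  push_cast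
  linarith

theorem le_strictFloor_add_one (β : ℝ) : β ≤ strictFloor β + 1 := by
  unfold strictFloor
  refine (Nat.le_ceil β).trans ?_
  have : ⌈β⌉₊ ≤ ⌈β⌉₊ - 1 + 1 := by omega
  exact_mod_cast this

/-- Expansion by multilinearity leaves one Hölder bound per sequence of indices; the weights of all
sequences add up to the power of the `ℓ¹` norm. -/
theorem IsHolderDensity.abs_iteratedFDeriv_sub_le (hf : IsHolderDensity d β L f) (x y v : E d) :
    |iteratedFDeriv ℝ (strictFloor β) f x (fun _ => v) -
      iteratedFDeriv ℝ (strictFloor β) f y fun _ => v| ≤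
      (∑ k, |v k|) ^ strictFloor β * (L * ‖x - y‖ ^ (β - strictFloor β)) := by
  rw [iteratedFDeriv_diag_eq_sum, iteratedFDeriv_diag_eq_sum, ← Finset.sum_sub_distrib,
    Fintype.sum_pow, Finset.sum_mul]
  refine (Finset.abs_sum_le_sum_abs _ _).trans (Finset.sum_le_sum fun i _ => ?_)
  rw [← mul_sub, abs_mul, Finset.abs_prod]
  gcongr
  exact hf.holder i x y

theorem IsHolderDensity.abs_sub_taylorSum_le (hf : IsHolderDensity d β L f) (hβ : 0 < β)
    (hL : 0 ≤ L) (y v : E d) {r : ℝ} (hr : ∑ k, |v k| ≤ r) :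
    |f (y + v) - taylorSum (strictFloor β) f y v| ≤ L * r ^ β / (strictFloor β).factorial := by
  refine DensityInterp.abs_sub_taylorSum_le hf.smooth y v fun τ hτ => ?_
  refine (hf.abs_iteratedFDeriv_sub_le _ _ _).trans ?_
  have h0 : 0 ≤ ∑ k, |v k| := Finset.sum_nonneg fun _ _ => abs_nonneg _
  have hr0 : 0 ≤ r := h0.trans hr
  have hn : ‖y + τ • v - y‖ ≤ r := by
    rw [add_sub_cancel_left, norm_smul, Real.norm_of_nonneg hτ.1]
    calc τ * ‖v‖ ≤ 1 * ‖v‖ := by gcongr; exact hτ.2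
      _ ≤ r := by rw [one_mul]; exact (norm_le_sum_abs v).trans hr
  have hpos : 0 < β - strictFloor β := sub_pos.2 (strictFloor_lt hβ)
  calc (∑ k, |v k|) ^ strictFloor β * (L * ‖y + τ • v - y‖ ^ (β - strictFloor β))
      ≤ r ^ strictFloor β * (L * r ^ (β - strictFloor β)) := by gcongr
    _ = L * (r ^ (strictFloor β : ℝ) * r ^ (β - strictFloor β)) := by
        rw [Real.rpow_natCast]; ring
    _ = L * r ^ β := by
        rw [← Real.rpow_add_of_nonneg hr0 (by positivity) hpos.le]
        congr 2
        ring

theorem isClosed_cube (d : ℕ) : IsClosed (cube d) := by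
  have : cube d = ⋂ i : Fin d, {y : E d | 0 ≤ y i} ∩ {y | y i ≤ 1} := by
    ext y
    simp [cube]
  rw [this]
  refine isClosed_iInter fun i => IsClosed.inter ?_ ?_
  · exact isClosed_le continuous_const (by fun_prop)
  · exact isClosed_le (by fun_prop) continuous_const

theorem IsHolderDensity.taylorSum_eq_zero (hf : IsHolderDensity d β L f) {y : E d}
    (hy : y ∉ cube d) (ℓ : ℕ) (v : E d) : taylorSum ℓ f y v = 0 := by
  have h : f =ᶠ[nhds y] fun _ => 0 := by
    filter_upwards [(isClosed_cube d).isOpen_compl.mem_nhds hy] with x hx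
    exact hf.supported x hx
  unfold taylorSum
  refine Finset.sum_eq_zero fun m _ => ?_
  have h1 : iteratedFDeriv ℝ m f y = iteratedFDeriv ℝ m (fun _ => (0 : ℝ)) y :=
    h.iteratedFDeriv ℝ m |>.eq_of_nhds
  rw [h1]
  simp

/-- A unit step along the first axis leads out of the cube, to a point near which `f` vanishes. The
Taylor polynomial there is zero, so the remainder bound with `r = 1` applies to `f x` itself. -/
theorem IsHolderDensity.le_bound (hf : IsHolderDensity d β L f) (hβ : 0 < β) (hL : 0 ≤ L)
    (hd : 1 ≤ d) (x : E d) : f x ≤ L := by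
  by_cases hx : x ∈ cube d
  swap
  · rw [hf.supported x hx]; exact hL
  have key : ∀ v : E d, x - v ∉ cube d → ∑ k, |v k| ≤ 1 → f x ≤ L := by
    intro v hv h1
    have h := hf.abs_sub_taylorSum_le hβ hL (x - v) v h1
    rw [hf.taylorSum_eq_zero hv, sub_add_cancel, sub_zero, Real.one_rpow, mul_one] at h
    refine (le_abs_self _).trans (h.trans (div_le_self hL ?_))
    exact_mod_cast (strictFloor β).factorial_pos
  have hsum : ∀ c : ℝ, |c| ≤ 1 →
      ∑ k, |(EuclideanSpace.single (⟨0, hd⟩ : Fin d) c : E d) k| ≤ 1 := by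
    intro c hc
    rw [Finset.sum_eq_single_of_mem (⟨0, hd⟩ : Fin d) (Finset.mem_univ _)]
    · simpa using hc
    · intro k _ hk
      simp [hk]
  -- Step upwards if the first coordinate is positive and downwards otherwise; from coordinate `0` a
  -- step upwards would only reach the face at `1`.
  rcases lt_or_ge 0 (x ⟨0, hd⟩) with h | h
  · refine key (EuclideanSpace.single ⟨0, hd⟩ (-1)) (fun hc => ?_) (hsum _ (by simp))
    have := (hc ⟨0, hd⟩).2
    simp at this
    linarith
  · refine key (EuclideanSpace.single ⟨0, hd⟩ 1) (fun hc => ?_) (hsum _ (by simp))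
    have := (hc ⟨0, hd⟩).1
    simp at this
    linarith

/-! ## The interpolation error -/

/-- The coordinates of a mesh point minus `y` are the differences `s (k + 1) - z (k + 1)` divided by
`ℓ K`. A Taylor term of order `m ≥ 1` is hence a combination of products of `m ≤ ℓ` affine forms
that all vanish at `z`, and reproduction gives `0`. Only order `0` survives. -/
theorem sum_basis_mul_taylorSum {ℓ K : ℕ} (hK : 0 < K) (j : Fin d → Fin K) (f : E d → ℝ)
    (y : E d) :
    ∑ s ∈ Comp d ℓ,
      basis d s (bary d ℓ K (fun k => if h : k < d then j ⟨k, h⟩ else 0) (coords y)) *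
        taylorSum ℓ f y ((meshPoint ℓ K j fun k => s (k + 1)) - y) = f y := by
  set z := bary d ℓ K (fun k => if h : k < d then (j ⟨k, h⟩ : ℕ) else 0) (coords y) with hz
  have hsum : ∑ i ∈ Finset.range (d + 1), z i = ℓ := sum_bary _ _ _ _ _
  have hK' : (K : ℝ) ≠ 0 := by exact_mod_cast hK.ne'
  unfold taylorSum
  simp only [Finset.mul_sum]
  rw [Finset.sum_comm, Finset.sum_eq_single_of_mem 0 (by simp)]
  · simp only [iteratedFDeriv_zero_apply, Nat.factorial_zero, Nat.cast_one, inv_one, one_mul]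
    rw [← Finset.sum_mul, sum_basis hsum, one_mul]
  · intro m hm hm0
    have hml : m ≤ ℓ := Nat.lt_succ_iff.1 (Finset.mem_range.1 hm)
    have hl : (ℓ : ℝ) ≠ 0 := by
      have : ℓ ≠ 0 := by omega
      exact_mod_cast this
    have hv : ∀ (s : ℕ → ℕ) (k : Fin d), ((meshPoint ℓ K j fun k => s (k + 1)) - y) k =
        ((ℓ : ℝ) * K)⁻¹ * ((s (k + 1) : ℝ) + -z (k + 1)) := by
      intro s k
      simp only [hz, bary, Fin.is_lt, dite_true, Fin.eta, coords_val, meshPoint, PiLp.sub_apply]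
      field_simp
      ring
    have hterm : ∀ (s : ℕ → ℕ) (i : Fin m → Fin d),
        ∏ r, ((meshPoint ℓ K j fun k => s (k + 1)) - y) (i r) = (((ℓ : ℝ) * K)⁻¹) ^ m *
          listProd (List.ofFn fun r => ((i r : ℕ) + 1, -z (i r + 1))) (fun k => s k) := by
      intro s i
      simp only [hv, Finset.prod_mul_distrib, Finset.prod_const, Finset.card_univ,
        Fintype.card_fin, listProd, List.map_ofFn, List.prod_ofFn, Function.comp_apply]
    have hzero : ∀ i : Fin m → Fin d, ∑ s ∈ Comp d ℓ, basis d s z *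
        listProd (List.ofFn fun r => ((i r : ℕ) + 1, -z (i r + 1))) (fun k => s k) = 0 := by
      intro i
      rw [sum_basis_mul_listProd _ (ℓ := ℓ) _ (by simpa using hml) hsum]
      · simp only [listProd, List.map_ofFn, List.prod_ofFn, Function.comp_apply]
        exact Finset.prod_eq_zero (Finset.mem_univ (⟨0, by omega⟩ : Fin m)) (by simp)
      · intro p hp
        obtain ⟨r, rfl⟩ := (List.mem_ofFn' _ _).1 hp
        exact (i r).2
    simp only [iteratedFDeriv_diag_eq_sum, hterm, Finset.mul_sum]
    rw [Finset.sum_comm]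
    refine Finset.sum_eq_zero fun i _ => ?_
    calc _ = ((m.factorial : ℝ)⁻¹ * (((ℓ : ℝ) * K)⁻¹) ^ m * partialDeriv f i y) *
          ∑ s ∈ Comp d ℓ, basis d s z *
            listProd (List.ofFn fun r => ((i r : ℕ) + 1, -z (i r + 1))) (fun k => s k) := by
          rw [Finset.mul_sum]
          exact Finset.sum_congr rfl fun s _ => by ring
      _ = 0 := by rw [hzero, mul_zero]

theorem abs_meshPoint_sub_le {ℓ K : ℕ} (hK : 0 < K) {j : Fin d → Fin K} {s : ℕ → ℕ}
    (hs : s ∈ Comp d ℓ) {y : E d} (hy : y ∈ subCube K j) :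
    ∑ k, |((meshPoint ℓ K j fun k => s (k + 1)) - y) k| ≤ (d : ℝ) / K := by
  have hK' : (0 : ℝ) < K := by exact_mod_cast hK
  have : ∀ k : Fin d, |((meshPoint ℓ K j fun k => s (k + 1)) - y) k| ≤ 1 / K := by
    intro k
    obtain ⟨h1, h2⟩ := hy k
    have h3 : ((s (k + 1) : ℝ) / ℓ) ≤ 1 :=
      div_le_one_of_le₀ (by exact_mod_cast le_of_mem_comp hs _) (by positivity)
    have h4 : 0 ≤ ((s (k + 1) : ℝ) / ℓ) := by positivity
    simp only [PiLp.sub_apply, meshPoint]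
    have h5 : (((j k : ℕ) : ℝ) + (s (k + 1) : ℝ) / ℓ) / K ≤ (((j k : ℕ) : ℝ) + 1) / K := by gcongr
    have h6 : ((j k : ℕ) : ℝ) / K ≤ (((j k : ℕ) : ℝ) + (s (k + 1) : ℝ) / ℓ) / K := by
      gcongr; linarith
    rw [add_div ((j k : ℕ) : ℝ) 1] at h5 h2
    rw [abs_le]
    constructor <;> linarith
  refine (Finset.sum_le_sum fun k _ => this k).trans (le_of_eq ?_)
  simp
  ring

theorem bary_mem {ℓ K : ℕ} (hK : 0 < K) {j : Fin d → Fin K} {y : E d} (hy : y ∈ subCube K j)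
    {k : ℕ} (hk : k < d) :
    0 ≤ bary d ℓ K (fun k => if h : k < d then j ⟨k, h⟩ else 0) (coords y) (k + 1) ∧
      bary d ℓ K (fun k => if h : k < d then j ⟨k, h⟩ else 0) (coords y) (k + 1) ≤ ℓ := by
  have hK' : (0 : ℝ) < K := by exact_mod_cast hK
  obtain ⟨h1, h2⟩ := hy ⟨k, hk⟩
  rw [div_le_iff₀ hK'] at h1
  rw [le_div_iff₀ hK'] at h2
  have hl : (0 : ℝ) ≤ ℓ := by positivity
  simp only [bary, hk, dite_true, coords]
  constructor
  · exact mul_nonneg hl (by linarith)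
  · exact mul_le_of_le_one_right hl (by linarith)

/-- An upper bound for the sum of the absolute values of the Lagrange polynomials. -/
noncomputable def lebesgueConst (d ℓ : ℕ) : ℝ := ((ℓ + d).choose d : ℝ) * ((d : ℝ) * ℓ) ^ ℓ

theorem sum_abs_basis_le {ℓ K : ℕ} (hd : 1 ≤ d) (hK : 0 < K) {j : Fin d → Fin K} {y : E d}
    (hy : y ∈ subCube K j) : ∑ s ∈ Comp d ℓ,
      |basis d s (bary d ℓ K (fun k => if h : k < d then j ⟨k, h⟩ else 0) (coords y))| ≤
        lebesgueConst d ℓ := by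
  refine (Finset.sum_le_card_nsmul _ _ _ fun s hs => abs_basis_le hd hs (sum_bary _ _ _ _ _)
    (fun k hk => (bary_mem hK hy hk).1) fun k hk => (bary_mem hK hy hk).2).trans (le_of_eq ?_)
  rw [card_piAntidiag, nsmul_eq_mul, lebesgueConst]

theorem abs_sum_mul_basis_le {ℓ K : ℕ} (hd : 1 ≤ d) (hK : 0 < K) {j : Fin d → Fin K} {y : E d}
    (hy : y ∈ subCube K j) {a : (ℕ → ℕ) → ℝ} {M : ℝ} (hM : 0 ≤ M)
    (ha : ∀ s ∈ Comp d ℓ, |a s| ≤ M) : |∑ s ∈ Comp d ℓ,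
      a s * basis d s (bary d ℓ K (fun k => if h : k < d then j ⟨k, h⟩ else 0) (coords y))| ≤
        lebesgueConst d ℓ * M := by
  refine (Finset.abs_sum_le_sum_abs _ _).trans ?_
  calc _ ≤ ∑ s ∈ Comp d ℓ, M *
      |basis d s (bary d ℓ K (fun k => if h : k < d then j ⟨k, h⟩ else 0) (coords y))| := by
        refine Finset.sum_le_sum fun s hs => ?_
        rw [abs_mul]
        exact mul_le_mul_of_nonneg_right (ha s hs) (abs_nonneg _)
    _ ≤ lebesgueConst d ℓ * M := by
        rw [← Finset.mul_sum, mul_comm]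
        exact mul_le_mul_of_nonneg_right (sum_abs_basis_le hd hK hy) hM

/-- The error of the interpolation formula with perturbed values. -/
theorem IsHolderDensity.abs_interpolate_sub_le (hf : IsHolderDensity d β L f) (hβ : 0 < β)
    (hL : 0 ≤ L) (hd : 1 ≤ d) {n K : ℕ} (hK : 0 < K) (g : E d → ℝ) {j : Fin d → Fin K} {y : E d}
    (hy : y ∈ subCube K j) {M : ℝ}
    (hM : ∀ s ∈ Comp d (strictFloor β),
      |quantize n L (g (meshPoint (strictFloor β) K j fun k => s (k + 1))) -
        f (meshPoint (strictFloor β) K j fun k => s (k + 1))| ≤ M) :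
    |interpolate n (strictFloor β) K L g j y - f y| ≤ lebesgueConst d (strictFloor β) *
      (M + L * ((d : ℝ) / K) ^ β / (strictFloor β).factorial) := by
  have hM0 : 0 ≤ M := by
    refine (abs_nonneg _).trans (hM _ (extend_mem_comp (s := 0) (by simp)))
  have hr : 0 ≤ L * ((d : ℝ) / K) ^ β / (strictFloor β).factorial := by positivity
  rw [← sum_basis_mul_taylorSum (ℓ := strictFloor β) hK j f y]
  unfold interpolate
  rw [← Finset.sum_sub_distrib]
  refine le_of_eq_of_le (congrArg _ (Finset.sum_congr rfl fun s hs => ?_))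
    (abs_sum_mul_basis_le hd hK hy (add_nonneg hM0 hr)
      (a := fun s => quantize n L (g (meshPoint (strictFloor β) K j fun k => s (k + 1))) -
        taylorSum (strictFloor β) f y ((meshPoint (strictFloor β) K j fun k => s (k + 1)) - y))
      fun s hs => ?_)
  · ring
  · have h := hf.abs_sub_taylorSum_le hβ hL y
      ((meshPoint (strictFloor β) K j fun k => s (k + 1)) - y) (abs_meshPoint_sub_le hK hs hy)
    rw [add_sub_cancel] at h
    refine (abs_sub_le _ (f (meshPoint (strictFloor β) K j fun k => s (k + 1))) _).trans ?_
    exact add_le_add (hM s hs) h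

end

/-! ## Measurability -/

/-- Measurability of a list of bits is expressed through its level sets, of which there are
countably many. -/
theorem measurableSet_append {Ω : Type*} [MeasurableSpace Ω] {h h' : Ω → List Bool}
    (hm : ∀ l, MeasurableSet {X | h X = l}) (hm' : ∀ l, MeasurableSet {X | h' X = l})
    (l : List Bool) : MeasurableSet {X | h X ++ h' X = l} := by
  have : {X | h X ++ h' X = l} =
      ⋃ p ∈ {p : List Bool × List Bool | p.1 ++ p.2 = l}, {X | h X = p.1} ∩ {X | h' X = p.2} := by
    ext X
    simp only [Set.mem_ofPred_eq, Set.mem_iUnion, Set.mem_inter_iff, exists_prop]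
    constructor
    · intro hX
      exact ⟨(h X, h' X), hX, rfl, rfl⟩
    · rintro ⟨p, hp, h1, h2⟩
      rw [h1, h2]
      exact hp
  rw [this]
  exact MeasurableSet.biUnion (Set.to_countable _) fun p _ => (hm p.1).inter (hm' p.2)

theorem measurableSet_const_list {Ω : Type*} [MeasurableSpace Ω] (a l : List Bool) :
    MeasurableSet {_X : Ω | a = l} := by simp

theorem measurableSet_flatMap {Ω : Type*} [MeasurableSpace Ω] (N : ℕ) {F : Ω → ℕ → List Bool}
    (hF : ∀ i < N, ∀ l, MeasurableSet {X | F X i = l}) (l : List Bool) :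
    MeasurableSet {X | (List.range N).flatMap (F X) = l} := by
  induction N generalizing l with
  | zero => exact measurableSet_const_list _ _
  | succ N ih =>
    simp only [List.range_succ, List.flatMap_append, List.flatMap_singleton]
    exact measurableSet_append (ih fun i hi => hF i (by omega)) (hF N (by omega)) l

theorem measurableSet_digits {Ω : Type*} [MeasurableSpace Ω] {v : Ω → ℝ} (hv : Measurable v)
    (b : ℕ) (L : ℝ) (l : List Bool) : MeasurableSet {X | digits b L (v X) = l} := by
  have h : ∀ X, digits b L (v X) = (List.range b).flatMap fun m => [digit L (v X) m] := by
    intro X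
    rw [digits, List.map_eq_flatMap]
  simp only [h]
  refine measurableSet_flatMap b (fun m _ l => ?_) l
  match l with
  | [] => simp
  | [x] =>
    simp only [List.cons.injEq, and_true]
    exact ((measurable_digit L m).comp hv) (measurableSet_singleton x)
  | x :: y :: l => simp

theorem measurable_of_measurableSet_list {Ω γ : Type*} [MeasurableSpace Ω] [MeasurableSpace γ]
    {h : Ω → List Bool} (hm : ∀ l, MeasurableSet {X | h X = l}) (G : List Bool → γ) :
    Measurable fun X => G (h X) := by
  intro U _
  have : (fun X => G (h X)) ⁻¹' U = ⋃ l ∈ G ⁻¹' U, {X | h X = l} := by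
    ext X
    simp
  rw [this]
  exact MeasurableSet.biUnion (Set.to_countable _) fun l _ => hm l

section
variable {n d : ℕ} {β L cstar : ℝ} {fhat : Sample n d → E d → ℝ}

theorem gridPoint_mem_cube {ℓ K c : ℕ} (hc : c < K ^ d) {s : ℕ → ℕ} (hs : s ∈ Comp d ℓ) :
    gridPoint d ℓ K c s ∈ cube d := by
  obtain ⟨j, hj⟩ := gridPoint_eq_meshPoint (ℓ := ℓ) hc s
  rw [hj]
  exact meshPoint_mem_cube j (sum_tail_le hs)

theorem measurableSet_stored (hn : 2 ≤ n) (hβ : 0 < β) (hL : 0 < L)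
    (hfm : ∀ y ∈ cube d, Measurable fun X => fhat X y) (l : List Bool) :
    MeasurableSet {X | (preprocess preProg n d β L (fhat X)).out = l} := by
  simp only [(preprocess_effect hn hβ hL _).1]
  refine measurableSet_flatMap _ (fun c hc => ?_) l
  refine measurableSet_flatMap _ (fun i hi => ?_)
  exact measurableSet_digits ((measurable_clip L).comp
    (hfm _ (gridPoint_mem_cube hc (compSeq_mem hi)))) _ _

theorem measurable_compressed (hn : 2 ≤ n) (hβ : 0 < β) (hL : 0 < L)
    (hfm : ∀ y ∈ cube d, Measurable fun X => fhat X y) (y : E d) :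
    Measurable fun X => compressed preProg qryProg n d β L (fhat X) y :=
  measurable_of_measurableSet_list (measurableSet_stored hn hβ hL hfm)
    fun l => (evaluate qryProg n d β L l y).real 2 0

/-- The supremum over uncountably many points needs neither continuity nor a dense subset, as it is
a function of the stored bits. -/
theorem measurable_supDist (hn : 2 ≤ n) (hβ : 0 < β) (hL : 0 < L)
    (hfm : ∀ y ∈ cube d, Measurable fun X => fhat X y) (f : E d → ℝ) :
    Measurable fun X => supDist (compressed preProg qryProg n d β L (fhat X)) f :=
  measurable_of_measurableSet_list (measurableSet_stored hn hβ hL hfm)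
    fun l => supDist (fun y => (evaluate qryProg n d β L l y).real 2 0) f

/-! ## Resources -/

/-- `n.size ≤ 1 + log n / log 2 ≤ 2 log n / log 2`, and `2 / log 2 < 3`. -/
theorem size_le_log (hn : 2 ≤ n) : (n.size : ℝ) ≤ 3 * Real.log n := by
  have hl2 := Real.log_two_gt_d9
  have hn' : (2 : ℝ) ≤ n := by exact_mod_cast hn
  have h1 : 0 < n.size := Nat.size_pos.2 (by omega)
  have h2 : 2 ^ (n.size - 1) ≤ n := Nat.lt_size.1 (by omega)
  have h3 : ((n.size - 1 : ℕ) : ℝ) * Real.log 2 ≤ Real.log n := by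
    rw [← Real.log_pow]
    exact Real.log_le_log (by positivity) (by exact_mod_cast h2)
  rw [Nat.cast_sub h1] at h3
  push_cast at h3
  have h4 : Real.log 2 ≤ Real.log n := Real.log_le_log (by norm_num) hn'
  have h5 : (1 : ℝ) ≤ n.size := by exact_mod_cast h1
  nlinarith

theorem cells_mul_choose_le : ((gridSize n d β ^ d * (strictFloor β + d).choose d : ℕ) : ℝ) ≤
    meshCount n d β := by
  unfold meshCount
  rw [Nat.cast_mul, mul_comm]
  exact mul_le_mul_of_nonneg_left gridSize_pow_le (by positivity)

theorem asked_length_le (hn : 2 ≤ n) (hβ : 0 < β) (hL : 0 < L) (g : E d → ℝ) :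
    ((preprocess preProg n d β L g).asked.length : ℝ) ≤ meshCount n d β := by
  rw [(preprocess_effect hn hβ hL g).2, length_flatMap_range (w := (strictFloor β + d).choose d)]
  · exact cells_mul_choose_le
  · simp

theorem asked_mem (hn : 2 ≤ n) (hβ : 0 < β) (hL : 0 < L) (g : E d → ℝ) :
    ∀ u ∈ (preprocess preProg n d β L g).asked,
      ∃ (j : Fin d → Fin (gridSize n d β)) (s : Fin d → ℕ),
        ∑ i, s i ≤ strictFloor β ∧ u = meshPoint (strictFloor β) (gridSize n d β) j s := by
  intro u hu
  rw [(preprocess_effect hn hβ hL g).2] at hu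
  obtain ⟨c, hc, hu⟩ := List.mem_flatMap.1 hu
  obtain ⟨i, hi, rfl⟩ := List.mem_map.1 hu
  obtain ⟨j, hj⟩ := gridPoint_eq_meshPoint (ℓ := strictFloor β) (List.mem_range.1 hc)
    (compSeq d (strictFloor β) i)
  exact ⟨j, _, sum_tail_le (compSeq_mem (List.mem_range.1 hi)), hj⟩

theorem time_preprocess_le (hn : 2 ≤ n) (hd : 1 ≤ d) (hβ : 0 < β) (hL : 0 < L) (g : E d → ℝ)
    {Q : ℝ} (hQ : (d : ℝ) + Real.log n ≤ Q) :
    (preprocess preProg n d β L g).time Q ≤ 5000 * (Q * meshCount n d β) := by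
  have hd' : (1 : ℝ) ≤ d := by exact_mod_cast hd
  have hs := size_le_log hn
  have hlog : 0 ≤ Real.log n := Real.log_natCast_nonneg n
  have hQ0 : 0 ≤ Q := by linarith
  have hM := cells_mul_choose_le (n := n) (d := d) (β := β)
  have hst := preProg_steps g [] (start n d (strictFloor β) (gridSize n d β) L 0)
    (by simp [start, Nat.choose_pos]) (by simp [start])
    (by simpa [start] using gridSize_pos hn hβ)
  have hst' : ((preprocess preProg n d β L g).steps : ℝ) ≤ 1000 *
      ((gridSize n d β ^ d * (strictFloor β + d).choose d : ℕ) * (1 + d + n.size)) := by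
    have : (preprocess preProg n d β L g).steps ≤ 1000 *
        (gridSize n d β ^ d * (strictFloor β + d).choose d * (1 + d + n.size)) := by
      simpa [start, preprocess, mul_assoc] using hst
    exact_mod_cast this
  -- `1 + d + 3 log n ≤ 3 Q` follows from `d + log n ≤ Q` and `1 ≤ d`.
  have h1 : ((gridSize n d β ^ d * (strictFloor β + d).choose d : ℕ) : ℝ) * (1 + d + n.size) ≤
      meshCount n d β * (3 * Q) := by
    refine mul_le_mul hM (by linarith) (by positivity) ((Nat.cast_nonneg _).trans hM)
  have h2 := mul_le_mul_of_nonneg_left (asked_length_le hn hβ hL g) hQ0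
  have h3 : 0 ≤ Q * meshCount n d β := mul_nonneg hQ0 ((Nat.cast_nonneg _).trans hM)
  unfold Config.time
  linarith

theorem length_out_le (hn : 2 ≤ n) (hd : 1 ≤ d) (hβ : 0 < β) (hL : 0 < L) (g : E d → ℝ) :
    ((preprocess preProg n d β L g).out.length : ℝ) ≤ 5000 * ((d : ℝ) ^ 2 *
      (max (strictFloor β) 1 : ℕ) ^ 2 * meshCount n d β * Real.log n) := by
  have hd' : (1 : ℝ) ≤ (d : ℝ) ^ 2 := one_le_pow₀ (by exact_mod_cast hd)
  have hm' : (1 : ℝ) ≤ ((max (strictFloor β) 1 : ℕ) : ℝ) ^ 2 :=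
    one_le_pow₀ (by exact_mod_cast le_max_right _ _)
  have hs := size_le_log hn
  have hlog : 0 ≤ Real.log n := Real.log_natCast_nonneg n
  have hM := cells_mul_choose_le (n := n) (d := d) (β := β)
  have hM0 : 0 ≤ meshCount n d β := (Nat.cast_nonneg _).trans hM
  rw [(preprocess_effect hn hβ hL g).1, length_storedBits, ← mul_assoc, Nat.cast_mul]
  have h1 : ((gridSize n d β ^ d * (strictFloor β + d).choose d : ℕ) : ℝ) * n.size ≤
      meshCount n d β * (3 * Real.log n) := by
    gcongr
  have h2 : 1 * (meshCount n d β * Real.log n) ≤ ((d : ℝ) ^ 2 *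
      ((max (strictFloor β) 1 : ℕ) : ℝ) ^ 2) * (meshCount n d β * Real.log n) := by
    gcongr
    exact one_le_mul_of_one_le_of_one_le hd' hm'
  have h3 : 0 ≤ meshCount n d β * Real.log n := mul_nonneg hM0 hlog
  have h4 : (d : ℝ) ^ 2 * ((max (strictFloor β) 1 : ℕ) : ℝ) ^ 2 * meshCount n d β * Real.log n =
    ((d : ℝ) ^ 2 * ((max (strictFloor β) 1 : ℕ) : ℝ) ^ 2) * (meshCount n d β * Real.log n) := by
    ring
  rw [h4]
  linarith

theorem log_ge (hn : 2 ≤ n) : (0.69 : ℝ) ≤ Real.log n := by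
  have hl2 := Real.log_two_gt_d9
  have h4 : Real.log 2 ≤ Real.log n := Real.log_le_log (by norm_num) (by exact_mod_cast hn)
  linarith

theorem steps_evaluate_le (hn : 2 ≤ n) (hd : 1 ≤ d) (hβ : 0 < β) (bits : List Bool) {y : E d}
    (hy : y ∈ cube d) : ((evaluate qryProg n d β L bits y).steps : ℝ) ≤ 5000 * ((d : ℝ) *
      (max (strictFloor β) 1 : ℕ) * ((strictFloor β + d).choose d : ℝ) * Real.log n) := by
  have h := (evaluate_effect (L := L) hd hn hβ bits hy).2
  have h' : ((evaluate qryProg n d β L bits y).steps : ℝ) ≤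
      20 + 300 * ((1 + d) * (1 + n.size)) +
        (strictFloor β + d).choose d * (201 * (1 + d + n.size + strictFloor β)) := by
    exact_mod_cast h
  refine h'.trans ?_
  have hd' : (1 : ℝ) ≤ d := by exact_mod_cast hd
  have hm' : (1 : ℝ) ≤ ((max (strictFloor β) 1 : ℕ) : ℝ) := by exact_mod_cast le_max_right _ _
  have hlm : (strictFloor β : ℝ) ≤ ((max (strictFloor β) 1 : ℕ) : ℝ) := by
    exact_mod_cast le_max_left _ _
  have hB : (1 : ℝ) ≤ ((strictFloor β + d).choose d : ℝ) := by
    exact_mod_cast Nat.choose_pos (by omega)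
  have hs := size_le_log hn
  have hu := log_ge hn
  generalize (strictFloor β : ℝ) = l at *
  generalize ((max (strictFloor β) 1 : ℕ) : ℝ) = m at *
  generalize ((strictFloor β + d).choose d : ℝ) = B at *
  generalize (d : ℝ) = D at *
  have hS : (0 : ℝ) ≤ n.size := Nat.cast_nonneg _
  generalize (n.size : ℝ) = S at *
  generalize Real.log (n : ℝ) = u at *
  have hDm : D ≤ D * m := le_mul_of_one_le_right (by linarith) hm'
  have hmD : m ≤ D * m := le_mul_of_one_le_left (by linarith) hd'
  set p := D * m
  have hpu : p * 0.69 ≤ p * u := by gcongr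
  have hu1 : 1 * u ≤ p * u := by gcongr; linarith
  have hDu : D * u ≤ p * u := by gcongr
  have e1 : (1 + D) * (1 + S) ≤ 10 * (p * u) := by
    calc (1 + D) * (1 + S) ≤ (2 * D) * (5 * u) :=
        mul_le_mul_of_nonneg (by linarith) (by linarith) (by linarith) (by linarith)
      _ ≤ 10 * (p * u) := by linarith
  have e2 : 1 + D + S + l ≤ 9 * (p * u) := by linarith
  have e3 : B * (201 * (1 + D + S + l)) ≤ B * (201 * (9 * (p * u))) := by gcongr
  have e4 : 1 * (p * u) ≤ B * (p * u) := by
    have : 0 ≤ p * u := by linarith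
    gcongr
  have e5 : p * B * u = B * (p * u) := by ring
  rw [e5]
  linarith

/-! ## The risk -/

/-- Truncation is the projection onto an interval that contains `w`, so it cannot increase the
distance to `w`. -/
theorem abs_clip_sub_le {v w : ℝ} (h0 : 0 ≤ w) (h1 : w ≤ L) : |clip L v - w| ≤ |v - w| := by
  unfold clip
  have e := abs_le.1 (le_refl |v - w|)
  rw [abs_le]
  constructor
  · rcases le_total v L with h | h
    · rw [min_eq_left h]; linarith [le_max_right 0 v]
    · rw [min_eq_right h]; linarith [le_max_right 0 L, abs_nonneg (v - w)]
  · rw [sub_le_iff_le_add]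
    refine max_le (by linarith [abs_nonneg (v - w)]) ((min_le_left _ _).trans (by linarith))

theorem isProbabilityMeasure_sampleLaw {f : E d → ℝ} (hf : IsHolderDensity d β L f) :
    IsProbabilityMeasure (sampleLaw n f) := by
  have hint : Integrable f := by
    by_contra h
    have := integral_undef h
    rw [hf.integral_eq_one] at this
    exact one_ne_zero this
  have : IsProbabilityMeasure
      ((volume : Measure (E d)).withDensity fun x => ENNReal.ofReal (f x)) := by
    constructor
    rw [withDensity_apply _ MeasurableSet.univ, Measure.restrict_univ,
      ← ofReal_integral_eq_lintegral_ofReal hint (Filter.Eventually.of_forall hf.nonneg),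
      hf.integral_eq_one, ENNReal.ofReal_one]
  unfold sampleLaw
  infer_instance

/-- The event that the estimator is off by more than `t` at some mesh point. -/
def badEvent (n d ℓ K : ℕ) (t : ℝ) (fhat : Sample n d → E d → ℝ) (f : E d → ℝ) :
    Set (Sample n d) :=
  ⋃ p ∈ (Finset.univ : Finset (Fin d → Fin K)) ×ˢ Comp d ℓ,
    {X | t < |fhat X (meshPoint ℓ K p.1 fun k => p.2 (k + 1)) -
      f (meshPoint ℓ K p.1 fun k => p.2 (k + 1))|}

theorem measurableSet_badEvent {ℓ K : ℕ} (t : ℝ)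
    (hfm : ∀ y ∈ cube d, Measurable fun X => fhat X y) (f : E d → ℝ) :
    MeasurableSet (badEvent n d ℓ K t fhat f) := by
  refine Finset.measurableSet_biUnion _ fun p hp => ?_
  have hmem := meshPoint_mem_cube (ℓ := ℓ) p.1 (sum_tail_le (Finset.mem_product.1 hp).2)
  exact measurableSet_lt measurable_const (((hfm _ hmem).sub_const _).abs)

/-- Union bound over all pairs of a sub-cube and a lattice point. -/
theorem sampleLaw_badEvent_le {ℓ K : ℕ} {t : ℝ} {f : E d → ℝ} (hf : IsHolderDensity d β L f)
    (htail : TailBound β L cstar fhat) (ht : cstar * rate n d β ≤ t) (ht1 : t ≤ 1) :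
    sampleLaw n f (badEvent n d ℓ K t fhat f) ≤ ENNReal.ofReal
      (((K ^ d * (ℓ + d).choose d : ℕ) : ℝ) *
        (2 * Real.exp (-(t ^ 2 / (cstar * rate n d β) ^ 2)))) := by
  refine (measure_biUnion_finset_le _ _).trans ?_
  refine (Finset.sum_le_card_nsmul _ _ _ fun p hp => htail _ (meshPoint_mem_cube p.1
    (sum_tail_le (Finset.mem_product.1 hp).2)) t ht ht1 f hf).trans ?_
  rw [Finset.card_product, card_piAntidiag, Finset.card_univ, Fintype.card_fun, Fintype.card_fin,
    Fintype.card_fin, nsmul_eq_mul, ENNReal.ofReal_mul (Nat.cast_nonneg _), ENNReal.ofReal_natCast]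

/-- The supremum error on and off the bad event. -/
theorem supDist_compressed_le (hd : 1 ≤ d) (hn : 2 ≤ n) (hβ : 0 < β) (hL : 0 < L) {t : ℝ}
    (ht : 0 ≤ t) {f : E d → ℝ} (hf : IsHolderDensity d β L f) (X : Sample n d) :
    supDist (compressed preProg qryProg n d β L (fhat X)) f ≤
      ENNReal.ofReal (lebesgueConst d (strictFloor β) * (L / n + t +
        L * ((d : ℝ) / gridSize n d β) ^ β / (strictFloor β).factorial)) +
      (badEvent n d (strictFloor β) (gridSize n d β) t fhat f).indicator
        (fun _ => ENNReal.ofReal (lebesgueConst d (strictFloor β) * L)) X := by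
  have hK := gridSize_pos (d := d) hn hβ
  have hΛ : 0 ≤ lebesgueConst d (strictFloor β) := by unfold lebesgueConst; positivity
  set R := L * ((d : ℝ) / gridSize n d β) ^ β / (strictFloor β).factorial with hR
  have hR0 : 0 ≤ R := by positivity
  have hLn : 0 ≤ L / n := by positivity
  refine iSup₂_le fun y hy => ?_
  rw [compressed_eq hd hn hβ hL (fhat X) hy, Real.enorm_eq_ofReal_abs]
  have hsub := mem_subCube_cellFun hK hy
  -- On the bad event the stored values and `f` still lie in `[0, L]`, so they differ by at most
  -- `L`. Off it, quantization, truncation and the level `t` give `L / n + t`.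
  by_cases hX : X ∈ badEvent n d (strictFloor β) (gridSize n d β) t fhat f
  · rw [Set.indicator_of_mem hX, ← ENNReal.ofReal_add (by positivity) (by positivity)]
    refine ENNReal.ofReal_le_ofReal ?_
    have h := hf.abs_interpolate_sub_le hβ hL.le hd (n := n) hK (fhat X) hsub (M := L)
      fun s _ => by
        have h1 := quantize_nonneg (n := n) hL.le (fhat X (meshPoint (strictFloor β)
          (gridSize n d β) (cellFun hK y) fun k => s (k + 1)))
        have h2 := quantize_le (n := n) hL.le (fhat X (meshPoint (strictFloor β)
          (gridSize n d β) (cellFun hK y) fun k => s (k + 1)))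
        have h3 := hf.nonneg (meshPoint (strictFloor β)
          (gridSize n d β) (cellFun hK y) fun k => s (k + 1))
        have h4 := hf.le_bound hβ hL.le hd (meshPoint (strictFloor β)
          (gridSize n d β) (cellFun hK y) fun k => s (k + 1))
        rw [abs_le]
        constructor <;> linarith
    refine h.trans ?_
    rw [← mul_add]
    exact mul_le_mul_of_nonneg_left (by linarith) hΛ
  · rw [Set.indicator_of_notMem hX, add_zero]
    refine ENNReal.ofReal_le_ofReal ?_
    refine hf.abs_interpolate_sub_le hβ hL.le hd (n := n) hK (fhat X) hsub (M := L / n + t)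
      fun s hs => ?_
    set u := meshPoint (strictFloor β) (gridSize n d β) (cellFun hK y) fun k => s (k + 1)
    have h1 := abs_quantize_sub_clip_le (n := n) hL.le (by omega) (fhat X u)
    have h2 := abs_clip_sub_le (v := fhat X u) (hf.nonneg u) (hf.le_bound hβ hL.le hd u)
    have h3 : |fhat X u - f u| ≤ t := by
      by_contra hcon
      refine hX (Set.mem_biUnion (x := (cellFun hK y, s)) ?_ (not_le.1 hcon))
      simpa using hs
    exact (abs_sub_le _ (clip L (fhat X u)) _).trans (add_le_add h1 (h2.trans h3))

end

/-! ### Constants and the expected error -/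

section
variable {n d : ℕ} {β L cstar : ℝ}

theorem rate_pos (hn : 2 ≤ n) : 0 < rate n d β := by
  unfold rate
  have : (0 : ℝ) < n := by exact_mod_cast (by omega : 0 < n)
  positivity

theorem inv_le_rate (hn : 2 ≤ n) (hβ : 0 < β) : 1 / (n : ℝ) ≤ rate n d β := by
  have hn1 : (1 : ℝ) ≤ n := by exact_mod_cast (by omega : 1 ≤ n)
  unfold rate
  rw [one_div, ← Real.rpow_neg_one]
  refine Real.rpow_le_rpow_of_exponent_le hn1 ?_
  rw [neg_le_neg_iff, div_le_one (by positivity)]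
  have : (0 : ℝ) ≤ d := by positivity
  linarith

/-- Rounding down a number that is at least `1` loses at most a factor `2`, which becomes `2 ^ β ≤ 2
* 2 ^ ℓ`. The power `2 ^ ℓ` is later absorbed by `(2ℓ)^(2ℓ)`. -/
theorem div_gridSize_rpow_le (hn : 2 ≤ n) (hβ : 0 < β) :
    ((d : ℝ) / gridSize n d β) ^ β ≤ (d : ℝ) ^ β * (2 * 2 ^ strictFloor β * rate n d β) := by
  have hn0 : (0 : ℝ) < n := by exact_mod_cast (by omega : 0 < n)
  have hK : (0 : ℝ) < gridSize n d β := by exact_mod_cast gridSize_pos hn hβ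
  have hK1 : (1 : ℝ) ≤ gridSize n d β := by exact_mod_cast gridSize_pos hn hβ
  have hx : (n : ℝ) ^ (1 / (2 * β + d)) ≤ 2 * gridSize n d β := by
    have := (Nat.lt_floor_add_one ((n : ℝ) ^ (1 / (2 * β + d)))).le
    unfold gridSize at hK1 ⊢
    linarith
  have hx0 : 0 < (n : ℝ) ^ (1 / (2 * β + d)) := by positivity
  rw [div_eq_mul_inv, Real.mul_rpow (by positivity) (by positivity)]
  refine mul_le_mul_of_nonneg_left ?_ (by positivity)
  have h1 : ((gridSize n d β : ℝ))⁻¹ ≤ 2 * ((n : ℝ) ^ (1 / (2 * β + d)))⁻¹ := by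
    rw [← div_eq_mul_inv, le_div_iff₀ hx0, inv_mul_le_iff₀ hK]
    linarith
  calc ((gridSize n d β : ℝ))⁻¹ ^ β ≤ (2 * ((n : ℝ) ^ (1 / (2 * β + d)))⁻¹) ^ β := by gcongr
    _ = 2 ^ β * rate n d β := by
        rw [Real.mul_rpow (by norm_num) (by positivity), ← Real.rpow_neg hn0.le,
          ← Real.rpow_mul hn0.le]
        unfold rate
        congr 2
        ring
    _ ≤ 2 * 2 ^ strictFloor β * rate n d β := by
        refine mul_le_mul_of_nonneg_right ?_ (rate_pos hn).le
        calc (2 : ℝ) ^ β ≤ 2 ^ ((strictFloor β : ℝ) + 1) :=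
              Real.rpow_le_rpow_of_exponent_le (by norm_num) (le_strictFloor_add_one β)
          _ = 2 * 2 ^ strictFloor β := by
              rw [Real.rpow_add (by norm_num), Real.rpow_natCast, Real.rpow_one, mul_comm]

theorem factorial_mul_pow_le (ℓ : ℕ) : (2 : ℝ) ^ ℓ * (ℓ.factorial * (ℓ : ℝ) ^ ℓ) ≤
    (2 * (ℓ : ℝ)) ^ (2 * ℓ) := by
  have h1 : (ℓ.factorial : ℝ) ≤ (ℓ : ℝ) ^ ℓ := by exact_mod_cast Nat.factorial_le_pow ℓ
  have h2 : (1 : ℝ) ≤ 2 ^ ℓ := one_le_pow₀ (by norm_num)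
  have h3 : (2 * (ℓ : ℝ)) ^ (2 * ℓ) = (2 ^ ℓ * 2 ^ ℓ) * ((ℓ : ℝ) ^ ℓ * (ℓ : ℝ) ^ ℓ) := by
    rw [mul_pow, two_mul, pow_add, pow_add]
  rw [h3]
  gcongr
  exact le_mul_of_one_le_left (by positivity) h2

theorem choose_ge_one (d ℓ : ℕ) : (1 : ℝ) ≤ ((ℓ + d).choose d : ℝ) := by
  exact_mod_cast Nat.choose_pos (by omega)

theorem two_pow_mul_lebesgueConst_le (d ℓ : ℕ) : 2 ^ ℓ * lebesgueConst d ℓ ≤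
    ((ℓ + d).choose d : ℝ) ^ 2 * (2 * (ℓ : ℝ)) ^ (2 * ℓ) := by
  have h := factorial_mul_pow_le ℓ
  have h2 : (d : ℝ) ^ ℓ ≤ ℓ.factorial * ((ℓ + d).choose d : ℝ) := by
    exact_mod_cast pow_le_factorial_mul_choose d ℓ
  unfold lebesgueConst
  calc (2 : ℝ) ^ ℓ * (((ℓ + d).choose d : ℝ) * ((d : ℝ) * ℓ) ^ ℓ)
      = 2 ^ ℓ * ((ℓ + d).choose d : ℝ) * (d : ℝ) ^ ℓ * (ℓ : ℝ) ^ ℓ := by rw [mul_pow]; ring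
    _ ≤ 2 ^ ℓ * ((ℓ + d).choose d : ℝ) * (ℓ.factorial * ((ℓ + d).choose d : ℝ)) * (ℓ : ℝ) ^ ℓ := by
        gcongr
    _ = ((ℓ + d).choose d : ℝ) ^ 2 * (2 ^ ℓ * (ℓ.factorial * (ℓ : ℝ) ^ ℓ)) := by ring
    _ ≤ _ := by gcongr

/-- Needed for the terms that carry `L` without the factor `d^β / ℓ!`: the factor is supplied by
`d^ℓ ≤ d^β` and the spare factorial in `factorial_mul_pow_le`. -/
theorem lebesgueConst_le (hd : 1 ≤ d) (hβ : 0 < β) : lebesgueConst d (strictFloor β) ≤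
    ((strictFloor β + d).choose d : ℝ) ^ 3 * (2 * (strictFloor β : ℝ)) ^ (2 * strictFloor β) *
      ((d : ℝ) ^ β / ((strictFloor β).factorial : ℝ)) := by
  have hd' : (1 : ℝ) ≤ d := by exact_mod_cast hd
  set ℓ := strictFloor β
  have hB := choose_ge_one d ℓ
  have hB3 : ((ℓ + d).choose d : ℝ) ≤ ((ℓ + d).choose d : ℝ) ^ 3 := le_self_pow₀ hB (by norm_num)
  have h := factorial_mul_pow_le ℓ
  have hf : (0 : ℝ) < ℓ.factorial := by exact_mod_cast ℓ.factorial_pos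
  have hdβ : (d : ℝ) ^ ℓ ≤ (d : ℝ) ^ β := by
    rw [← Real.rpow_natCast]
    exact Real.rpow_le_rpow_of_exponent_le hd' (strictFloor_lt hβ).le
  have h2 : (1 : ℝ) ≤ 2 ^ ℓ := one_le_pow₀ (by norm_num)
  have h' : (ℓ.factorial : ℝ) * (ℓ : ℝ) ^ ℓ ≤ (2 * (ℓ : ℝ)) ^ (2 * ℓ) :=
    (le_mul_of_one_le_left (by positivity) h2).trans h
  rw [← mul_div_assoc, le_div_iff₀ hf]
  unfold lebesgueConst
  calc ((ℓ + d).choose d : ℝ) * ((d : ℝ) * ℓ) ^ ℓ * ℓ.factorial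
      = ((ℓ + d).choose d : ℝ) * (ℓ.factorial * (ℓ : ℝ) ^ ℓ) * (d : ℝ) ^ ℓ := by
        rw [mul_pow]; ring
    _ ≤ _ := by gcongr

/-- The argument of the logarithm in the choice of the error level. -/
theorem log_level_mem (hn : 2 ≤ n) (hβ : 0 < β) (ℓ : ℕ) :
    1 ≤ Real.log (2 * ((ℓ + d).choose d : ℝ) * (n : ℝ) ^ ((d : ℝ) / (2 * β + d) + 2)) ∧
    Real.log (2 * ((ℓ + d).choose d : ℝ) * (n : ℝ) ^ ((d : ℝ) / (2 * β + d) + 2)) ≤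
      (3 * ((ℓ + d).choose d : ℝ)) ^ 2 * Real.log n := by
  have hn0 : (0 : ℝ) < n := by exact_mod_cast (by omega : 0 < n)
  have hB := choose_ge_one d ℓ
  have hu := log_ge hn
  have hl2 := Real.log_two_gt_d9
  have hl2' : Real.log 2 ≤ Real.log n := Real.log_le_log (by norm_num) (by exact_mod_cast hn)
  have hD0 : 0 ≤ (d : ℝ) / (2 * β + d) := by positivity
  have hD1 : (d : ℝ) / (2 * β + d) ≤ 1 := by
    rw [div_le_one (by positivity)]; linarith
  have hlB : Real.log ((ℓ + d).choose d : ℝ) ≤ ((ℓ + d).choose d : ℝ) - 1 :=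
    Real.log_le_sub_one_of_pos (by linarith)
  have hlB0 : 0 ≤ Real.log ((ℓ + d).choose d : ℝ) := Real.log_nonneg hB
  rw [Real.log_mul (by positivity) (by positivity), Real.log_mul (by norm_num) (by positivity),
    Real.log_rpow hn0]
  generalize ((ℓ + d).choose d : ℝ) = B at *
  generalize Real.log (n : ℝ) = u at *
  generalize (d : ℝ) / (2 * β + d) = D at *
  have h1 : 0 ≤ D * u := by positivity
  have h2 : D * u ≤ u := mul_le_of_le_one_left (by linarith) hD1
  constructor
  · linarith
  · have h3 : B * 0.69 ≤ B * u := by gcongr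
    have h4 : 1 * u ≤ B * u := by gcongr
    have h5 : 1 * (B * u) ≤ B * (B * u) := by gcongr
    have h6 : (3 * B) ^ 2 * u = 9 * (B * (B * u)) := by ring
    rw [h6]
    linarith

/-- The comparison of the bound for the risk with the constant of the theorem. -/
theorem risk_bound_lt (hn : 2 ≤ n) (hd : 1 ≤ d) (hβ : 0 < β) (hL : 0 < L) (hc : 0 < cstar) :
    lebesgueConst d (strictFloor β) * (L / n + cstar * rate n d β *
        √(Real.log (2 * ((strictFloor β + d).choose d : ℝ) *
          (n : ℝ) ^ ((d : ℝ) / (2 * β + d) + 2))) +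
        L * ((d : ℝ) / gridSize n d β) ^ β / (strictFloor β).factorial) +
      lebesgueConst d (strictFloor β) * L * ((n : ℝ) ^ 2)⁻¹ <
    riskConst d β L cstar * (Real.log n) ^ (1 / 2 : ℝ) * rate n d β := by
  have hn1 : (1 : ℝ) ≤ n := by exact_mod_cast (by omega : 1 ≤ n)
  have hd0 : (0 : ℝ) < d := by exact_mod_cast hd
  have hρ := rate_pos (n := n) (d := d) (β := β) hn
  have hρn := inv_le_rate (n := n) (d := d) hn hβ
  have hR := div_gridSize_rpow_le (n := n) (d := d) hn hβ
  have hΛ1 := two_pow_mul_lebesgueConst_le d (strictFloor β)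
  have hΛ2 := lebesgueConst_le (d := d) hd hβ
  have hA := (log_level_mem (d := d) hn hβ (strictFloor β)).2
  have hu := log_ge hn
  have hn2 : ((n : ℝ) ^ 2)⁻¹ ≤ rate n d β := by
    refine le_trans ?_ hρn
    rw [one_div]
    exact inv_anti₀ (by linarith) (le_self_pow₀ hn1 (by norm_num))
  have hB := choose_ge_one d (strictFloor β)
  have hsym : ((strictFloor β + d).choose (strictFloor β) : ℝ) =
      ((strictFloor β + d).choose d : ℝ) := by exact_mod_cast Nat.choose_symm_add
  have hΛ0 : 0 ≤ lebesgueConst d (strictFloor β) := by unfold lebesgueConst; positivity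
  have hf : (0 : ℝ) < (strictFloor β).factorial := by
    exact_mod_cast (strictFloor β).factorial_pos
  have h2 : (1 : ℝ) ≤ 2 ^ strictFloor β := one_le_pow₀ (by norm_num)
  have hrest : 0 < 2 * L * (d : ℝ) ^ ((3 * (strictFloor β : ℝ) + 1) / 2) := by positivity
  have hdβ : 0 < (d : ℝ) ^ β := by positivity
  have hW0 : 0 ≤ (2 * (strictFloor β : ℝ)) ^ (2 * strictFloor β) := by positivity
  unfold riskConst
  rw [← Real.sqrt_eq_rpow, hsym]
  have hsA : √(Real.log (2 * ((strictFloor β + d).choose d : ℝ) *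
      (n : ℝ) ^ ((d : ℝ) / (2 * β + d) + 2))) ≤
      3 * ((strictFloor β + d).choose d : ℝ) * √(Real.log n) := by
    refine (Real.sqrt_le_sqrt hA).trans (le_of_eq ?_)
    rw [Real.sqrt_mul (by positivity), Real.sqrt_sq (by positivity)]
  have hs : (0.8 : ℝ) ≤ √(Real.log n) := by
    refine Real.le_sqrt_of_sq_le ?_
    norm_num at hu ⊢
    linarith
  generalize √(Real.log (2 * ((strictFloor β + d).choose d : ℝ) *
      (n : ℝ) ^ ((d : ℝ) / (2 * β + d) + 2))) = a at *
  generalize √(Real.log n) = s at *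
  generalize 2 * L * (d : ℝ) ^ ((3 * (strictFloor β : ℝ) + 1) / 2) = w at *
  generalize lebesgueConst d (strictFloor β) = Λ at *
  generalize (2 * (strictFloor β : ℝ)) ^ (2 * strictFloor β) = W at *
  generalize ((strictFloor β + d).choose d : ℝ) = B at *
  generalize (2 : ℝ) ^ strictFloor β = T at *
  generalize ((strictFloor β).factorial : ℝ) = F at *
  generalize ((d : ℝ) / gridSize n d β) ^ β = R at *
  generalize (d : ℝ) ^ β = G at *
  generalize rate n d β = ρ at *
  have hP0 : 0 ≤ B ^ 3 * W := by positivity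
  have hB23 : B ^ 2 * W ≤ B ^ 3 * W := by
    gcongr
    norm_num
  have hTΛ : T * Λ ≤ B ^ 3 * W := hΛ1.trans hB23
  -- The third power of the binomial coefficient: two factors come from the Lebesgue constant, the
  -- third from `√A ≤ 3 B √(log n)`.
  have hΛB : Λ * B ≤ B ^ 3 * W := by
    calc Λ * B ≤ (T * Λ) * B := by
          gcongr
          exact le_mul_of_one_le_left hΛ0 h2
      _ ≤ (B ^ 2 * W) * B := by gcongr
      _ = B ^ 3 * W := by ring
  set P := B ^ 3 * W
  have e1 : Λ * (cstar * ρ * a) ≤ 3 * P * s * (cstar * ρ) := by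
    calc Λ * (cstar * ρ * a) ≤ Λ * (cstar * ρ * (3 * B * s)) := by gcongr
      _ = 3 * (Λ * B) * s * (cstar * ρ) := by ring
      _ ≤ 3 * P * s * (cstar * ρ) := by gcongr
  have e2 : Λ * (L * R / F) ≤ 2 * P * (L * G / F * ρ) := by
    calc Λ * (L * R / F) ≤ Λ * (L * (G * (2 * T * ρ)) / F) := by gcongr
      _ = 2 * (T * Λ) * (L * G / F * ρ) := by ring
      _ ≤ 2 * P * (L * G / F * ρ) := by gcongr
  have hΛ3 : Λ * (L * ρ) ≤ P * (L * G / F * ρ) := by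
    calc Λ * (L * ρ) ≤ (P * (G / F)) * (L * ρ) := by gcongr
      _ = P * (L * G / F * ρ) := by ring
  have e3 : Λ * (L / n) ≤ P * (L * G / F * ρ) := by
    refine le_trans ?_ hΛ3
    rw [div_eq_mul_one_div]
    gcongr
  have e4 : Λ * L * ((n : ℝ) ^ 2)⁻¹ ≤ P * (L * G / F * ρ) := by
    refine le_trans ?_ hΛ3
    rw [mul_assoc]
    gcongr
  have hY0 : 0 ≤ P * (L * G / F * ρ) := by positivity
  have hY : P * (L * G / F * ρ) * 0.8 ≤ P * (L * G / F * ρ) * s := by gcongr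
  have hX0 : 0 ≤ P * s * (cstar * ρ) := by
    have : 0 ≤ s := by linarith
    positivity
  have hw : 0 < w * s * ρ := by
    have : 0 < s := by linarith
    positivity
  -- The stochastic term uses `3` of the `10` units. The other terms use `2 + 1 + 1 = 4` units
  -- without the factor `s`, hence `5` with it, because `s ≥ 0.8`. Strictness comes from `w`.
  have hexp : (10 * B ^ 3 * W * (cstar + L * G / F) + w) * s * ρ =
      10 * (P * s * (cstar * ρ)) + 10 * (P * (L * G / F * ρ) * s) + w * s * ρ := by
    simp only [P]
    ring
  rw [hexp]
  linarith [mul_add Λ (L / n + cstar * ρ * a) (L * R / F), mul_add Λ (L / n) (cstar * ρ * a)]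

theorem lintegral_supDist_lt (hn : 2 ≤ n) (hd : 1 ≤ d) (hβ : 0 < β) (hL : 0 < L) (hc : 0 < cstar)
    {fhat : Sample n d → E d → ℝ} (hfm : ∀ y ∈ cube d, Measurable fun X => fhat X y)
    (htail : TailBound β L cstar fhat)
    (hlevel : cstar * rate n d β * √(Real.log (2 * ((strictFloor β + d).choose d : ℝ)
                * (n : ℝ) ^ ((d : ℝ) / (2 * β + d) + 2))) ≤ 1)
    {f : E d → ℝ} (hf : IsHolderDensity d β L f) :
    ∫⁻ X, supDist (compressed preProg qryProg n d β L (fhat X)) f ∂(sampleLaw n f) <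
      ENNReal.ofReal (riskConst d β L cstar * (Real.log n) ^ (1 / 2 : ℝ) * rate n d β) := by
  have := isProbabilityMeasure_sampleLaw (n := n) hf
  have hn0 : (0 : ℝ) < n := by exact_mod_cast (by omega : 0 < n)
  have hρ := rate_pos (n := n) (d := d) (β := β) hn
  have hB := choose_ge_one d (strictFloor β)
  have hΛ0 : 0 ≤ lebesgueConst d (strictFloor β) := by unfold lebesgueConst; positivity
  have hlt := risk_bound_lt (n := n) (d := d) hn hd hβ hL hc
  obtain ⟨hA1, -⟩ := log_level_mem (n := n) (d := d) hn hβ (strictFloor β)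
  set A := Real.log (2 * ((strictFloor β + d).choose d : ℝ)
                * (n : ℝ) ^ ((d : ℝ) / (2 * β + d) + 2)) with hA
  set t := cstar * rate n d β * √A with ht
  have hε : 0 < cstar * rate n d β := mul_pos hc hρ
  -- The tail bound is available at `t`: from below since `A ≥ 1`, from above by `hlevel`.
  have ht0 : cstar * rate n d β ≤ t := le_mul_of_one_le_right hε.le (Real.one_le_sqrt.2 hA1)
  have hbad := sampleLaw_badEvent_le (ℓ := strictFloor β) (K := gridSize n d β) hf htail ht0 hlevel
  have hexp : t ^ 2 / (cstar * rate n d β) ^ 2 = A := by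
    rw [ht, mul_pow, Real.sq_sqrt (by linarith)]
    field_simp
  -- `A` is chosen so that `exp (-A)` cancels the factor `2` and the number of mesh points, with
  -- `n^(-2)` left over.
  have hprob : ((gridSize n d β ^ d * (strictFloor β + d).choose d : ℕ) : ℝ) *
      (2 * Real.exp (-A)) ≤ ((n : ℝ) ^ 2)⁻¹ := by
    have hpow : (n : ℝ) ^ ((d : ℝ) / (2 * β + d) + 2) =
        (n : ℝ) ^ ((d : ℝ) / (2 * β + d)) * (n : ℝ) ^ 2 := by
      rw [Real.rpow_add hn0]
      norm_cast
    have hD : 0 < (n : ℝ) ^ ((d : ℝ) / (2 * β + d)) := by positivity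
    rw [Real.exp_neg, hA, Real.exp_log (by positivity), hpow]
    refine (mul_le_mul_of_nonneg_right cells_mul_choose_le (by positivity)).trans (le_of_eq ?_)
    unfold meshCount
    field_simp
  rw [hexp] at hbad
  have hbad' := hbad.trans (ENNReal.ofReal_le_ofReal hprob)
  refine (lintegral_mono fun X => supDist_compressed_le (fhat := fhat) hd hn hβ hL
    (hε.le.trans ht0) hf X).trans_lt ?_
  rw [lintegral_add_left measurable_const, lintegral_const, measure_univ, mul_one,
    lintegral_indicator_const (measurableSet_badEvent t hfm f)]
  refine lt_of_le_of_lt (add_le_add_right (mul_le_mul_right hbad' _) _) ?_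
  have ht' : 0 ≤ t := hε.le.trans ht0
  rw [← ENNReal.ofReal_mul (by positivity), ← ENNReal.ofReal_add (by positivity) (by positivity)]
  refine (ENNReal.ofReal_lt_ofReal_iff_of_nonneg (by positivity)).2 hlt

end

end DensityInterp

theorem theorem1 :
    ∃ (C : ℝ) (pre qry : DensityInterp.Prog), 0 < C ∧
      ∀ (n d : ℕ) (β L cstar : ℝ), 2 ≤ n → 1 ≤ d → 0 < β → 0 < L → 0 < cstar →
      ∀ fhat : DensityInterp.Sample n d → DensityInterp.E d → ℝ,
        (∀ y ∈ DensityInterp.cube d, Measurable fun X => fhat X y) →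
        DensityInterp.TailBound β L cstar fhat →
        -- for every sample: construction, storage, queries, shape of the new estimator
        (∀ X : DensityInterp.Sample n d,
          (∀ Q : ℝ, (d : ℝ) + Real.log n ≤ Q →
            (DensityInterp.preprocess pre n d β L (fhat X)).time Q
              ≤ C * (Q * DensityInterp.meshCount n d β)) ∧
          ((DensityInterp.preprocess pre n d β L (fhat X)).asked.length : ℝ)
              ≤ DensityInterp.meshCount n d β ∧
          (∀ u ∈ (DensityInterp.preprocess pre n d β L (fhat X)).asked,
            ∃ (j : Fin d → Fin (DensityInterp.gridSize n d β)) (s : Fin d → ℕ),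
              ∑ i, s i ≤ DensityInterp.strictFloor β ∧
              u = DensityInterp.meshPoint (DensityInterp.strictFloor β)
                (DensityInterp.gridSize n d β) j s) ∧
          ((DensityInterp.preprocess pre n d β L (fhat X)).out.length : ℝ)
              ≤ C * ((d : ℝ) ^ 2 * (max (DensityInterp.strictFloor β) 1 : ℕ) ^ 2
                * DensityInterp.meshCount n d β * Real.log n) ∧
          (∀ y ∈ DensityInterp.cube d,
            ((DensityInterp.evaluate qry n d β L
                (DensityInterp.preprocess pre n d β L (fhat X)).out y).steps : ℝ)
              ≤ C * ((d : ℝ) * (max (DensityInterp.strictFloor β) 1 : ℕ)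
                * ((DensityInterp.strictFloor β + d).choose d : ℝ) * Real.log n)) ∧
          DensityInterp.IsInterpolant (DensityInterp.strictFloor β)
            (DensityInterp.gridSize n d β) L (L / n) (fhat X)
            (DensityInterp.compressed pre qry n d β L (fhat X))) ∧
        -- the new estimator is measurable in the sample
        (∀ y ∈ DensityInterp.cube d,
          Measurable fun X => DensityInterp.compressed pre qry n d β L (fhat X) y) ∧
        -- the risk bound
        (cstar * DensityInterp.rate n d β
            * √(Real.log (2 * ((DensityInterp.strictFloor β + d).choose d : ℝ)
                * (n : ℝ) ^ ((d : ℝ) / (2 * β + d) + 2))) ≤ 1 →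
          ∀ f : DensityInterp.E d → ℝ, DensityInterp.IsHolderDensity d β L f →
            (Measurable fun X : DensityInterp.Sample n d =>
              DensityInterp.supDist (DensityInterp.compressed pre qry n d β L (fhat X)) f) ∧
            ∫⁻ X, DensityInterp.supDist (DensityInterp.compressed pre qry n d β L (fhat X)) f
                ∂(DensityInterp.sampleLaw n f)
              < ENNReal.ofReal (DensityInterp.riskConst d β L cstar
                * (Real.log n) ^ (1 / 2 : ℝ) * DensityInterp.rate n d β)) := by
  -- The query time decides the constant: its three contributions in `steps_evaluate_le` are about
  -- `29`, `3000` and `1809`.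
  refine ⟨5000, DensityInterp.preProg, DensityInterp.qryProg, by norm_num, ?_⟩
  intro n d β L cstar hn hd hβ hL hc fhat hfm htail
  refine ⟨fun X => ⟨fun Q hQ => ?_, ?_, ?_, ?_, fun y hy => ?_, ?_⟩, fun y _ => ?_,
    fun hlevel f hf => ⟨?_, ?_⟩⟩
  · exact DensityInterp.time_preprocess_le hn hd hβ hL _ hQ
  · exact DensityInterp.asked_length_le hn hβ hL _
  · exact DensityInterp.asked_mem hn hβ hL _
  · exact DensityInterp.length_out_le hn hd hβ hL _
  · exact DensityInterp.steps_evaluate_le hn hd hβ _ hy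
  · exact DensityInterp.isInterpolant_compressed hd hn hβ hL _
  · exact DensityInterp.measurable_compressed hn hβ hL hfm y
  · exact DensityInterp.measurable_supDist hn hβ hL hfm f
  · exact DensityInterp.lintegral_supDist_lt hn hd hβ hL hc hfm htail hlevel hf
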